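/- Let $\mathcal L:\mathbb R[x]\to \mathrm{Sym}(\mathbb R^{l\times l})$ be a linear map, and for matrix-valued polynomials $Q(x)=\sum_j Q_jx^j$, $R(x)=\sum_k R_kx^k$ with coefficients in $\mathbb R^{l\times l}$ put $\langle Q,R\rangle=\sum_{j,k}Q_j\,\mathcal L(x^{j+k})\,R_k^t$. Assume that $\mathcal L$ is positive, i.e. $\langle Q,Q\rangle$ is positive definite for every $Q$ with highest coefficient $I_l$. Let $\{P_n\}_{n\ge 0}$ be its orthonormal polynomials: $P_n$ has degree at most $n$, the coefficient of $x^n$ in $P_n$ is lower triangular with positive diagonal entries, and $\langle P_n,P_m\rangle=\delta_{n,m}I_l$. Put $P_{-1}=0$, $A_n=\langle xP_{n-1},P_n\rangle$, $B_n=\langle xP_n,P_n\rangle$. Let $N\ge 0$ be an integer and let $\hat\Psi_N$ be the matrix-valued polynomial in $z$ $$\hat\Psi_N(z)=z^N\bigl(P_N(x)-2zA_N^tP_{N-1}(x)\bigr),\qquad x=\tfrac12\bigl(z+\tfrac1z\bigr).$$ **(a)** For $z\in\mathbb C$ with $|z|\le 1$ and $z\notin[-1,0)\cup(0,1]$ the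 matrix $\hat\Psi_N(z)$ is nonsingular. At each $z_0\in[-1,0)\cup(0,1]$ where $\hat\Psi_N(z_0)$ is singular, $\hat\Psi_N$ has a simple zero, i.e. $\hat\Psi_N(z)^{-1}$ has a simple pole at $z_0$. **(b)** There is a unique matrix-valued polynomial $W_N(x)$ with real coefficients such that $W_N(x)=\hat\Psi_N(1/z)^t\,\hat\Psi_N(z)$ for $x=\frac12(z+\frac1z)$ and all $z\in\mathbb C\setminus\{0\}$. It is invertible for $x\in(-1,1)$, and for every $f\in\mathbb R[x]$ the entries of $f(x)\sqrt{1-x^2}\,W_N(x)^{-1}$ are integrable on $(-1,1)$. Let $z_1,\dots,z_k$ be the distinct zeros of $\hat\Psi_N$ (points where it is singular) in $(-1,1)$; let $x_j=\frac12(z_j+\frac1{z_j})$ and let $E_j$ be the orthogonal projection onto $\ker\hat\Psi_N(z_j)$. The matrix $\frac{1}{2(z_j-1/z_j)}E_jW_N'(x_j)E_j+(I_l-E_j)$ is invertible; the canonical weight at $x_j$ is $$\rho_j=E_j\Bigl(\tfrac{1}{2(z_j-1/z_j)}E_jW_N'(x_j)E_j+(I_l-E_j)\Bigr)^{-1}.$$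 Then $A_{n+1}=\frac12I_l$ and $B_n=0$ for all $n\ge N$ if and only if $$\mathcal L(f)=\frac2\pi\int_{-1}^1 f(x)\sqrt{1-x^2}\,W_N(x)^{-1}\,dx+\sum_{j=1}^k f(x_j)\,\rho_j\qquad\text{for all } f\in\mathbb R[x].$$ **(c)** If $A_N\ne\frac12I_l$, then $\hat\Psi_N$ has degree $2N$. If $N\ge1$, $A_N=\frac12I_l$ and $B_{N-1}\ne0$, then $\hat\Psi_N$ has degree $2N-1$. Here the degree is the largest power of $z$ with a nonzero matrix coefficient, which need not be invertible. -/

import Mathlib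

open Polynomial

namespace MatrixOP

noncomputable section

/-! Matrix-valued polynomials with real coefficients are `l × l` matrices with entries in `ℝ[X]`. -/

/-- The matrix coefficient of `x ^ k` of a matrix-valued polynomial. -/
def coeffMat {l : ℕ} (Q : Matrix (Fin l) (Fin l) ℝ[X]) (k : ℕ) : Matrix (Fin l) (Fin l) ℝ :=
  Q.map fun p => p.coeff k

/-- The degree of a matrix-valued polynomial: the least `k` such that all its entries have degree
at most `k` (the matrix coefficient of `x ^ k` need not be invertible). -/
def matDegree {l : ℕ} (Q : Matrix (Fin l) (Fin l) ℝ[X]) : ℕ :=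
  Finset.univ.sup fun ij : Fin l × Fin l => (Q ij.1 ij.2).natDegree

/-- The value of a matrix-valued polynomial at a real point. -/
def evalR {l : ℕ} (Q : Matrix (Fin l) (Fin l) ℝ[X]) (x : ℝ) : Matrix (Fin l) (Fin l) ℝ :=
  Q.map fun p => p.eval x

/-- The value of a (real) matrix-valued polynomial at a complex point. -/
def evalC {l : ℕ} (Q : Matrix (Fin l) (Fin l) ℝ[X]) (z : ℂ) : Matrix (Fin l) (Fin l) ℂ :=
  Q.map fun p => aeval z p

/-- The matrix-valued inner product `⟨Q, R⟩ = ∑ j k, Q_j L(x ^ (j + k)) R_kᵗ`. -/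
def matInner {l : ℕ} (L : ℝ[X] →ₗ[ℝ] Matrix (Fin l) (Fin l) ℝ)
    (Q R : Matrix (Fin l) (Fin l) ℝ[X]) : Matrix (Fin l) (Fin l) ℝ :=
  ∑ j ∈ Finset.range (matDegree Q + 1), ∑ k ∈ Finset.range (matDegree R + 1),
    coeffMat Q j * L (X ^ (j + k)) * (coeffMat R k).transpose

/-- `L` is a positive matrix-valued functional: its values are symmetric matrices, and `⟨Q, Q⟩` is
positive definite for each matrix-valued polynomial `Q = x ^ k I + (terms of lower degree)`. -/
structure IsPositiveFunctional {l : ℕ} (L : ℝ[X] →ₗ[ℝ] Matrix (Fin l) (Fin l) ℝ) : Prop where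
  symm : ∀ f : ℝ[X], (L f).IsSymm
  pos : ∀ (k : ℕ) (Q : Matrix (Fin l) (Fin l) ℝ[X]),
    matDegree Q ≤ k → coeffMat Q k = 1 → (matInner L Q Q).PosDef

/-- `M` is lower triangular with positive diagonal entries. -/
def IsLowerPos {l : ℕ} (M : Matrix (Fin l) (Fin l) ℝ) : Prop :=
  (∀ i j, i < j → M i j = 0) ∧ ∀ i, 0 < M i i

/-- `P 0, P 1, …` are the orthonormal polynomials of `L`, normalized so that their highest
coefficients are lower triangular with positive diagonal entries. -/
structure IsOrthonormalSeq {l : ℕ} (L : ℝ[X] →ₗ[ℝ] Matrix (Fin l) (Fin l) ℝ)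
    (P : ℕ → Matrix (Fin l) (Fin l) ℝ[X]) : Prop where
  degree_le : ∀ n, matDegree (P n) ≤ n
  lead : ∀ n, IsLowerPos (coeffMat (P n) n)
  ortho : ∀ n m, matInner L (P n) (P m) = if n = m then 1 else 0

/-- `prevPoly P n` is `P (n - 1)`, with the convention that the polynomial of index `-1` is `0`. -/
def prevPoly {l : ℕ} (P : ℕ → Matrix (Fin l) (Fin l) ℝ[X]) : ℕ → Matrix (Fin l) (Fin l) ℝ[X]
  | 0 => 0
  | n + 1 => P n

/-- The recurrence coefficient `A_n = ⟨x P_{n-1}, P_n⟩`. -/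
def recA {l : ℕ} (L : ℝ[X] →ₗ[ℝ] Matrix (Fin l) (Fin l) ℝ)
    (P : ℕ → Matrix (Fin l) (Fin l) ℝ[X]) (n : ℕ) : Matrix (Fin l) (Fin l) ℝ :=
  matInner L ((X : ℝ[X]) • prevPoly P n) (P n)

/-- The recurrence coefficient `B_n = ⟨x P_n, P_n⟩`. -/
def recB {l : ℕ} (L : ℝ[X] →ₗ[ℝ] Matrix (Fin l) (Fin l) ℝ)
    (P : ℕ → Matrix (Fin l) (Fin l) ℝ[X]) (n : ℕ) : Matrix (Fin l) (Fin l) ℝ :=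
  matInner L ((X : ℝ[X]) • P n) (P n)

/-- For `p` of degree at most `N`, the polynomial `z ^ N * p ((z + 1/z) / 2)` in `z`
(see `aeval_pull`). -/
def pull (N : ℕ) (p : ℝ[X]) : ℝ[X] :=
  ∑ k ∈ Finset.range (N + 1), C (p.coeff k) * (C (1 / 2) * (X ^ 2 + 1)) ^ k * X ^ (N - k)

theorem aeval_pull (N : ℕ) (p : ℝ[X]) (hp : p.natDegree ≤ N) (z : ℂ) (hz : z ≠ 0) :
    aeval z (pull N p) = z ^ N * aeval ((z + z⁻¹) / 2) p := by
  rw [aeval_eq_sum_range' (Nat.lt_succ_of_le hp), pull, map_sum, Finset.mul_sum]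
  refine Finset.sum_congr rfl fun k hk => ?_
  have hk' : k ≤ N := Nat.lt_succ_iff.mp (Finset.mem_range.mp hk)
  have h1 : z ^ N = z ^ k * z ^ (N - k) := by rw [← pow_add, Nat.add_sub_cancel' hk']
  have h2 : (1 / 2 : ℂ) * (z ^ 2 + 1) = z * ((z + z⁻¹) / 2) := by field_simp
  have h3 : (algebraMap ℝ ℂ) (1 / 2) = 1 / 2 := by simp
  simp only [map_mul, map_pow, map_add, map_one, aeval_C, aeval_X, h3, h2, Algebra.smul_def]
  rw [h1, mul_pow]
  ring

/-- The matrix-valued polynomial `z ^ N (P_N(x) - 2 z A_Nᵗ P_{N-1}(x))`, `x = (z + 1/z) / 2`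
(see `evalC_psiHat`). -/
def psiHat {l : ℕ} (L : ℝ[X] →ₗ[ℝ] Matrix (Fin l) (Fin l) ℝ)
    (P : ℕ → Matrix (Fin l) (Fin l) ℝ[X]) (N : ℕ) : Matrix (Fin l) (Fin l) ℝ[X] :=
  (P N).map (pull N) -
    (2 * X : ℝ[X]) • ((recA L P N).transpose.map C * (prevPoly P N).map (pull N))

theorem natDegree_le_matDegree {l : ℕ} (Q : Matrix (Fin l) (Fin l) ℝ[X]) (i j : Fin l) :
    (Q i j).natDegree ≤ matDegree Q :=
  Finset.le_sup (f := fun ij : Fin l × Fin l => (Q ij.1 ij.2).natDegree) (Finset.mem_univ (i, j))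

theorem evalC_psiHat {l : ℕ} (L : ℝ[X] →ₗ[ℝ] Matrix (Fin l) (Fin l) ℝ)
    (P : ℕ → Matrix (Fin l) (Fin l) ℝ[X]) (hP : IsOrthonormalSeq L P) (N : ℕ) (z : ℂ)
    (hz : z ≠ 0) :
    evalC (psiHat L P N) z =
      z ^ N • (evalC (P N) ((z + z⁻¹) / 2) -
        (2 * z) • ((recA L P N).transpose.map Complex.ofReal *
          evalC (prevPoly P N) ((z + z⁻¹) / 2))) := by
  have hN : ∀ i j, ((P N) i j).natDegree ≤ N := fun i j =>
    (natDegree_le_matDegree _ i j).trans (hP.degree_le N)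
  have hprev : ∀ i j, ((prevPoly P N) i j).natDegree ≤ N := by
    intro i j
    cases N with
    | zero => simp [prevPoly]
    | succ n =>
      exact ((natDegree_le_matDegree _ i j).trans (hP.degree_le n)).trans (Nat.le_succ n)
  ext i j
  simp only [evalC, psiHat, Matrix.map_apply, Matrix.sub_apply, Matrix.smul_apply, smul_eq_mul,
    Matrix.mul_apply, map_sub, map_mul, map_sum, aeval_X, aeval_C, map_ofNat,
    aeval_pull N _ (hN i j) z hz, aeval_pull N _ (hprev _ j) z hz, Finset.mul_sum, mul_sub]
  congr 1
  refine Finset.sum_congr rfl fun k _ => ?_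
  simp only [Complex.coe_algebraMap]
  ring

/-- `F` has a pole of order `k` at `z₀`: `k` is the least positive integer such that
`(z - z₀) ^ k F(z)` has a finite nonzero limit at `z₀`. -/
def HasPoleOfOrder {l : ℕ} (F : ℂ → Matrix (Fin l) (Fin l) ℂ) (z₀ : ℂ) (k : ℕ) : Prop :=
  IsLeast {m : ℕ | 0 < m ∧ ∃ R : Matrix (Fin l) (Fin l) ℂ, R ≠ 0 ∧
    Filter.Tendsto (fun z => (z - z₀) ^ m • F z) (nhdsWithin z₀ {z₀}ᶜ) (nhds R)} k

/-- `F` has a simple zero at `z₀`: the inverse of `F` has a simple pole at `z₀`. -/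
def HasSimpleZero {l : ℕ} (F : ℂ → Matrix (Fin l) (Fin l) ℂ) (z₀ : ℂ) : Prop :=
  HasPoleOfOrder (fun z => (F z)⁻¹) z₀ 1

/-- `W` is the matrix-valued polynomial with `W(x) = Φ(1/z)ᵗ Φ(z)` for `x = (z + 1/z) / 2`. -/
def IsWeightPoly {l : ℕ} (Φ W : Matrix (Fin l) (Fin l) ℝ[X]) : Prop :=
  ∀ z : ℂ, z ≠ 0 → evalC W ((z + z⁻¹) / 2) = (evalC Φ z⁻¹).transpose * evalC Φ z

/-- The matrix of the orthogonal projection of Euclidean space onto the kernel of `M`. -/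
def kerProj {l : ℕ} (M : Matrix (Fin l) (Fin l) ℝ) : Matrix (Fin l) (Fin l) ℝ :=
  Matrix.toEuclideanLin.symm
    ((LinearMap.ker (Matrix.toEuclideanLin M)).starProjection :
      EuclideanSpace ℝ (Fin l) →ₗ[ℝ] EuclideanSpace ℝ (Fin l))

/-- The matrix `(2 (z₀ - 1/z₀))⁻¹ E₀ W'(x₀) E₀ + (I - E₀)`, where `E₀` is the orthogonal projection
onto the kernel of `Φ(z₀)` and `x₀ = (z₀ + 1/z₀) / 2`. -/
def canonicalMat {l : ℕ} (Φ W : Matrix (Fin l) (Fin l) ℝ[X]) (z₀ : ℝ) :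
    Matrix (Fin l) (Fin l) ℝ :=
  (1 / (2 * (z₀ - z₀⁻¹))) •
      (kerProj (evalR Φ z₀) * evalR (W.map fun p => derivative p) ((z₀ + z₀⁻¹) / 2) *
        kerProj (evalR Φ z₀)) +
    (1 - kerProj (evalR Φ z₀))

/-- The canonical weight at the zero `z₀` of `Φ`. -/
def canonicalWeight {l : ℕ} (Φ W : Matrix (Fin l) (Fin l) ℝ[X]) (z₀ : ℝ) :
    Matrix (Fin l) (Fin l) ℝ :=
  kerProj (evalR Φ z₀) * (canonicalMat Φ W z₀)⁻¹

/-- The finite set of zeros of `Φ` (points where `Φ` is singular) in `(-1, 1)`; it is meant for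
`Φ` whose determinant is not identically zero. -/
def zerosIn {l : ℕ} (Φ : Matrix (Fin l) (Fin l) ℝ[X]) : Finset ℝ :=
  Φ.det.roots.toFinset.filter fun z => -1 < z ∧ z < 1

end

end MatrixOP

/-! Write `F` for `psiHat L P N`, and `x = (z + 1/z)/2`. Everything rests on the three term
recurrence and its consequence, the Christoffel–Darboux formula `christoffel_darboux`.

Zeros. If `F(z) v = 0`, then `P_N(x) v = 2z w` with `w = A_Nᵗ P_{N-1}(x) v`. For nonreal `z` in the
closed disk, Christoffel–Darboux at `x` and its conjugate equates a nonpositive multiple of `∑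
|P_k(x) v|²` with `4|w|²`. Hence `w = 0`, and the recurrence run backwards gives `v = 0`. At a real
zero `s` the limiting formula `confluent` has the same sign structure and excludes Jordan chains of
length two (`no_double_zero`). Algebraically this yields `F K = (diskPoly * q) I` with `q` zero-free
on the closed disk (`exists_disk_denominator`): simple poles follow at once, and the residues of
`F⁻¹` can be read off from `K`. The same sign argument makes the canonical matrices invertible
(`det_canonicalMat_ne_zero`).

Weight. Continue `P_N` by the free recurrence (`A = 1/2`, `B = 0`) to polynomials `g_k`. Then `(1/z
- z) g_k(x) = z^{-(N+k+1)} F(z) - z^{N+k+1} F(1/z)` (`ev_freePoly`). Since `W = F(1/z)ᵗ F(z)`,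
multiplying by `W⁻¹` cancels one factor of `W`, and with `x = cos θ` the integral of `g_k W⁻¹ Qᵗ`
against `√(1 - x²)` becomes a contour integral over the unit circle. Its poles inside are `0` and
the zeros of `F`. The canonical masses cancel the residues at the zeros; the residue at `0` leaves
exactly the pairing an orthonormal polynomial has with a `Q` of no larger degree
(`ip_weightFunctional_freePoly`).

Equivalence. If the coefficients are free from `N` on, then `P_{N+k} = g_k`, so `L` and the weight
functional pair equally with `P_n` for `n ≥ N`; the recurrence carries this down to all `n`, and the
functionals agree (`functional_eq`). Conversely, if `L` is the weight functional, uniqueness of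
orthonormal polynomials gives `g_k = P_{N+k}` (`eq_freePoly`), and the free recurrence determines
the coefficients. Positivity of the weight functional is never proved separately.

Degree. The coefficient of `z^{2N}` is an invertible multiple of `1 - 4 A_Nᵗ A_N`, which vanishes
only for `A_N = 1/2`; in that case the next coefficient is an invertible multiple of `B_{N-1}`. -/

namespace MatrixOP

noncomputable section

variable {l : ℕ}

/-! ### Coefficients and degrees of matrix polynomials -/

theorem coeffMat_add (Q R : Matrix (Fin l) (Fin l) ℝ[X]) (k : ℕ) :
    coeffMat (Q + R) k = coeffMat Q k + coeffMat R k := by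
  ext i j; simp [coeffMat]

theorem coeffMat_sub (Q R : Matrix (Fin l) (Fin l) ℝ[X]) (k : ℕ) :
    coeffMat (Q - R) k = coeffMat Q k - coeffMat R k := by
  ext i j; simp [coeffMat]

theorem coeffMat_zero (k : ℕ) : coeffMat (0 : Matrix (Fin l) (Fin l) ℝ[X]) k = 0 := by
  ext i j; simp [coeffMat]

theorem coeffMat_map_C_mul (A : Matrix (Fin l) (Fin l) ℝ) (Q : Matrix (Fin l) (Fin l) ℝ[X])
    (k : ℕ) : coeffMat (A.map C * Q) k = A * coeffMat Q k := by
  ext i j; simp [coeffMat, Matrix.mul_apply]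

theorem coeffMat_X_smul_succ (Q : Matrix (Fin l) (Fin l) ℝ[X]) (k : ℕ) :
    coeffMat ((X : ℝ[X]) • Q) (k + 1) = coeffMat Q k := by
  ext i j; simp [coeffMat]

theorem coeffMat_X_smul_zero (Q : Matrix (Fin l) (Fin l) ℝ[X]) :
    coeffMat ((X : ℝ[X]) • Q) 0 = 0 := by
  ext i j; simp [coeffMat]

theorem coeffMat_ext {Q R : Matrix (Fin l) (Fin l) ℝ[X]}
    (h : ∀ k, coeffMat Q k = coeffMat R k) : Q = R := by
  ext i j k
  exact congrFun (congrFun (h k) i) j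

/-- All entries of `Q` have degree less than `n`. -/
def DegLT (Q : Matrix (Fin l) (Fin l) ℝ[X]) (n : ℕ) : Prop :=
  ∀ k, n ≤ k → coeffMat Q k = 0

theorem matDegree_le_iff {Q : Matrix (Fin l) (Fin l) ℝ[X]} {n : ℕ} :
    matDegree Q ≤ n ↔ DegLT Q (n + 1) := by
  constructor
  · intro h k hk
    ext i j
    exact coeff_eq_zero_of_natDegree_lt
      (lt_of_le_of_lt ((natDegree_le_matDegree Q i j).trans h) hk)
  · intro h
    refine Finset.sup_le fun ij _ => ?_
    refine natDegree_le_iff_coeff_eq_zero.mpr fun k hk => ?_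
    exact congrFun (congrFun (h k hk) ij.1) ij.2

theorem DegLT.mono {Q : Matrix (Fin l) (Fin l) ℝ[X]} {m n : ℕ} (h : DegLT Q m) (hmn : m ≤ n) :
    DegLT Q n := fun k hk => h k (hmn.trans hk)

theorem DegLT.eq_zero {Q : Matrix (Fin l) (Fin l) ℝ[X]} (h : DegLT Q 0) : Q = 0 :=
  coeffMat_ext fun k => by rw [h k (Nat.zero_le k), coeffMat_zero]

theorem DegLT.zero (n : ℕ) : DegLT (0 : Matrix (Fin l) (Fin l) ℝ[X]) n :=
  fun k _ => coeffMat_zero k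

theorem DegLT.add {Q R : Matrix (Fin l) (Fin l) ℝ[X]} {n : ℕ} (hQ : DegLT Q n) (hR : DegLT R n) :
    DegLT (Q + R) n := fun k hk => by rw [coeffMat_add, hQ k hk, hR k hk, add_zero]

theorem DegLT.sub {Q R : Matrix (Fin l) (Fin l) ℝ[X]} {n : ℕ} (hQ : DegLT Q n) (hR : DegLT R n) :
    DegLT (Q - R) n := fun k hk => by rw [coeffMat_sub, hQ k hk, hR k hk, sub_zero]

theorem DegLT.map_C_mul {Q : Matrix (Fin l) (Fin l) ℝ[X]} {n : ℕ} (hQ : DegLT Q n)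
    (A : Matrix (Fin l) (Fin l) ℝ) : DegLT (A.map C * Q) n :=
  fun k hk => by rw [coeffMat_map_C_mul, hQ k hk, mul_zero]

theorem DegLT.X_smul {Q : Matrix (Fin l) (Fin l) ℝ[X]} {n : ℕ} (hQ : DegLT Q n) :
    DegLT ((X : ℝ[X]) • Q) (n + 1) := by
  intro k hk
  obtain ⟨k, rfl⟩ : ∃ m, k = m + 1 := ⟨k - 1, by omega⟩
  rw [coeffMat_X_smul_succ, hQ k (by omega)]

theorem DegLT.pred {Q : Matrix (Fin l) (Fin l) ℝ[X]} {n : ℕ} (hQ : DegLT Q (n + 1))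
    (h : coeffMat Q n = 0) : DegLT Q n := by
  intro k hk
  rcases hk.eq_or_lt with rfl | hk
  · exact h
  · exact hQ k hk

/-! ### The matrix inner product -/

/-- The matrix inner product, entry by entry. -/
def ip (L : ℝ[X] →ₗ[ℝ] Matrix (Fin l) (Fin l) ℝ) (Q R : Matrix (Fin l) (Fin l) ℝ[X]) :
    Matrix (Fin l) (Fin l) ℝ :=
  Matrix.of fun a b => ∑ c, ∑ d, L (Q a c * R b d) c d

theorem ip_apply (L : ℝ[X] →ₗ[ℝ] Matrix (Fin l) (Fin l) ℝ) (Q R : Matrix (Fin l) (Fin l) ℝ[X])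
    (a b : Fin l) : ip L Q R a b = ∑ c, ∑ d, L (Q a c * R b d) c d := rfl

theorem sum_sum_comm {α β γ δ M : Type*} [AddCommMonoid M] (s : Finset α) (t : Finset β)
    (u : Finset γ) (v : Finset δ) (f : α → β → γ → δ → M) :
    ∑ a ∈ s, ∑ b ∈ t, ∑ c ∈ u, ∑ d ∈ v, f a b c d =
      ∑ c ∈ u, ∑ d ∈ v, ∑ a ∈ s, ∑ b ∈ t, f a b c d := by
  calc ∑ a ∈ s, ∑ b ∈ t, ∑ c ∈ u, ∑ d ∈ v, f a b c d
      = ∑ a ∈ s, ∑ c ∈ u, ∑ b ∈ t, ∑ d ∈ v, f a b c d :=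
        Finset.sum_congr rfl fun a _ => Finset.sum_comm
    _ = ∑ c ∈ u, ∑ a ∈ s, ∑ b ∈ t, ∑ d ∈ v, f a b c d := Finset.sum_comm
    _ = ∑ c ∈ u, ∑ a ∈ s, ∑ d ∈ v, ∑ b ∈ t, f a b c d :=
        Finset.sum_congr rfl fun c _ => Finset.sum_congr rfl fun a _ => Finset.sum_comm
    _ = ∑ c ∈ u, ∑ d ∈ v, ∑ a ∈ s, ∑ b ∈ t, f a b c d :=
        Finset.sum_congr rfl fun c _ => Finset.sum_comm

/-- The entrywise form has no degree-dependent summation ranges, so bilinearity becomes immediate.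
-/
theorem matInner_eq_ip (L : ℝ[X] →ₗ[ℝ] Matrix (Fin l) (Fin l) ℝ)
    (Q R : Matrix (Fin l) (Fin l) ℝ[X]) : matInner L Q R = ip L Q R := by
  ext a b
  have key : ∀ c d, L (Q a c * R b d) c d =
      ∑ j ∈ Finset.range (matDegree Q + 1), ∑ k ∈ Finset.range (matDegree R + 1),
        (Q a c).coeff j * L (X ^ (j + k)) c d * (R b d).coeff k := by
    intro c d
    conv_lhs =>
      rw [as_sum_range_C_mul_X_pow' (Q a c)
          (Nat.lt_succ_of_le (natDegree_le_matDegree Q a c)),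
        as_sum_range_C_mul_X_pow' (R b d)
          (Nat.lt_succ_of_le (natDegree_le_matDegree R b d)), Finset.sum_mul_sum]
    simp only [map_sum, Matrix.sum_apply]
    refine Finset.sum_congr rfl fun j _ => Finset.sum_congr rfl fun k _ => ?_
    have : C ((Q a c).coeff j) * X ^ j * (C ((R b d).coeff k) * X ^ k) =
        ((Q a c).coeff j * (R b d).coeff k) • (X : ℝ[X]) ^ (j + k) := by
      rw [smul_eq_C_mul, C_mul, pow_add]; ring
    rw [this, map_smul, Matrix.smul_apply, smul_eq_mul]; ring
  simp only [ip_apply, key, matInner, Matrix.sum_apply, Matrix.mul_apply, coeffMat,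
    Matrix.map_apply, Matrix.transpose_apply, Finset.sum_mul]
  rw [sum_sum_comm]
  exact Finset.sum_comm

variable (L : ℝ[X] →ₗ[ℝ] Matrix (Fin l) (Fin l) ℝ)

theorem ip_add_left (Q Q' R : Matrix (Fin l) (Fin l) ℝ[X]) :
    ip L (Q + Q') R = ip L Q R + ip L Q' R := by
  ext a b; simp [ip_apply, add_mul, Finset.sum_add_distrib]

theorem ip_sub_left (Q Q' R : Matrix (Fin l) (Fin l) ℝ[X]) :
    ip L (Q - Q') R = ip L Q R - ip L Q' R := by
  ext a b; simp [ip_apply, sub_mul, Finset.sum_sub_distrib]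

theorem ip_zero_left (R : Matrix (Fin l) (Fin l) ℝ[X]) : ip L 0 R = 0 := by
  ext a b; simp [ip_apply]

theorem ip_zero_right (R : Matrix (Fin l) (Fin l) ℝ[X]) : ip L R 0 = 0 := by
  ext a b; simp [ip_apply]

theorem ip_add_right (Q R R' : Matrix (Fin l) (Fin l) ℝ[X]) :
    ip L Q (R + R') = ip L Q R + ip L Q R' := by
  ext a b; simp [ip_apply, mul_add, Finset.sum_add_distrib]

theorem ip_sub_right (Q R R' : Matrix (Fin l) (Fin l) ℝ[X]) :
    ip L Q (R - R') = ip L Q R - ip L Q R' := by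
  ext a b; simp [ip_apply, mul_sub, Finset.sum_sub_distrib]

theorem ip_map_C_mul_left (A : Matrix (Fin l) (Fin l) ℝ) (Q R : Matrix (Fin l) (Fin l) ℝ[X]) :
    ip L (A.map C * Q) R = A * ip L Q R := by
  ext a b
  have key : ∀ c d, L ((A.map C * Q) a c * R b d) c d =
      ∑ i, A a i * L (Q i c * R b d) c d := by
    intro c d
    simp only [Matrix.mul_apply, Matrix.map_apply, Finset.sum_mul, map_sum, Matrix.sum_apply]
    refine Finset.sum_congr rfl fun i _ => ?_
    rw [mul_assoc, ← smul_eq_C_mul, map_smul, Matrix.smul_apply, smul_eq_mul]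
  rw [ip_apply, Matrix.mul_apply]
  simp_rw [key, ip_apply, Finset.mul_sum]
  rw [Finset.sum_comm (s := Finset.univ) (t := Finset.univ) (f := fun i c => ∑ d, A a i * _)]
  exact Finset.sum_congr rfl fun c _ => Finset.sum_comm

theorem ip_map_C_mul_right (A : Matrix (Fin l) (Fin l) ℝ) (Q R : Matrix (Fin l) (Fin l) ℝ[X]) :
    ip L Q (A.map C * R) = ip L Q R * A.transpose := by
  ext a b
  have key : ∀ c d, L (Q a c * (A.map C * R) b d) c d =
      ∑ i, L (Q a c * R i d) c d * A b i := by
    intro c d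
    simp only [Matrix.mul_apply, Matrix.map_apply, Finset.mul_sum, map_sum, Matrix.sum_apply]
    refine Finset.sum_congr rfl fun i _ => ?_
    rw [mul_left_comm, ← smul_eq_C_mul, map_smul, Matrix.smul_apply, smul_eq_mul, mul_comm]
  rw [ip_apply, Matrix.mul_apply]
  simp_rw [key, ip_apply, Finset.sum_mul, Matrix.transpose_apply]
  rw [Finset.sum_comm (s := Finset.univ) (t := Finset.univ) (f := fun i c => ∑ d, _ * A b i)]
  exact Finset.sum_congr rfl fun c _ => Finset.sum_comm

theorem ip_X_smul (Q R : Matrix (Fin l) (Fin l) ℝ[X]) :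
    ip L ((X : ℝ[X]) • Q) R = ip L Q ((X : ℝ[X]) • R) := by
  ext a b
  simp only [ip_apply, Matrix.smul_apply, smul_eq_mul]
  refine Finset.sum_congr rfl fun c _ => Finset.sum_congr rfl fun d _ => ?_
  rw [mul_comm X, mul_assoc]

theorem ip_transpose {L : ℝ[X] →ₗ[ℝ] Matrix (Fin l) (Fin l) ℝ} (hL : ∀ f, (L f).IsSymm)
    (Q R : Matrix (Fin l) (Fin l) ℝ[X]) : (ip L Q R).transpose = ip L R Q := by
  ext a b
  rw [Matrix.transpose_apply, ip_apply, ip_apply, Finset.sum_comm]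
  refine Finset.sum_congr rfl fun c _ => Finset.sum_congr rfl fun d _ => ?_
  rw [mul_comm, ← (hL (R a c * Q b d)).apply d c]

theorem ip_one_left_smul (f : ℝ[X]) : ip L (f • 1) 1 = L f := by
  ext a b
  simp only [ip_apply, Matrix.smul_apply, Matrix.one_apply, smul_eq_mul]
  rw [Finset.sum_eq_single a, Finset.sum_eq_single b] <;> simp +contextual [eq_comm]

end

noncomputable section

variable {l : ℕ}

/-! ### Lower triangular matrices with positive diagonal -/

theorem IsLowerPos.det_ne_zero {M : Matrix (Fin l) (Fin l) ℝ} (hM : IsLowerPos M) : M.det ≠ 0 := by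
  rw [Matrix.det_of_isLowerTriangular M fun i j h => hM.1 i j h]
  exact Finset.prod_ne_zero_iff.mpr fun i _ => (hM.2 i).ne'

theorem IsLowerPos.mul_inv {M : Matrix (Fin l) (Fin l) ℝ} (hM : IsLowerPos M) : M * M⁻¹ = 1 :=
  Matrix.mul_nonsing_inv _ (isUnit_iff_ne_zero.mpr hM.det_ne_zero)

theorem IsLowerPos.inv_mul {M : Matrix (Fin l) (Fin l) ℝ} (hM : IsLowerPos M) : M⁻¹ * M = 1 :=
  Matrix.nonsing_inv_mul _ (isUnit_iff_ne_zero.mpr hM.det_ne_zero)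

theorem diag_mul_of_lower {M K : Matrix (Fin l) (Fin l) ℝ} (hM : ∀ i j, i < j → M i j = 0)
    (hK : ∀ i j, i < j → K i j = 0) (i : Fin l) : (M * K) i i = M i i * K i i := by
  rw [Matrix.mul_apply]
  refine Finset.sum_eq_single i (fun j _ hj => ?_) (by simp)
  rcases lt_or_gt_of_ne hj with h | h
  · rw [hK j i h, mul_zero]
  · rw [hM i j h, zero_mul]

theorem IsLowerPos.mul {M K : Matrix (Fin l) (Fin l) ℝ} (hM : IsLowerPos M) (hK : IsLowerPos K) :
    IsLowerPos (M * K) := by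
  refine ⟨fun i j h => ?_, fun i => ?_⟩
  · rw [Matrix.mul_apply]
    refine Finset.sum_eq_zero fun k _ => ?_
    rcases lt_or_ge i k with h' | h'
    · rw [hM.1 i k h', zero_mul]
    · rw [hK.1 k j (lt_of_le_of_lt h' h), mul_zero]
  · rw [diag_mul_of_lower hM.1 hK.1]
    exact mul_pos (hM.2 i) (hK.2 i)

theorem IsLowerPos.inv {M : Matrix (Fin l) (Fin l) ℝ} (hM : IsLowerPos M) : IsLowerPos M⁻¹ := by
  have hlow : ∀ i j, i < j → M⁻¹ i j = 0 := by
    have : Invertible M := Matrix.invertibleOfIsUnitDet _ (isUnit_iff_ne_zero.mpr hM.det_ne_zero)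
    have h : M.BlockTriangular OrderDual.toDual := fun i j h => hM.1 i j h
    exact fun i j hij => Matrix.blockTriangular_inv_of_blockTriangular h hij
  refine ⟨hlow, fun i => ?_⟩
  have h1 := diag_mul_of_lower hM.1 hlow i
  rw [hM.mul_inv, Matrix.one_apply_eq] at h1
  exact pos_of_mul_pos_right (by rw [← h1]; exact one_pos) (hM.2 i).le

theorem IsLowerPos.smul {M : Matrix (Fin l) (Fin l) ℝ} (hM : IsLowerPos M) {c : ℝ} (hc : 0 < c) :
    IsLowerPos (c • M) :=
  ⟨fun i j h => by rw [Matrix.smul_apply, hM.1 i j h, smul_zero],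
    fun i => by rw [Matrix.smul_apply]; exact mul_pos hc (hM.2 i)⟩

/-- An orthogonal lower triangular matrix with positive diagonal is the identity. -/
theorem IsLowerPos.eq_one {M : Matrix (Fin l) (Fin l) ℝ} (hM : IsLowerPos M)
    (h : M.transpose * M = 1) : M = 1 := by
  -- The inverse is again lower triangular but equals the transpose, so `M` is diagonal with squares
  -- `1` on the diagonal.
  have hinv : M⁻¹ = M.transpose := Matrix.inv_eq_left_inv h
  have hup : ∀ i j, j < i → M i j = 0 := by
    intro i j hij
    have := hM.inv.1 j i hij
    rwa [hinv] at this
  have hd : ∀ i, M i i = 1 := by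
    intro i
    have h1 := diag_mul_of_lower (M := M.transpose) (K := M) (fun a b hab => hup b a hab) hM.1 i
    rw [h, Matrix.one_apply_eq, Matrix.transpose_apply] at h1
    nlinarith [hM.2 i]
  ext i j
  rcases lt_trichotomy i j with hij | rfl | hij
  · rw [hM.1 i j hij, Matrix.one_apply_ne hij.ne]
  · rw [hd, Matrix.one_apply_eq]
  · rw [hup i j hij, Matrix.one_apply_ne hij.ne']

/-! ### Orthonormal sequences -/

variable {L : ℝ[X] →ₗ[ℝ] Matrix (Fin l) (Fin l) ℝ} {P : ℕ → Matrix (Fin l) (Fin l) ℝ[X]}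

theorem IsOrthonormalSeq.degLT (hP : IsOrthonormalSeq L P) (n : ℕ) : DegLT (P n) (n + 1) :=
  matDegree_le_iff.mp (hP.degree_le n)

theorem IsOrthonormalSeq.ip_eq (hP : IsOrthonormalSeq L P) (n m : ℕ) :
    ip L (P n) (P m) = if n = m then 1 else 0 := by
  rw [← matInner_eq_ip, hP.ortho]

/-- One step of left division: the multiple is chosen to cancel the top coefficient. It drives all
inductions on the degree. -/
theorem DegLT.reduce {Q R : Matrix (Fin l) (Fin l) ℝ[X]} {n : ℕ} (hR : DegLT R (n + 1))
    (hl : IsLowerPos (coeffMat R n)) (hQ : DegLT Q (n + 1)) :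
    DegLT (Q - (coeffMat Q n * (coeffMat R n)⁻¹).map C * R) n :=
  DegLT.pred (hQ.sub (hR.map_C_mul _)) <| by
    rw [coeffMat_sub, coeffMat_map_C_mul, mul_assoc, hl.inv_mul, mul_one, sub_self]

theorem IsOrthonormalSeq.ip_eq_zero (hP : IsOrthonormalSeq L P) {n m : ℕ} (hmn : m ≤ n)
    {Q : Matrix (Fin l) (Fin l) ℝ[X]} (hQ : DegLT Q m) : ip L (P n) Q = 0 := by
  induction m generalizing Q with
  | zero => rw [hQ.eq_zero, ip_zero_right]
  | succ m ih =>
    have h := ih (by omega) (DegLT.reduce (hP.degLT m) (hP.lead m) hQ)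
    rw [ip_sub_right, ip_map_C_mul_right, hP.ip_eq, if_neg (by omega), zero_mul, sub_zero] at h
    exact h

/-- The inner product of `P n` with a polynomial of degree at most `n`. -/
theorem IsOrthonormalSeq.ip_of_degLT (hP : IsOrthonormalSeq L P) {n : ℕ}
    {Q : Matrix (Fin l) (Fin l) ℝ[X]} (hQ : DegLT Q (n + 1)) :
    ip L (P n) Q = ((coeffMat Q n) * (coeffMat (P n) n)⁻¹).transpose := by
  have h := hP.ip_eq_zero le_rfl (DegLT.reduce (hP.degLT n) (hP.lead n) hQ)
  rw [ip_sub_right, ip_map_C_mul_right, hP.ip_eq, if_pos rfl, one_mul, sub_eq_zero] at h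
  exact h

/-- A polynomial of degree less than `m` orthogonal to `P 0, …, P (m - 1)` is zero. -/
theorem IsOrthonormalSeq.eq_zero_of_ip (hP : IsOrthonormalSeq L P) {m : ℕ}
    {Q : Matrix (Fin l) (Fin l) ℝ[X]} (hQ : DegLT Q m) (h : ∀ k < m, ip L (P k) Q = 0) :
    Q = 0 := by
  induction m with
  | zero => exact hQ.eq_zero
  | succ m ih =>
    have h1 := h m (Nat.lt_succ_self m)
    rw [hP.ip_of_degLT hQ, Matrix.transpose_eq_zero] at h1
    have h2 : coeffMat Q m = 0 := by
      rw [← mul_one (coeffMat Q m), ← (hP.lead m).inv_mul, ← mul_assoc, h1, zero_mul]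
    exact ih (hQ.pred h2) fun k hk => h k (by omega)

theorem recA_succ_eq (n : ℕ) : recA L P (n + 1) = ip L ((X : ℝ[X]) • P n) (P (n + 1)) :=
  matInner_eq_ip _ _ _

theorem recA_zero_eq : recA L P 0 = 0 := by
  rw [recA, matInner_eq_ip, prevPoly, smul_zero, ip_zero_left]

theorem recB_eq (n : ℕ) : recB L P n = ip L ((X : ℝ[X]) • P n) (P n) := matInner_eq_ip _ _ _

theorem IsPositiveFunctional.recB_transpose (hL : IsPositiveFunctional L) (n : ℕ) :
    (recB L P n).transpose = recB L P n := by
  rw [recB_eq, ip_transpose hL.symm, ip_X_smul]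

/-- The three term recurrence. -/
theorem IsOrthonormalSeq.recurrence (hP : IsOrthonormalSeq L P) (hL : IsPositiveFunctional L)
    (n : ℕ) : (X : ℝ[X]) • P n = (recA L P (n + 1)).map C * P (n + 1) +
      (recB L P n).map C * P n + (recA L P n).transpose.map C * prevPoly P n := by
  have hprev : DegLT (prevPoly P n) (n + 2) := by
    cases n with
    | zero => exact DegLT.zero _
    | succ n => exact (hP.degLT n).mono (by omega)
  rw [← sub_eq_zero]
  -- Both sides have degree at most `n + 1`, so it suffices to pair with `P 0, …, P (n + 1)`.
  refine hP.eq_zero_of_ip (m := n + 2) ?_ fun k hk => ?_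
  · exact (hP.degLT n).X_smul.sub ((((hP.degLT (n + 1)).map_C_mul _).add
      (((hP.degLT n).mono (by omega)).map_C_mul _)).add (hprev.map_C_mul _))
  · rw [ip_sub_right, ip_add_right, ip_add_right, ip_map_C_mul_right, ip_map_C_mul_right,
      ip_map_C_mul_right, hP.ip_eq, hP.ip_eq, Matrix.transpose_transpose, sub_eq_zero,
      recA_succ_eq, recB_eq, ip_transpose hL.symm, ip_transpose hL.symm]
    rcases (by omega : k = n + 1 ∨ k = n ∨ k < n) with rfl | rfl | hk'
    · have : ip L (P (n + 1)) (prevPoly P n) = 0 := by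
        cases n with
        | zero => exact ip_zero_right _ _
        | succ n => rw [prevPoly, hP.ip_eq, if_neg (by omega)]
      simp [this]
    · have : ip L (P k) (prevPoly P k) = 0 := by
        cases k with
        | zero => exact ip_zero_right _ _
        | succ n => rw [prevPoly, hP.ip_eq, if_neg (by omega)]
      simp [this]
    · rw [if_neg (by omega), if_neg (by omega), zero_mul, zero_mul, zero_add, zero_add]
      obtain ⟨n, rfl⟩ : ∃ m, n = m + 1 := ⟨n - 1, by omega⟩
      rw [prevPoly, hP.ip_eq, recA_succ_eq]
      rcases (by omega : k = n ∨ k < n) with rfl | hk''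
      · rw [if_pos rfl, one_mul, ip_X_smul]
      -- Moving `X` across, `X P_k` has too small a degree to meet `P (n + 1)`.
      · rw [if_neg (by omega), zero_mul, ← ip_X_smul, ← ip_transpose hL.symm,
          hP.ip_eq_zero le_rfl ((hP.degLT k).X_smul.mono (by omega)), Matrix.transpose_zero]

theorem IsOrthonormalSeq.lead_eq (hP : IsOrthonormalSeq L P) (hL : IsPositiveFunctional L)
    (n : ℕ) : coeffMat (P n) n = recA L P (n + 1) * coeffMat (P (n + 1)) (n + 1) := by
  have h := congrArg (coeffMat · (n + 1)) (hP.recurrence hL n)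
  have hprev : coeffMat (prevPoly P n) (n + 1) = 0 := by
    cases n with
    | zero => exact coeffMat_zero _
    | succ n => exact hP.degLT n _ (by omega)
  simpa only [coeffMat_X_smul_succ, coeffMat_add, coeffMat_map_C_mul,
    hP.degLT n (n + 1) le_rfl, hprev, mul_zero, add_zero] using h

/-- Comparing top coefficients in the recurrence makes `A_{n+1}` a quotient of two leading
coefficients. -/
theorem IsOrthonormalSeq.recA_lowerPos (hP : IsOrthonormalSeq L P) (hL : IsPositiveFunctional L)
    (n : ℕ) : IsLowerPos (recA L P (n + 1)) := by
  have h : recA L P (n + 1) = coeffMat (P n) n * (coeffMat (P (n + 1)) (n + 1))⁻¹ := by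
    rw [hP.lead_eq hL n, mul_assoc, (hP.lead (n + 1)).mul_inv, mul_one]
  rw [h]
  exact (hP.lead n).mul (hP.lead (n + 1)).inv

/-! ### Evaluation in commutative algebras -/

section Eval

variable {𝕜 : Type*} [CommRing 𝕜] [Algebra ℝ 𝕜]

/-- Evaluation of matrix polynomials at a point of a commutative algebra. -/
def ev (x : 𝕜) : Matrix (Fin l) (Fin l) ℝ[X] →ₐ[ℝ] Matrix (Fin l) (Fin l) 𝕜 :=
  (aeval x : ℝ[X] →ₐ[ℝ] 𝕜).mapMatrix

theorem ev_apply (x : 𝕜) (Q : Matrix (Fin l) (Fin l) ℝ[X]) (i j : Fin l) :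
    ev x Q i j = aeval x (Q i j) := rfl

theorem evalC_eq_ev (Q : Matrix (Fin l) (Fin l) ℝ[X]) (z : ℂ) : evalC Q z = ev z Q := rfl

theorem evalR_eq_ev (Q : Matrix (Fin l) (Fin l) ℝ[X]) (x : ℝ) : evalR Q x = ev x Q := by
  ext i j
  simp [evalR, ev_apply, coe_aeval_eq_eval]

theorem ev_map_C (x : 𝕜) (A : Matrix (Fin l) (Fin l) ℝ) :
    ev x (A.map C) = A.map (algebraMap ℝ 𝕜) := by
  ext i j; simp [ev_apply]

theorem ev_smul (x : 𝕜) (p : ℝ[X]) (Q : Matrix (Fin l) (Fin l) ℝ[X]) :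
    ev x (p • Q) = aeval x p • ev x Q := by
  ext i j; simp [ev_apply]

theorem ev_transpose (x : 𝕜) (Q : Matrix (Fin l) (Fin l) ℝ[X]) :
    ev x Q.transpose = (ev x Q).transpose := rfl

theorem IsOrthonormalSeq.ev_recurrence (hP : IsOrthonormalSeq L P) (hL : IsPositiveFunctional L)
    (n : ℕ) (x : 𝕜) : x • ev x (P n) =
      (recA L P (n + 1)).map (algebraMap ℝ 𝕜) * ev x (P (n + 1)) +
      (recB L P n).map (algebraMap ℝ 𝕜) * ev x (P n) +
      ((recA L P n).map (algebraMap ℝ 𝕜)).transpose * ev x (prevPoly P n) := by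
  have h := congrArg (ev x) (hP.recurrence hL n)
  rwa [ev_smul, aeval_X, map_add, map_add, map_mul, map_mul, map_mul, ev_map_C, ev_map_C,
    ev_map_C, Matrix.transpose_map] at h

/-- The Christoffel–Darboux formula. -/
theorem IsOrthonormalSeq.christoffel_darboux (hP : IsOrthonormalSeq L P)
    (hL : IsPositiveFunctional L) (n : ℕ) (x y : 𝕜) :
    (x - y) • ∑ k ∈ Finset.range n, (ev y (P k)).transpose * ev x (P k) =
      (ev y (prevPoly P n)).transpose * (recA L P n).map (algebraMap ℝ 𝕜) * ev x (P n) -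
      (ev y (P n)).transpose * ((recA L P n).map (algebraMap ℝ 𝕜)).transpose *
        ev x (prevPoly P n) := by
  induction n with
  | zero => simp [prevPoly]
  | succ n ih =>
    have hx := hP.ev_recurrence hL n x
    have hy := congrArg Matrix.transpose (hP.ev_recurrence hL n y)
    -- Symmetry of `B_n` is what cancels the middle terms of the two recurrences.
    have hB : ((recB L P n).map (algebraMap ℝ 𝕜)).transpose = (recB L P n).map (algebraMap ℝ 𝕜) := by
      rw [← Matrix.transpose_map, hL.recB_transpose]
    simp only [Matrix.transpose_add, Matrix.transpose_mul, Matrix.transpose_smul,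
      Matrix.transpose_transpose, hB] at hy
    have h : (x - y) • ((ev y (P n)).transpose * ev x (P n)) =
        (ev y (P n)).transpose * (x • ev x (P n)) - (y • (ev y (P n)).transpose) * ev x (P n) := by
      rw [sub_smul, mul_smul_comm, smul_mul_assoc]
    rw [Finset.sum_range_succ, smul_add, ih, h, hx, hy, prevPoly]
    noncomm_ring

/-- A common null vector of `P n (x)` and `A_nᵗ P_{n-1} (x)` vanishes. -/
theorem IsOrthonormalSeq.eq_zero_of_mulVec (hP : IsOrthonormalSeq L P)
    (hL : IsPositiveFunctional L) (n : ℕ) (x : 𝕜) (v : Fin l → 𝕜)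
    (h1 : (ev x (P n)).mulVec v = 0)
    (h2 : (((recA L P n).map (algebraMap ℝ 𝕜)).transpose * ev x (prevPoly P n)).mulVec v = 0) :
    v = 0 := by
  induction n with
  | zero =>
    have h0 : ev x (P 0) = (coeffMat (P 0) 0).map (algebraMap ℝ 𝕜) := by
      rw [← ev_map_C]
      congr 1
      refine coeffMat_ext fun k => ?_
      cases k with
      | zero => ext i j; simp [coeffMat]
      | succ k =>
        rw [hP.degLT 0 (k + 1) (by omega)]
        ext i j; simp [coeffMat]
    have hi : (coeffMat (P 0) 0)⁻¹.map (algebraMap ℝ 𝕜) * ev x (P 0) = 1 := by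
      rw [h0, ← Matrix.map_mul, (hP.lead 0).inv_mul]
      simp
    rw [← Matrix.one_mulVec v, ← hi, ← Matrix.mulVec_mulVec, h1, Matrix.mulVec_zero]
  | succ n ih =>
    have h3 : (ev x (P n)).mulVec v = 0 := by
      have hA := hP.recA_lowerPos hL n
      have hi : (recA L P (n + 1))⁻¹.transpose.map (algebraMap ℝ 𝕜) *
          ((recA L P (n + 1)).map (algebraMap ℝ 𝕜)).transpose = 1 := by
        rw [← Matrix.transpose_map, ← Matrix.map_mul, ← Matrix.transpose_mul, hA.mul_inv]
        simp
      rw [prevPoly] at h2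
      rw [← Matrix.one_mulVec (Matrix.mulVec _ v), ← hi, ← Matrix.mulVec_mulVec,
        Matrix.mulVec_mulVec _ _ (ev x (P n)), h2, Matrix.mulVec_zero]
    refine ih h3 ?_
    -- With `P (n + 1)` and `P n` both killing `v`, only the last term of the recurrence survives.
    have h4 := congrArg (Matrix.mulVec · v) (hP.ev_recurrence hL n x)
    simp only [Matrix.add_mulVec, Matrix.smul_mulVec, ← Matrix.mulVec_mulVec, h1, h3,
      Matrix.mulVec_zero, smul_zero, zero_add] at h4
    rw [← Matrix.mulVec_mulVec, ← h4]

end Eval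

end

noncomputable section

variable {l : ℕ}

/-! ### The polynomials `z ^ n p((z + 1/z) / 2)` -/

theorem pull_zero (p : ℝ[X]) : pull 0 p = C (p.coeff 0) := by
  simp [pull]

theorem pull_succ (n : ℕ) (p : ℝ[X]) :
    pull (n + 1) p = X * pull n p + C (p.coeff (n + 1)) * (C (1 / 2) * (X ^ 2 + 1)) ^ (n + 1) := by
  rw [pull, Finset.sum_range_succ, Nat.sub_self, pow_zero, mul_one, pull, Finset.mul_sum]
  congr 1
  refine Finset.sum_congr rfl fun k hk => ?_
  rw [Nat.succ_sub (Nat.lt_succ_iff.mp (Finset.mem_range.mp hk)), Nat.succ_eq_add_one, pow_succ X]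
  ring

theorem natDegree_half_X_sq_add_one_pow_le (n : ℕ) :
    ((C (1 / 2 : ℝ) * (X ^ 2 + 1)) ^ n).natDegree ≤ 2 * n := by
  refine natDegree_pow_le.trans ?_
  rw [mul_comm]
  refine Nat.mul_le_mul_right n ?_
  compute_degree

theorem coeff_half_X_sq_add_one_pow (n : ℕ) :
    ((C (1 / 2 : ℝ) * (X ^ 2 + 1)) ^ n).coeff (2 * n) = (1 / 2) ^ n := by
  rw [mul_comm 2 n, coeff_pow_of_natDegree_le (by compute_degree)]
  simp [coeff_one]

/-- The power is a polynomial in `X ^ 2`, so odd coefficients vanish. -/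
theorem coeff_half_X_sq_add_one_pow_pred (n : ℕ) :
    ((C (1 / 2 : ℝ) * (X ^ 2 + 1)) ^ (n + 1)).coeff (2 * n + 1) = 0 := by
  induction n with
  | zero => simp [coeff_one, coeff_X_pow]
  | succ n ih =>
    have : (C (1 / 2 : ℝ) * (X ^ 2 + 1)) ^ (n + 1 + 1) =
        C (1 / 2) * ((C (1 / 2 : ℝ) * (X ^ 2 + 1)) ^ (n + 1) * X ^ 2) +
        C (1 / 2) * ((C (1 / 2 : ℝ) * (X ^ 2 + 1)) ^ (n + 1)) := by ring
    rw [this, coeff_add, coeff_C_mul, coeff_C_mul, show 2 * (n + 1) + 1 = 2 * n + 1 + 2 by ring,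
      coeff_mul_X_pow, ih, coeff_eq_zero_of_natDegree_lt
        (lt_of_le_of_lt (natDegree_half_X_sq_add_one_pow_le (n + 1)) (by omega))]
    simp

theorem natDegree_pull_le (n : ℕ) (p : ℝ[X]) : (pull n p).natDegree ≤ 2 * n := by
  induction n with
  | zero => simp [pull_zero]
  | succ n ih =>
    rw [pull_succ]
    refine natDegree_add_le_of_degree_le ?_ ?_
    · exact natDegree_mul_le.trans (by rw [natDegree_X]; omega)
    · exact (natDegree_C_mul_le _ _).trans (natDegree_half_X_sq_add_one_pow_le _)

theorem coeff_pull_top (n : ℕ) (p : ℝ[X]) :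
    (pull n p).coeff (2 * n) = (1 / 2) ^ n * p.coeff n := by
  cases n with
  | zero => simp [pull_zero]
  | succ n =>
    rw [pull_succ, coeff_add, coeff_C_mul, coeff_half_X_sq_add_one_pow,
      show 2 * (n + 1) = 2 * n + 1 + 1 by ring, coeff_X_mul,
      coeff_eq_zero_of_natDegree_lt (lt_of_le_of_lt (natDegree_pull_le n p) (by omega))]
    ring

theorem coeff_pull_pred (n : ℕ) (p : ℝ[X]) :
    (pull (n + 1) p).coeff (2 * n + 1) = (1 / 2) ^ n * p.coeff n := by
  rw [pull_succ, coeff_add, coeff_C_mul, coeff_half_X_sq_add_one_pow_pred, coeff_X_mul,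
    coeff_pull_top]
  ring

theorem eval_zero_pull (n : ℕ) (p : ℝ[X]) : (pull n p).eval 0 = (1 / 2) ^ n * p.coeff n := by
  cases n with
  | zero => simp [pull_zero]
  | succ n => rw [pull_succ]; simp; ring

section

variable {𝕜 : Type*} [Field 𝕜] [Algebra ℝ 𝕜]

/-- Valid over any field extension of `ℝ`, because real zeros are treated over `ℝ` and the circle
over `ℂ`. -/
theorem aeval_pull_of_ne_zero (N : ℕ) (p : ℝ[X]) (hp : p.natDegree ≤ N) (z : 𝕜) (hz : z ≠ 0) :
    aeval z (pull N p) = z ^ N * aeval ((z + z⁻¹) / 2) p := by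
  have : CharZero 𝕜 := charZero_of_injective_algebraMap (algebraMap ℝ 𝕜).injective
  rw [aeval_eq_sum_range' (Nat.lt_succ_of_le hp), pull, map_sum, Finset.mul_sum]
  refine Finset.sum_congr rfl fun k hk => ?_
  have hk' : k ≤ N := Nat.lt_succ_iff.mp (Finset.mem_range.mp hk)
  have h1 : z ^ N = z ^ k * z ^ (N - k) := by rw [← pow_add, Nat.add_sub_cancel' hk']
  have h2 : (1 / 2 : 𝕜) * (z ^ 2 + 1) = z * ((z + z⁻¹) / 2) := by field_simp
  have h3 : (algebraMap ℝ 𝕜) (1 / 2) = 1 / 2 := by rw [map_div₀, map_one, map_ofNat]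
  simp only [map_mul, map_pow, map_add, map_one, aeval_C, aeval_X, h3, h2, Algebra.smul_def]
  rw [h1, mul_pow]
  ring

theorem ev_map_pull {N : ℕ} {Q : Matrix (Fin l) (Fin l) ℝ[X]} (hQ : DegLT Q (N + 1)) {z : 𝕜}
    (hz : z ≠ 0) : ev z (Q.map (pull N)) = z ^ N • ev ((z + z⁻¹) / 2) Q := by
  ext i j
  exact aeval_pull_of_ne_zero N _ ((natDegree_le_matDegree Q i j).trans (matDegree_le_iff.mpr hQ))
    z hz

variable {L : ℝ[X] →ₗ[ℝ] Matrix (Fin l) (Fin l) ℝ} {P : ℕ → Matrix (Fin l) (Fin l) ℝ[X]}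

theorem IsOrthonormalSeq.prevPoly_degLT (hP : IsOrthonormalSeq L P) (N : ℕ) :
    DegLT (prevPoly P N) N := by
  cases N with
  | zero => exact DegLT.zero _
  | succ n => exact hP.degLT n

theorem IsOrthonormalSeq.ev_psiHat (hP : IsOrthonormalSeq L P) (N : ℕ) {z : 𝕜} (hz : z ≠ 0) :
    ev z (psiHat L P N) = z ^ N • (ev ((z + z⁻¹) / 2) (P N) -
      (2 * z) • (((recA L P N).map (algebraMap ℝ 𝕜)).transpose *
        ev ((z + z⁻¹) / 2) (prevPoly P N))) := by
  rw [psiHat, map_sub, ev_smul, map_mul (ev z), ev_map_pull (hP.degLT N) hz,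
    ev_map_pull ((hP.prevPoly_degLT N).mono (Nat.le_succ N)) hz, ev_map_C, smul_sub,
    Matrix.transpose_map, mul_smul_comm, smul_comm (z ^ N), map_mul, aeval_X, map_ofNat]

end

variable {L : ℝ[X] →ₗ[ℝ] Matrix (Fin l) (Fin l) ℝ} {P : ℕ → Matrix (Fin l) (Fin l) ℝ[X]}

/-! ### Top coefficients and degree of `psiHat`. -/

theorem coeffMat_map_pull_top (n : ℕ) (Q : Matrix (Fin l) (Fin l) ℝ[X]) :
    coeffMat (Q.map (pull n)) (2 * n) = (1 / 2 : ℝ) ^ n • coeffMat Q n := by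
  ext i j; exact coeff_pull_top n _

theorem coeffMat_map_pull_pred (n : ℕ) (Q : Matrix (Fin l) (Fin l) ℝ[X]) :
    coeffMat (Q.map (pull (n + 1))) (2 * n + 1) = (1 / 2 : ℝ) ^ n • coeffMat Q n := by
  ext i j; exact coeff_pull_pred n _

theorem degLT_map_pull (n : ℕ) (Q : Matrix (Fin l) (Fin l) ℝ[X]) :
    DegLT (Q.map (pull n)) (2 * n + 1) := by
  intro k hk
  ext i j
  exact coeff_eq_zero_of_natDegree_lt (lt_of_le_of_lt (natDegree_pull_le n _) hk)

theorem ev_zero_map_pull (n : ℕ) (Q : Matrix (Fin l) (Fin l) ℝ[X]) :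
    ev (0 : ℝ) (Q.map (pull n)) = (1 / 2 : ℝ) ^ n • coeffMat Q n := by
  ext i j
  simp only [ev_apply, Matrix.map_apply, coe_aeval_eq_eval, eval_zero_pull]
  rfl

theorem map_pull_succ {n : ℕ} {Q : Matrix (Fin l) (Fin l) ℝ[X]} (hQ : DegLT Q (n + 1)) :
    Q.map (pull (n + 1)) = (X : ℝ[X]) • Q.map (pull n) := by
  ext1 i j
  have h : (Q i j).coeff (n + 1) = 0 := congrFun (congrFun (hQ (n + 1) le_rfl) i) j
  rw [Matrix.map_apply, pull_succ, h]
  simp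

/-- The value at the origin. -/
theorem ev_zero_psiHat (N : ℕ) :
    ev (0 : ℝ) (psiHat L P N) = (1 / 2 : ℝ) ^ N • coeffMat (P N) N := by
  rw [psiHat, map_sub, ev_smul, ev_zero_map_pull]
  simp

theorem psiHat_zero : psiHat L P 0 = (P 0).map (pull 0) := by
  rw [psiHat, recA_zero_eq]
  simp [Matrix.map_zero, prevPoly]

/-- `P n` has degree at most `n` but is pulled back with exponent `n + 1`; this supplies the second
factor `X`. -/
theorem IsOrthonormalSeq.psiHat_succ (hP : IsOrthonormalSeq L P) (n : ℕ) :
    psiHat L P (n + 1) = (P (n + 1)).map (pull (n + 1)) - (X : ℝ[X]) • (X : ℝ[X]) •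
      (((2 : ℝ) • (recA L P (n + 1)).transpose).map C * (P n).map (pull n)) := by
  rw [psiHat, prevPoly, map_pull_succ (hP.degLT n)]
  congr 1
  rw [show ((2 : ℝ) • (recA L P (n + 1)).transpose).map C =
    (2 : ℝ[X]) • (recA L P (n + 1)).transpose.map C by ext1 i j; simp [C_ofNat],
    Matrix.smul_mul, mul_smul_comm, mul_smul, smul_comm 2 (X : ℝ[X]), smul_comm 2 (X : ℝ[X])]

theorem IsOrthonormalSeq.psiHat_degLT (hP : IsOrthonormalSeq L P) (N : ℕ) :
    DegLT (psiHat L P N) (2 * N + 1) := by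
  cases N with
  | zero => rw [psiHat_zero]; exact degLT_map_pull 0 _
  | succ n =>
    rw [hP.psiHat_succ]
    exact (degLT_map_pull _ _).sub ((degLT_map_pull n _).map_C_mul _).X_smul.X_smul

/-- Both terms contribute; `lead_eq` expresses the leading coefficient of `P (N - 1)` through that
of `P N`. -/
theorem IsOrthonormalSeq.coeffMat_psiHat_top (hP : IsOrthonormalSeq L P)
    (hL : IsPositiveFunctional L) (N : ℕ) :
    coeffMat (psiHat L P N) (2 * N) = (1 / 2 : ℝ) ^ N •
      ((1 - (4 : ℝ) • ((recA L P N).transpose * recA L P N)) * coeffMat (P N) N) := by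
  cases N with
  | zero =>
    rw [psiHat_zero, coeffMat_map_pull_top, recA_zero_eq]
    simp
  | succ n =>
    rw [hP.psiHat_succ, coeffMat_sub, coeffMat_map_pull_top,
      show 2 * (n + 1) = 2 * n + 1 + 1 by ring, coeffMat_X_smul_succ, coeffMat_X_smul_succ,
      coeffMat_map_C_mul, coeffMat_map_pull_top, hP.lead_eq hL n, pow_succ, sub_mul, one_mul,
      smul_sub, mul_smul_comm, smul_mul_assoc, smul_mul_assoc, smul_smul, smul_smul, mul_assoc, mul_assoc]
    congr 2
    ring

/-- The two subleading coefficients involved are related by the `x ^ n` coefficient of the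
recurrence; with `A = 1/2` everything cancels except the `B_n` term. -/
theorem IsOrthonormalSeq.coeffMat_psiHat_pred (hP : IsOrthonormalSeq L P)
    (hL : IsPositiveFunctional L) (n : ℕ)
    (hA : recA L P (n + 1) = (1 / 2 : ℝ) • (1 : Matrix (Fin l) (Fin l) ℝ)) :
    coeffMat (psiHat L P (n + 1)) (2 * n + 1) =
      -((2 * (1 / 2 : ℝ) ^ n) • (recB L P n * coeffMat (P n) n)) := by
  have hA2 : (2 : ℝ) • (recA L P (n + 1)).transpose = 1 := by
    rw [hA, Matrix.transpose_smul, smul_smul, Matrix.transpose_one]; norm_num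
  have h1 : (1 : Matrix (Fin l) (Fin l) ℝ).map (C : ℝ → ℝ[X]) = 1 := by simp
  rw [hP.psiHat_succ, coeffMat_sub, coeffMat_map_pull_pred, hA2, h1, one_mul]
  cases n with
  | zero =>
    have h := congrArg (coeffMat · 0) (hP.recurrence hL 0)
    simp only [coeffMat_X_smul_zero, coeffMat_add, coeffMat_map_C_mul, hA, prevPoly,
      mul_zero, add_zero] at h
    rw [show 2 * 0 + 1 = 0 + 1 by rfl, coeffMat_X_smul_succ, coeffMat_X_smul_zero, sub_zero,
      pow_zero, one_smul, mul_one, eq_neg_iff_add_eq_zero]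
    have h2 := congrArg ((2 : ℝ) • ·) h
    simp only [smul_zero, smul_add, smul_mul_assoc, one_mul, smul_smul] at h2
    rw [h2]; norm_num
  | succ n =>
    have h := congrArg (coeffMat · (n + 1)) (hP.recurrence hL (n + 1))
    simp only [coeffMat_X_smul_succ, coeffMat_add, coeffMat_map_C_mul, hA, prevPoly,
      hP.degLT n (n + 1) le_rfl, mul_zero, add_zero] at h
    rw [show 2 * (n + 1) + 1 = 2 * n + 1 + 1 + 1 by ring, coeffMat_X_smul_succ,
      coeffMat_X_smul_succ, coeffMat_map_pull_pred, h, pow_succ, smul_add, smul_mul_assoc, one_mul,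
      smul_smul]
    rw [show 2 * ((1 / 2 : ℝ) ^ n * (1 / 2)) = (1 / 2) ^ n by ring]
    abel

theorem matDegree_eq_of_coeffMat {Q : Matrix (Fin l) (Fin l) ℝ[X]} {n : ℕ} (h : DegLT Q (n + 1))
    (hn : coeffMat Q n ≠ 0) : matDegree Q = n := by
  refine le_antisymm (matDegree_le_iff.mpr h) ?_
  by_contra hlt
  exact hn (matDegree_le_iff.mp le_rfl n (by omega))

theorem IsLowerPos.eq_half {A : Matrix (Fin l) (Fin l) ℝ} (hA : IsLowerPos A)
    (h : (1 : Matrix (Fin l) (Fin l) ℝ) - (4 : ℝ) • (A.transpose * A) = 0) :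
    A = (1 / 2 : ℝ) • (1 : Matrix (Fin l) (Fin l) ℝ) := by
  have h2 : ((2 : ℝ) • A) = 1 := by
    refine (hA.smul two_pos).eq_one ?_
    rw [Matrix.transpose_smul, smul_mul_smul_comm, show (2 : ℝ) * 2 = 4 by norm_num,
      ← sub_eq_zero.mp h]
  rw [← h2, smul_smul]
  norm_num

theorem IsOrthonormalSeq.matDegree_psiHat (hP : IsOrthonormalSeq L P)
    (hL : IsPositiveFunctional L) (N : ℕ)
    (hA : recA L P N ≠ (1 / 2 : ℝ) • (1 : Matrix (Fin l) (Fin l) ℝ)) :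
    matDegree (psiHat L P N) = 2 * N := by
  refine matDegree_eq_of_coeffMat (hP.psiHat_degLT N) fun h => hA ?_
  rw [hP.coeffMat_psiHat_top hL, smul_eq_zero_iff_right (by positivity)] at h
  have h2 : (1 : Matrix (Fin l) (Fin l) ℝ) - (4 : ℝ) • ((recA L P N).transpose * recA L P N) = 0 := by
    rw [← mul_one (1 - _), ← (hP.lead N).mul_inv, ← mul_assoc, (hP.lead N).mul_inv, h, zero_mul]
  cases N with
  | zero =>
    -- Here `A_0 = 0`, so `h2` says `1 = 0`, which occurs only for matrices of size zero.
    rw [recA_zero_eq] at h2 ⊢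
    simp at h2
    rw [h2, smul_zero]
  | succ n => exact (hP.recA_lowerPos hL n).eq_half h2

theorem IsOrthonormalSeq.matDegree_psiHat_of_half (hP : IsOrthonormalSeq L P)
    (hL : IsPositiveFunctional L) (n : ℕ)
    (hA : recA L P (n + 1) = (1 / 2 : ℝ) • (1 : Matrix (Fin l) (Fin l) ℝ))
    (hB : recB L P n ≠ 0) : matDegree (psiHat L P (n + 1)) = 2 * n + 1 := by
  refine matDegree_eq_of_coeffMat ((hP.psiHat_degLT (n + 1)).pred ?_) fun h => hB ?_
  · rw [hP.coeffMat_psiHat_top hL, hA,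
      Matrix.transpose_smul, Matrix.transpose_one, smul_mul_smul_comm, smul_smul]
    norm_num
  · rw [hP.coeffMat_psiHat_pred hL n hA, neg_eq_zero, smul_eq_zero_iff_right (by positivity)] at h
    rw [← mul_one (recB L P n), ← (hP.lead n).mul_inv, ← mul_assoc, h, zero_mul]

end

noncomputable section

variable {l : ℕ} {L : ℝ[X] →ₗ[ℝ] Matrix (Fin l) (Fin l) ℝ} {P : ℕ → Matrix (Fin l) (Fin l) ℝ[X]}

/-! ### Nonsingularity off the real axis -/

theorem ev_ofReal (x : ℝ) (Q : Matrix (Fin l) (Fin l) ℝ[X]) :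
    ev (x : ℂ) Q = (ev x Q).map Complex.ofReal := by
  ext i j
  exact (aeval_algebraMap_apply ℂ x (Q i j))

theorem ev_conj (x : ℂ) (Q : Matrix (Fin l) (Fin l) ℝ[X]) :
    (ev ((starRingEnd ℂ) x) Q).transpose = (ev x Q).conjTranspose := by
  ext i j
  exact Polynomial.aeval_conj (Q j i) x

theorem det_ev_ofReal (x : ℝ) (Q : Matrix (Fin l) (Fin l) ℝ[X]) :
    (ev (x : ℂ) Q).det = ((ev x Q).det : ℂ) := by
  rw [ev_ofReal]
  exact (RingHom.map_det Complex.ofRealHom (ev x Q)).symm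

theorem det_ev {𝕜 : Type*} [CommRing 𝕜] [Algebra ℝ 𝕜] (x : 𝕜) (Q : Matrix (Fin l) (Fin l) ℝ[X]) :
    (ev x Q).det = aeval x Q.det :=
  (AlgHom.map_det (aeval x : ℝ[X] →ₐ[ℝ] 𝕜) Q).symm

theorem star_dotProduct_self (w : Fin l → ℂ) :
    star w ⬝ᵥ w = ((∑ i, Complex.normSq (w i) : ℝ) : ℂ) := by
  rw [dotProduct, Complex.ofReal_sum]
  exact Finset.sum_congr rfl fun i _ => Complex.normSq_eq_conj_mul_self.symm

theorem eq_zero_of_sum_normSq {w : Fin l → ℂ} (h : ∑ i, Complex.normSq (w i) = 0) : w = 0 := by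
  funext i
  exact Complex.normSq_eq_zero.mp
    ((Finset.sum_eq_zero_iff_of_nonneg fun i _ => Complex.normSq_nonneg _).mp h i (Finset.mem_univ i))

theorem IsOrthonormalSeq.mulVec_psiHat {𝕜 : Type*} [Field 𝕜] [Algebra ℝ 𝕜]
    (hP : IsOrthonormalSeq L P) (N : ℕ) {z : 𝕜} (hz : z ≠ 0) (v : Fin l → 𝕜) :
    (ev z (psiHat L P N)).mulVec v = z ^ N • ((ev ((z + z⁻¹) / 2) (P N)).mulVec v -
      (2 * z) • (((recA L P N).map (algebraMap ℝ 𝕜)).transpose *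
        ev ((z + z⁻¹) / 2) (prevPoly P N)).mulVec v) := by
  rw [hP.ev_psiHat N hz, Matrix.smul_mulVec, Matrix.sub_mulVec, Matrix.smul_mulVec]

/-- In the closed disk `x` and `z` have imaginary parts of weakly opposite sign; this is the sign
behind the nonsingularity. -/
theorem im_joukowski {z : ℂ} :
    ((z + z⁻¹) / 2).im = z.im * (1 - (Complex.normSq z)⁻¹) / 2 := by
  rw [show (z + z⁻¹) / 2 = ((2⁻¹ : ℝ) : ℂ) * (z + z⁻¹) by push_cast; ring,
    Complex.im_ofReal_mul, Complex.add_im, Complex.inv_im]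
  ring

/-- Sandwich Christoffel–Darboux at `x` and its conjugate between a null vector and its adjoint,
then compare imaginary parts: the signs force both sides to vanish. -/
theorem IsOrthonormalSeq.det_psiHat_ne_zero_of_im (hP : IsOrthonormalSeq L P)
    (hL : IsPositiveFunctional L) (N : ℕ) {z : ℂ} (hz : ‖z‖ ≤ 1) (him : z.im ≠ 0) :
    (ev z (psiHat L P N)).det ≠ 0 := by
  have hz0 : z ≠ 0 := by rintro rfl; simp at him
  intro hdet
  obtain ⟨v, hv0, hv⟩ := Matrix.exists_mulVec_eq_zero_iff.mpr hdet
  refine hv0 ?_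
  rw [hP.mulVec_psiHat N hz0, smul_eq_zero_iff_right (pow_ne_zero _ hz0), sub_eq_zero] at hv
  set x : ℂ := (z + z⁻¹) / 2 with hx
  set A : Matrix (Fin l) (Fin l) ℂ := (recA L P N).map (algebraMap ℝ ℂ) with hA
  set w := (A.transpose * ev x (prevPoly P N)).mulVec v with hw
  have hAH : A.conjTranspose = A.transpose := by
    ext i j; simp [hA]
  have h := congrArg (fun M => star v ⬝ᵥ Matrix.mulVec M v)
    (hP.christoffel_darboux hL N x ((starRingEnd ℂ) x))
  have hk : ∀ k, star v ⬝ᵥ ((ev ((starRingEnd ℂ) x) (P k)).transpose * ev x (P k)).mulVec v =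
      ((∑ i, Complex.normSq ((ev x (P k)).mulVec v i) : ℝ) : ℂ) := by
    intro k
    rw [← star_dotProduct_self, ev_conj, ← Matrix.mulVec_mulVec, Matrix.dotProduct_mulVec,
      Matrix.star_mulVec]
  have h1 : star v ⬝ᵥ ((ev ((starRingEnd ℂ) x) (prevPoly P N)).transpose * A *
      ev x (P N)).mulVec v = 2 * z * ((∑ i, Complex.normSq (w i) : ℝ) : ℂ) := by
    rw [← Matrix.mulVec_mulVec, hv, Matrix.mulVec_smul, dotProduct_smul, smul_eq_mul,
      ← star_dotProduct_self, ev_conj, Matrix.dotProduct_mulVec, hw, Matrix.star_mulVec,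
      Matrix.conjTranspose_mul, ← hAH, Matrix.conjTranspose_conjTranspose]
  have h2 : star v ⬝ᵥ ((ev ((starRingEnd ℂ) x) (P N)).transpose * A.transpose *
      ev x (prevPoly P N)).mulVec v =
      2 * (starRingEnd ℂ) z * ((∑ i, Complex.normSq (w i) : ℝ) : ℂ) := by
    rw [mul_assoc, ← Matrix.mulVec_mulVec, ev_conj, Matrix.dotProduct_mulVec, ← Matrix.star_mulVec,
      hv, star_smul, smul_dotProduct, ← hw, star_dotProduct_self]
    simp
  simp only [← hA] at h
  simp only [Matrix.smul_mulVec, Matrix.sub_mulVec, dotProduct_smul, dotProduct_sub, h1, h2,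
    Matrix.sum_mulVec, dotProduct_sum, hk, smul_eq_mul] at h
  rw [← Complex.ofReal_sum, ← sub_mul, ← mul_sub, Complex.sub_conj, Complex.sub_conj] at h
  set σ : ℝ := ∑ k ∈ Finset.range N, ∑ i, Complex.normSq ((ev x (P k)).mulVec v i) with hσ
  set ω : ℝ := ∑ i, Complex.normSq (w i) with hω
  have hσ0 : 0 ≤ σ := Finset.sum_nonneg fun k _ => Finset.sum_nonneg fun i _ =>
    Complex.normSq_nonneg _
  have hω0 : 0 ≤ ω := Finset.sum_nonneg fun i _ => Complex.normSq_nonneg _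
  have h3 := congrArg Complex.im h
  have h4 : 2 * x.im * σ = 2 * (2 * z.im) * ω := by
    simpa [Complex.mul_im, Complex.mul_re] using h3
  rw [hx, im_joukowski] at h4
  have hn0 : 0 < Complex.normSq z := Complex.normSq_pos.mpr hz0
  have hn1 : 1 ≤ (Complex.normSq z)⁻¹ := by
    rw [one_le_inv₀ hn0, Complex.normSq_eq_norm_sq]
    exact pow_le_one₀ (norm_nonneg _) hz
  -- The left side is nonpositive and the right side nonnegative, so `ω = 0`.
  have h5 : (1 - (Complex.normSq z)⁻¹) * σ = 4 * ω := by
    refine mul_left_cancel₀ him ?_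
    linarith
  have hw0 : w = 0 := eq_zero_of_sum_normSq (by nlinarith)
  refine hP.eq_zero_of_mulVec hL N x v ?_ hw0
  rw [hv, hw0, smul_zero]

theorem IsOrthonormalSeq.det_psiHat_ne_zero (hP : IsOrthonormalSeq L P)
    (hL : IsPositiveFunctional L) (N : ℕ) (z : ℂ) (hz : ‖z‖ ≤ 1)
    (h : ¬ ∃ t : ℝ, t ≠ 0 ∧ -1 ≤ t ∧ t ≤ 1 ∧ (t : ℂ) = z) :
    (ev z (psiHat L P N)).det ≠ 0 := by
  by_cases him : z.im = 0
  · have hre : ((z.re : ℝ) : ℂ) = z := Complex.ext (by simp) (by simp [him])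
    by_cases h0 : z.re = 0
    -- The origin is the only remaining real point; there the value is a scaled leading coefficient.
    · rw [← hre, h0, det_ev_ofReal, ev_zero_psiHat, Matrix.det_smul]
      exact Complex.ofReal_ne_zero.mpr (mul_ne_zero (by positivity) (hP.lead N).det_ne_zero)
    · have := abs_le.mp ((Complex.abs_re_le_norm z).trans hz)
      exact absurd ⟨z.re, h0, this.1, this.2, hre⟩ h
  · exact hP.det_psiHat_ne_zero_of_im hL N hz him

/-! ### The real zeros are simple -/

theorem continuousAt_eval_joukowski (p : ℝ[X]) {s : ℝ} (hs : s ≠ 0) :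
    ContinuousAt (fun z : ℝ => p.eval ((z + z⁻¹) / 2)) s :=
  p.continuous.continuousAt.comp
    ((continuousAt_id.add (continuousAt_inv₀ hs)).div_const 2)

/-- Replaces differentiation at `s`: divide an identity by `z - s` away from `s` and pass to the
limit. The point `0` is also left out because `z⁻¹` occurs. -/
theorem eq_of_eq_punctured {Y : Type*} [TopologicalSpace Y] [T2Space Y] {f g : ℝ → Y} {s : ℝ} (hf : ContinuousAt f s) (hg : ContinuousAt g s)
    (hs : s ≠ 0) (h : ∀ z, z ≠ 0 → z ≠ s → f z = g z) : f s = g s := by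
  have h1 : Filter.Tendsto f (nhdsWithin s {s}ᶜ) (nhds (f s)) := hf.tendsto.mono_left nhdsWithin_le_nhds
  have h2 : Filter.Tendsto g (nhdsWithin s {s}ᶜ) (nhds (g s)) := hg.tendsto.mono_left nhdsWithin_le_nhds
  refine tendsto_nhds_unique h1 (h2.congr' ?_)
  have h3 : ∀ᶠ z in nhdsWithin s {s}ᶜ, z ≠ 0 :=
    (continuousAt_id.eventually_ne hs).filter_mono nhdsWithin_le_nhds
  filter_upwards [h3, self_mem_nhdsWithin] with z hz hz'
  exact (h z hz hz').symm

theorem continuousAt_dotProduct {f g : ℝ → Fin l → ℝ} {s : ℝ}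
    (hf : ∀ i, ContinuousAt (fun z => f z i) s) (hg : ∀ i, ContinuousAt (fun z => g z i) s) :
    ContinuousAt (fun z => f z ⬝ᵥ g z) s :=
  tendsto_finsetSum _ fun j _ => (hf j).mul (hg j)

theorem joukowski_sub {z s : ℝ} (hz : z ≠ 0) (hs : s ≠ 0) :
    (z + z⁻¹) / 2 - (s + s⁻¹) / 2 = (z - s) * ((1 - z⁻¹ * s⁻¹) / 2) := by
  field_simp
  ring

/-- The confluent Christoffel–Darboux formula at a zero `s` of `psiHat`, for a polynomial vector
`V` whose value at `s` is a null vector. -/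
theorem IsOrthonormalSeq.confluent (hP : IsOrthonormalSeq L P) (hL : IsPositiveFunctional L)
    (N : ℕ) {s : ℝ} (hs : s ≠ 0) (V b : Fin l → ℝ[X])
    (hV : (psiHat L P N).mulVec V = (X - C s : ℝ[X]) • b) (v w : Fin l → ℝ)
    (hv : v = fun i => (V i).eval s)
    (hw : w = ((recA L P N).transpose * ev ((s + s⁻¹) / 2) (prevPoly P N)).mulVec v) :
    (s ^ N)⁻¹ * (w ⬝ᵥ fun i => (b i).eval s) + 2 * (w ⬝ᵥ w) =
      (1 - s⁻¹ * s⁻¹) / 2 * ∑ k ∈ Finset.range N,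
        (ev ((s + s⁻¹) / 2) (P k)).mulVec v ⬝ᵥ (ev ((s + s⁻¹) / 2) (P k)).mulVec v := by
  have hA : ∀ A : Matrix (Fin l) (Fin l) ℝ, A.map (algebraMap ℝ ℝ) = A := fun A => by ext; rfl
  set Vz : ℝ → Fin l → ℝ := fun z i => (V i).eval z with hVz
  set G : ℝ → Fin l → ℝ := fun z =>
    ((recA L P N).transpose * ev ((z + z⁻¹) / 2) (prevPoly P N)).mulVec (Vz z) with hG
  have hFV : ∀ z, (ev z (psiHat L P N)).mulVec (Vz z) = (z - s) • fun i => (b i).eval z := by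
    intro z
    funext i
    have h := congrArg (eval z) (congrFun hV i)
    simpa [Matrix.mulVec, dotProduct, eval_finsetSum, ev_apply, hVz, coe_aeval_eq_eval] using h
  have hPs : (ev ((s + s⁻¹) / 2) (P N)).mulVec v = (2 * s) • w := by
    have h := hFV s
    rw [hP.mulVec_psiHat N hs, sub_self, zero_smul, smul_eq_zero_iff_right (pow_ne_zero _ hs),
      sub_eq_zero, hA] at h
    rw [hw, hv]
    exact h
  have hcont : ∀ Q : Matrix (Fin l) (Fin l) ℝ[X], ∀ i,
      ContinuousAt (fun z => (ev ((z + z⁻¹) / 2) Q).mulVec (Vz z) i) s := by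
    intro Q i
    simp only [Matrix.mulVec, dotProduct, ev_apply, coe_aeval_eq_eval]
    refine tendsto_finsetSum _ fun j _ => ?_
    exact (continuousAt_eval_joukowski _ hs).mul (V j).continuous.continuousAt
  have hw' : G s = w := by rw [hw, hv]
  -- For `z ≠ s` this is Christoffel–Darboux at the images of `z` and `s`, divided by `z - s`.
  have key := eq_of_eq_punctured (s := s)
    (f := fun z => (z ^ N)⁻¹ * (w ⬝ᵥ fun i => (b i).eval z) + 2 * (w ⬝ᵥ G z))
    (g := fun z => (1 - z⁻¹ * s⁻¹) / 2 * ∑ k ∈ Finset.range N,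
        (ev ((s + s⁻¹) / 2) (P k)).mulVec v ⬝ᵥ (ev ((z + z⁻¹) / 2) (P k)).mulVec (Vz z))
    ?_ ?_ hs ?_
  · simp only [hw'] at key
    rw [key, hv]
  · refine ContinuousAt.add (ContinuousAt.mul ((continuousAt_id.pow N).inv₀ (pow_ne_zero _ hs)) ?_)
      (continuousAt_const.mul ?_)
    · exact continuousAt_dotProduct (fun j => continuousAt_const)
        fun j => (b j).continuous.continuousAt
    · refine continuousAt_dotProduct (fun j => continuousAt_const) fun j => ?_
      simp only [hG, ← Matrix.mulVec_mulVec]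
      exact continuousAt_dotProduct (fun k => continuousAt_const) fun k => hcont _ k
  · refine ContinuousAt.mul (((continuousAt_const.sub
      ((continuousAt_inv₀ hs).mul continuousAt_const))).div_const 2) ?_
    exact tendsto_finsetSum _ fun k _ =>
      continuousAt_dotProduct (fun j => continuousAt_const) fun j => hcont _ j
  · intro z hz hzs
    have h := congrArg (fun M => v ⬝ᵥ Matrix.mulVec M (Vz z))
      (hP.christoffel_darboux hL N ((z + z⁻¹) / 2) ((s + s⁻¹) / 2))
    have ht : ∀ (Q R : Matrix (Fin l) (Fin l) ℝ) (u : Fin l → ℝ),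
        v ⬝ᵥ (Q.transpose * R).mulVec u = Q.mulVec v ⬝ᵥ R.mulVec u := by
      intro Q R u
      rw [← Matrix.mulVec_mulVec, Matrix.dotProduct_mulVec, Matrix.vecMul_transpose]
    have hPz : (ev ((z + z⁻¹) / 2) (P N)).mulVec (Vz z) =
        ((z ^ N)⁻¹ * (z - s)) • (fun i => (b i).eval z) + (2 * z) • G z := by
      have h' := congrArg ((z ^ N)⁻¹ • ·) (hFV z)
      simp only [hP.mulVec_psiHat N hz, smul_smul, inv_mul_cancel₀ (pow_ne_zero N hz), one_smul,
        hA] at h'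
      rw [← h', sub_add_cancel]
    have h1 : (ev ((s + s⁻¹) / 2) (prevPoly P N)).transpose * recA L P N =
        ((recA L P N).transpose * ev ((s + s⁻¹) / 2) (prevPoly P N)).transpose := by
      rw [Matrix.transpose_mul, Matrix.transpose_transpose]
    simp only [hA, Matrix.smul_mulVec, Matrix.sub_mulVec, dotProduct_smul, dotProduct_sub,
      Matrix.sum_mulVec, dotProduct_sum, smul_eq_mul, h1, mul_assoc, ht, ← hw, hPs] at h
    change _ = _ - (2 * s) • w ⬝ᵥ G z at h
    rw [hPz, dotProduct_add, dotProduct_smul, dotProduct_smul, smul_dotProduct,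
      joukowski_sub hz hs] at h
    simp only [smul_eq_mul] at h
    refine mul_left_cancel₀ (sub_ne_zero.mpr hzs) ?_
    linear_combination -h

theorem ev_mulVec_eval {𝕜 : Type*} [CommRing 𝕜] [Algebra ℝ 𝕜] (F : Matrix (Fin l) (Fin l) ℝ[X])
    (V : Fin l → ℝ[X]) (z : 𝕜) :
    (ev z F).mulVec (fun i => aeval z (V i)) = fun i => aeval z (F.mulVec V i) := by
  funext i
  simp [Matrix.mulVec, dotProduct, ev_apply]

/-- Without the term in `b`, the confluent formula equates `2|w|²` with a nonpositive number, as `1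
- s⁻² ≤ 0`. So `w = 0`, and then `P_N v = 0` as well. It serves both for simplicity of the zeros and
for the canonical matrices. -/
theorem IsOrthonormalSeq.eq_zero_of_confluent (hP : IsOrthonormalSeq L P)
    (hL : IsPositiveFunctional L) (N : ℕ) {s : ℝ} (hs : s ≠ 0) (hs1 : -1 ≤ s) (hs2 : s ≤ 1)
    (V b : Fin l → ℝ[X]) (hV : (psiHat L P N).mulVec V = (X - C s : ℝ[X]) • b) (v : Fin l → ℝ)
    (hv : v = fun i => (V i).eval s)
    (hb : ((recA L P N).transpose * ev ((s + s⁻¹) / 2) (prevPoly P N)).mulVec v ⬝ᵥ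
      (fun i => (b i).eval s) = 0) : v = 0 := by
  have h := hP.confluent hL N hs V b hV v _ hv rfl
  set w := ((recA L P N).transpose * ev ((s + s⁻¹) / 2) (prevPoly P N)).mulVec v with hw
  rw [hb, mul_zero, zero_add] at h
  have hσ : 0 ≤ ∑ k ∈ Finset.range N,
      (ev ((s + s⁻¹) / 2) (P k)).mulVec v ⬝ᵥ (ev ((s + s⁻¹) / 2) (P k)).mulVec v :=
    Finset.sum_nonneg fun k _ => Finset.sum_nonneg fun i _ => mul_self_nonneg _
  have hss : 1 ≤ s⁻¹ * s⁻¹ := by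
    rw [← mul_inv, one_le_inv₀ (mul_self_pos.mpr hs)]
    nlinarith
  have hw0' : w ⬝ᵥ w = 0 := by
    have : 0 ≤ w ⬝ᵥ w := Finset.sum_nonneg fun i _ => mul_self_nonneg _
    nlinarith
  have hw0 : w = 0 := dotProduct_self_eq_zero.mp hw0'
  refine hP.eq_zero_of_mulVec hL N ((s + s⁻¹) / 2) v ?_ hw0
  have h1 : (ev s (psiHat L P N)).mulVec v = 0 := by
    rw [hv]
    refine (ev_mulVec_eval (psiHat L P N) V s).trans ?_
    rw [hV]
    funext i
    simp
  rw [hP.mulVec_psiHat N hs, smul_eq_zero_iff_right (pow_ne_zero _ hs), sub_eq_zero] at h1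
  rw [h1]
  exact (congrArg _ hw0).trans (smul_zero _)

/-- No Jordan chain of length two: the cofactor `b = (X - s) U` vanishes at `s`. -/
theorem IsOrthonormalSeq.no_double_zero (hP : IsOrthonormalSeq L P) (hL : IsPositiveFunctional L)
    (N : ℕ) {s : ℝ} (hs : s ≠ 0) (hs1 : -1 ≤ s) (hs2 : s ≤ 1) (V U : Fin l → ℝ[X])
    (hV : (psiHat L P N).mulVec V = ((X - C s) ^ 2 : ℝ[X]) • U) (i : Fin l) :
    (V i).eval s = 0 := by
  refine congrFun (hP.eq_zero_of_confluent hL N hs hs1 hs2 V ((X - C s : ℝ[X]) • U)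
    (by rw [hV, smul_smul, sq]) _ rfl ?_) i
  have h0 : (fun i => (((X - C s : ℝ[X]) • U) i).eval s) = 0 := by
    funext i; simp
  rw [h0, dotProduct_zero]

end

noncomputable section

variable {l : ℕ}

/-! ### Scalar denominators of the inverse of a matrix polynomial -/

theorem aeval_ofReal (s : ℝ) (p : ℝ[X]) : aeval (s : ℂ) p = ((p.eval s : ℝ) : ℂ) := by
  have h := aeval_algebraMap_apply ℂ s p
  rwa [coe_aeval_eq_eval] at h

theorem exists_eq_smul_of_ev_eq_zero {Q : Matrix (Fin l) (Fin l) ℝ[X]} {s : ℝ}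
    (h : ∀ i j, (Q i j).eval s = 0) : ∃ R : Matrix (Fin l) (Fin l) ℝ[X], Q = (X - C s : ℝ[X]) • R := by
  choose R hR using fun i j => dvd_iff_isRoot.mpr (h i j)
  exact ⟨Matrix.of R, by ext1 i j; simpa using hR i j⟩

theorem smul_matrix_injective {p : ℝ[X]} (hp : p ≠ 0) {Q R : Matrix (Fin l) (Fin l) ℝ[X]}
    (h : p • Q = p • R) : Q = R := by
  ext1 i j
  exact mul_left_cancel₀ hp (congrFun (congrFun h i) j)

/-- `e` is a scalar denominator of minimal degree of `F⁻¹ = M / e`. -/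
theorem exists_minimal_denominator {F : Matrix (Fin l) (Fin l) ℝ[X]} (hF : F.det ≠ 0) :
    ∃ (e : ℝ[X]) (M : Matrix (Fin l) (Fin l) ℝ[X]), e ≠ 0 ∧ F * M = e • 1 ∧
      ∀ (e' : ℝ[X]) (M' : Matrix (Fin l) (Fin l) ℝ[X]), e' ≠ 0 → F * M' = e' • 1 →
        e.natDegree ≤ e'.natDegree := by
  classical
  have hex : ∃ n, ∃ (e : ℝ[X]) (M : Matrix (Fin l) (Fin l) ℝ[X]), e ≠ 0 ∧ F * M = e • 1 ∧
      e.natDegree = n := ⟨_, F.det, F.adjugate, hF, Matrix.mul_adjugate F, rfl⟩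
  obtain ⟨e, M, he, hM, hn⟩ := Nat.find_spec hex
  refine ⟨e, M, he, hM, fun e' M' he' hM' => ?_⟩
  rw [hn]
  exact Nat.find_min' hex ⟨e', M', he', hM', rfl⟩

/-- Since `F.det` is a denominator with numerator the adjugate, so is its remainder modulo `e`;
minimality makes that remainder zero. -/
theorem dvd_det_of_minimal {F M : Matrix (Fin l) (Fin l) ℝ[X]} {e : ℝ[X]} (he : e ≠ 0)
    (hM : F * M = e • 1) (hmin : ∀ (e' : ℝ[X]) (M' : Matrix (Fin l) (Fin l) ℝ[X]), e' ≠ 0 →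
      F * M' = e' • 1 → e.natDegree ≤ e'.natDegree) : e ∣ F.det := by
  rw [← EuclideanDomain.mod_eq_zero]
  by_contra hr
  have h1 : F * (F.adjugate - (F.det / e) • M) = (F.det % e) • 1 := by
    rw [mul_sub, mul_smul_comm, hM, Matrix.mul_adjugate, smul_smul, ← sub_smul,
      EuclideanDomain.mod_eq_sub_mul_div, mul_comm e]
  have h2 : (F.det % e).degree < e.degree := EuclideanDomain.mod_lt _ he
  exact absurd (hmin _ _ hr h1) (not_le.mpr (natDegree_lt_natDegree hr h2))

/-- If `(X - s)²` divided `e`, each column of `M` would vanish at `s` by hypothesis, and a factor `X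
- s` could be cancelled from `M / e`. -/
theorem not_sq_dvd_of_minimal {F M : Matrix (Fin l) (Fin l) ℝ[X]} {e : ℝ[X]} (he : e ≠ 0)
    (hM : F * M = e • 1) (hmin : ∀ (e' : ℝ[X]) (M' : Matrix (Fin l) (Fin l) ℝ[X]), e' ≠ 0 →
      F * M' = e' • 1 → e.natDegree ≤ e'.natDegree) {s : ℝ}
    (hs : ∀ V U : Fin l → ℝ[X], F.mulVec V = ((X - C s) ^ 2 : ℝ[X]) • U → ∀ i, (V i).eval s = 0) :
    ¬ (X - C s) ^ 2 ∣ e := by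
  rintro ⟨e', rfl⟩
  have h0 : ∀ i j, (M i j).eval s = 0 := by
    intro i j
    refine hs (fun i => M i j) (fun i => e' * (1 : Matrix (Fin l) (Fin l) ℝ[X]) i j) ?_ i
    funext k
    have := congrFun (congrFun hM k) j
    simpa [Matrix.mul_apply, Matrix.mulVec, dotProduct, mul_assoc] using this
  obtain ⟨M1, rfl⟩ := exists_eq_smul_of_ev_eq_zero h0
  have hX : (X - C s : ℝ[X]) ≠ 0 := X_sub_C_ne_zero s
  have he' : e' ≠ 0 := right_ne_zero_of_mul he
  have h1 : F * M1 = ((X - C s) * e') • 1 := by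
    refine smul_matrix_injective hX ?_
    rw [← mul_smul_comm, hM, smul_smul]
    ring_nf
  have h2 := hmin _ _ (mul_ne_zero hX he') h1
  rw [natDegree_mul (pow_ne_zero 2 hX) he', natDegree_mul hX he', natDegree_pow,
    natDegree_X_sub_C] at h2
  omega

theorem mem_zerosIn {F : Matrix (Fin l) (Fin l) ℝ[X]} (hF : F.det ≠ 0) {s : ℝ} :
    s ∈ zerosIn F ↔ F.det.eval s = 0 ∧ -1 < s ∧ s < 1 := by
  simp [zerosIn, hF]

/-- The polynomial `1 - X²` times the product of `X - s` over the zeros `s` in `(-1, 1)`. -/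
def diskPoly (S : Finset ℝ) : ℝ[X] := (1 - X ^ 2) * ∏ s ∈ S, (X - C s)

theorem eval_diskPoly_eq_zero {S : Finset ℝ} {s : ℝ} (h : s ∈ S ∨ s = 1 ∨ s = -1) :
    (diskPoly S).eval s = 0 := by
  rw [diskPoly, eval_mul, eval_prod]
  rcases h with h | rfl | rfl
  · rw [Finset.prod_eq_zero h (by simp), mul_zero]
  · simp
  · simp

/-- If `F` has no zeros in the closed disk except simple ones in `[-1, 0) ∪ (0, 1]`, then `F⁻¹` has
a scalar denominator with simple zeros there, and no other zeros in the closed disk. -/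
theorem exists_disk_denominator {F : Matrix (Fin l) (Fin l) ℝ[X]}
    (hdet : ∀ z : ℂ, ‖z‖ ≤ 1 → (¬ ∃ t : ℝ, t ≠ 0 ∧ -1 ≤ t ∧ t ≤ 1 ∧ (t : ℂ) = z) →
      (ev z F).det ≠ 0)
    (hs : ∀ s : ℝ, s ≠ 0 → -1 ≤ s → s ≤ 1 → ∀ V U : Fin l → ℝ[X],
      F.mulVec V = ((X - C s) ^ 2 : ℝ[X]) • U → ∀ i, (V i).eval s = 0) :
    ∃ (K : Matrix (Fin l) (Fin l) ℝ[X]) (q : ℝ[X]),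
      F * K = (diskPoly (zerosIn F) * q) • 1 ∧ ∀ z : ℂ, ‖z‖ ≤ 1 → aeval z q ≠ 0 := by
  classical
  have hF : F.det ≠ 0 := by
    intro h
    refine hdet 0 (by simp) ?_ (by rw [det_ev, h, map_zero])
    rintro ⟨t, ht, -, -, h0⟩
    exact ht (by exact_mod_cast h0)
  obtain ⟨e, M, he, hM, hmin⟩ := exists_minimal_denominator hF
  set T := diskPoly (zerosIn F) with hT
  -- `q` is `e` without the factors shared with `diskPoly`; the complementary factor `t` is absorbed
  -- into `K`.
  obtain ⟨q, hq⟩ := EuclideanDomain.gcd_dvd_left e T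
  obtain ⟨t, ht⟩ := EuclideanDomain.gcd_dvd_right e T
  set d := EuclideanDomain.gcd e T with hd
  refine ⟨t • M, q, ?_, fun z hz hqz => ?_⟩
  · rw [mul_smul_comm, hM, smul_smul]
    congr 1
    rw [ht, hq]; ring
  · have hez : aeval z e = 0 := by rw [hq, map_mul, hqz, mul_zero]
    have hdz : (ev z F).det = 0 := by
      obtain ⟨k, hk⟩ := dvd_det_of_minimal he hM hmin
      rw [det_ev, hk, map_mul, hez, zero_mul]
    obtain ⟨s, hs0, hs1, hs2, rfl⟩ := not_not.mp (mt (hdet z hz) (not_not.mpr hdz))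
    have hreal : ∀ p : ℝ[X], aeval (s : ℂ) p = 0 → p.eval s = 0 := by
      intro p hp
      rw [aeval_ofReal] at hp
      exact_mod_cast hp
    rw [det_ev] at hdz
    have hTs : (X - C s) ∣ T := by
      refine dvd_iff_isRoot.mpr (eval_diskPoly_eq_zero ?_)
      rcases eq_or_lt_of_le hs2 with h2 | h2
      · exact Or.inr (Or.inl h2)
      rcases eq_or_lt_of_le hs1 with h1 | h1
      · exact Or.inr (Or.inr h1.symm)
      · exact Or.inl ((mem_zerosIn hF).mpr ⟨hreal _ hdz, h1, h2⟩)
    have hes : (X - C s) ∣ e := dvd_iff_isRoot.mpr (hreal _ hez)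
    have hqs : (X - C s) ∣ q := dvd_iff_isRoot.mpr (hreal _ hqz)
    -- A zero `s` of `q` in the disk also divides the gcd, so `(X - s)²` would divide `e`.
    refine not_sq_dvd_of_minimal he hM hmin (hs s hs0 hs1 hs2) ?_
    rw [hq, sq]
    exact mul_dvd_mul (EuclideanDomain.dvd_gcd hes hTs) hqs

/-! ### Simple zeros -/

theorem continuous_ev (Q : Matrix (Fin l) (Fin l) ℝ[X]) : Continuous fun z : ℂ => ev z Q :=
  continuous_matrix fun i j => (Q i j).continuous_aeval

/-- Near `s` the inverse is `K / ((z - s) h)`, so the limit to examine is `K(s) / h(s)`. -/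
theorem hasSimpleZero_of_mul_eq {F K : Matrix (Fin l) (Fin l) ℝ[X]} {s : ℝ} {h : ℝ[X]}
    (hFK : F * K = ((X - C s) * h) • 1) (hh : h.eval s ≠ 0) (hF : (evalC F (s : ℂ)).det = 0) :
    HasSimpleZero (evalC F) (s : ℂ) := by
  have hev : ∀ z : ℂ, evalC F z * ev z K = ((z - s) * aeval z h) • 1 := by
    intro z
    have := congrArg (ev z) hFK
    rw [map_mul, ev_smul, map_one] at this
    rw [evalC_eq_ev, this]
    simp
  have hhs : aeval (s : ℂ) h ≠ 0 := by
    rw [aeval_ofReal]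
    exact_mod_cast hh
  refine ⟨⟨one_pos, (aeval (s : ℂ) h)⁻¹ • ev (s : ℂ) K, ?_, ?_⟩, fun m hm => hm.1⟩
  -- If `K(s) = 0`, cancelling `X - s` gives `F K1 = h`, which would make `F(s)` nonsingular.
  · intro h0
    rw [smul_eq_zero_iff_right (inv_ne_zero hhs)] at h0
    have hK : ∀ i j, (K i j).eval s = 0 := by
      intro i j
      have h2 : aeval (s : ℂ) (K i j) = 0 := congrFun (congrFun h0 i) j
      rw [aeval_ofReal] at h2
      exact_mod_cast h2
    obtain ⟨K1, rfl⟩ := exists_eq_smul_of_ev_eq_zero hK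
    have h1 : F * K1 = h • 1 := by
      refine smul_matrix_injective (X_sub_C_ne_zero s) ?_
      rw [← mul_smul_comm, hFK, smul_smul]
    have h2 := congrArg Matrix.det (congrArg (ev (s : ℂ)) h1)
    rw [map_mul, ev_smul, map_one, Matrix.det_mul, ← evalC_eq_ev, hF, zero_mul, Matrix.det_smul,
      Matrix.det_one, mul_one] at h2
    exact pow_ne_zero _ hhs h2.symm
  · have hcont : Filter.Tendsto (fun z : ℂ => (aeval z h)⁻¹ • ev z K) (nhdsWithin (s : ℂ) {(s : ℂ)}ᶜ)
        (nhds ((aeval (s : ℂ) h)⁻¹ • ev (s : ℂ) K)) := by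
      refine Filter.Tendsto.mono_left ?_ nhdsWithin_le_nhds
      exact (h.continuous_aeval.continuousAt.inv₀ hhs).smul (continuous_ev K).continuousAt
    refine hcont.congr' ?_
    have h3 : ∀ᶠ z in nhdsWithin (s : ℂ) {(s : ℂ)}ᶜ, aeval z h ≠ 0 :=
      (h.continuous_aeval.continuousAt.eventually_ne hhs).filter_mono nhdsWithin_le_nhds
    filter_upwards [h3, self_mem_nhdsWithin] with z hz hzs
    have hzs' : z - s ≠ 0 := sub_ne_zero.mpr hzs
    have hinv : (evalC F z)⁻¹ = ((z - s) * aeval z h)⁻¹ • ev z K := by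
      refine Matrix.inv_eq_right_inv ?_
      rw [mul_smul_comm, hev, smul_smul, inv_mul_cancel₀ (mul_ne_zero hzs' hz), one_smul]
    rw [hinv, smul_smul, pow_one]
    congr 1
    field_simp

theorem exists_diskPoly_eq {S : Finset ℝ} (hS : ∀ s ∈ S, -1 < s ∧ s < 1) {s : ℝ}
    (h : s ∈ S ∨ s = 1 ∨ s = -1) :
    ∃ g : ℝ[X], diskPoly S = (X - C s) * g ∧ g.eval s ≠ 0 := by
  classical
  have hprod : ∀ t : ℝ, t ∉ S → (∏ s ∈ S, (X - C s)).eval t ≠ 0 := by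
    intro t ht
    rw [eval_prod]
    refine Finset.prod_ne_zero_iff.mpr fun a ha => ?_
    rw [eval_sub, eval_X, eval_C, sub_ne_zero]
    rintro rfl
    exact ht ha
  rcases h with h | rfl | rfl
  · refine ⟨(1 - X ^ 2) * ∏ t ∈ S.erase s, (X - C t), ?_, ?_⟩
    · rw [diskPoly, ← Finset.mul_prod_erase S _ h]; ring
    · rw [eval_mul]
      refine mul_ne_zero ?_ ?_
      · have := hS s h
        simp only [eval_sub, eval_one, eval_pow, eval_X]
        nlinarith
      · rw [eval_prod]
        refine Finset.prod_ne_zero_iff.mpr fun a ha => ?_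
        rw [eval_sub, eval_X, eval_C, sub_ne_zero]
        exact (Finset.ne_of_mem_erase ha).symm
  · refine ⟨-(1 + X) * ∏ s ∈ S, (X - C s), by rw [diskPoly, C_1]; ring, ?_⟩
    rw [eval_mul]
    exact mul_ne_zero (by norm_num) (hprod 1 fun h => absurd (hS 1 h).2 (lt_irrefl _))
  · refine ⟨(1 - X) * ∏ s ∈ S, (X - C s), by rw [diskPoly, C_neg, C_1]; ring, ?_⟩
    rw [eval_mul]
    exact mul_ne_zero (by norm_num) (hprod (-1) fun h => absurd (hS _ h).1 (lt_irrefl _))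

theorem hasSimpleZero_of_disk_denominator {F K : Matrix (Fin l) (Fin l) ℝ[X]} {q : ℝ[X]}
    (hdet0 : F.det ≠ 0) (hFK : F * K = (diskPoly (zerosIn F) * q) • 1)
    (hq : ∀ z : ℂ, ‖z‖ ≤ 1 → aeval z q ≠ 0) {s : ℝ} (hs1 : -1 ≤ s) (hs2 : s ≤ 1)
    (hF : (evalC F (s : ℂ)).det = 0) : HasSimpleZero (evalC F) (s : ℂ) := by
  have hmem : s ∈ zerosIn F ∨ s = 1 ∨ s = -1 := by
    rcases eq_or_lt_of_le hs2 with h2 | h2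
    · exact Or.inr (Or.inl h2)
    rcases eq_or_lt_of_le hs1 with h1 | h1
    · exact Or.inr (Or.inr h1.symm)
    · refine Or.inl ((mem_zerosIn hdet0).mpr ⟨?_, h1, h2⟩)
      rw [evalC_eq_ev, det_ev, aeval_ofReal] at hF
      exact_mod_cast hF
  obtain ⟨g, hg, hgs⟩ := exists_diskPoly_eq (fun t ht => ((mem_zerosIn hdet0).mp ht).2) hmem
  refine hasSimpleZero_of_mul_eq (h := g * q) (by rw [hFK, hg, mul_assoc]) ?_ hF
  rw [eval_mul]
  refine mul_ne_zero hgs ?_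
  have := hq s (by rw [Complex.norm_real]; exact abs_le.mpr ⟨hs1, hs2⟩)
  rw [aeval_ofReal] at this
  exact_mod_cast this

end

noncomputable section

variable {l : ℕ}

/-! ### The projection onto the kernel -/

theorem toEuclideanLin_kerProj (M : Matrix (Fin l) (Fin l) ℝ) :
    Matrix.toEuclideanLin (kerProj M) =
      ((LinearMap.ker (Matrix.toEuclideanLin M)).starProjection :
        EuclideanSpace ℝ (Fin l) →ₗ[ℝ] EuclideanSpace ℝ (Fin l)) :=
  LinearEquiv.apply_symm_apply _ _

theorem toLp_kerProj_mulVec (M : Matrix (Fin l) (Fin l) ℝ) (v : Fin l → ℝ) :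
    WithLp.toLp 2 ((kerProj M).mulVec v) =
      (LinearMap.ker (Matrix.toEuclideanLin M)).starProjection (WithLp.toLp 2 v) :=
  LinearMap.congr_fun (toEuclideanLin_kerProj M) (WithLp.toLp 2 v)

theorem mem_ker_toEuclideanLin {M : Matrix (Fin l) (Fin l) ℝ} {v : Fin l → ℝ} :
    WithLp.toLp 2 v ∈ LinearMap.ker (Matrix.toEuclideanLin M) ↔ M.mulVec v = 0 := by
  rw [LinearMap.mem_ker]
  exact (WithLp.toLp_injective 2).eq_iff' (WithLp.toLp_zero 2)

theorem mul_kerProj (M : Matrix (Fin l) (Fin l) ℝ) : M * kerProj M = 0 := by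
  refine Matrix.ext_of_mulVec_single fun i => ?_
  rw [← Matrix.mulVec_mulVec, Matrix.zero_mulVec, ← mem_ker_toEuclideanLin, toLp_kerProj_mulVec]
  exact Submodule.starProjection_apply_mem _ _

theorem kerProj_mulVec_eq_self {M : Matrix (Fin l) (Fin l) ℝ} {v : Fin l → ℝ}
    (h : M.mulVec v = 0) : (kerProj M).mulVec v = v := by
  refine WithLp.toLp_injective 2 ?_
  rw [toLp_kerProj_mulVec]
  exact Submodule.starProjection_eq_self_iff.mpr (mem_ker_toEuclideanLin.mpr h)

theorem kerProj_mul_eq_self {M K : Matrix (Fin l) (Fin l) ℝ} (h : M * K = 0) :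
    kerProj M * K = K := by
  refine Matrix.ext_of_mulVec_single fun i => ?_
  rw [← Matrix.mulVec_mulVec]
  exact kerProj_mulVec_eq_self (by rw [Matrix.mulVec_mulVec, h, Matrix.zero_mulVec])

theorem kerProj_mul_self (M : Matrix (Fin l) (Fin l) ℝ) : kerProj M * kerProj M = kerProj M :=
  kerProj_mul_eq_self (mul_kerProj M)

theorem kerProj_transpose (M : Matrix (Fin l) (Fin l) ℝ) :
    (kerProj M).transpose = kerProj M := by
  have h : (kerProj M).IsHermitian := by
    rw [← Matrix.isSymmetric_toEuclideanLin_iff, toEuclideanLin_kerProj]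
    exact (LinearMap.ker (Matrix.toEuclideanLin M)).starProjection_isSymmetric
  rwa [Matrix.IsHermitian, Matrix.conjTranspose_eq_transpose_of_trivial] at h

/-! ### The weight polynomial -/

/-- With `w² = x² - 1`, the numbers `x + w` and `x - w` are mutually inverse. Surjectivity gives
uniqueness of the weight polynomial. -/
theorem exists_joukowski (x : ℂ) : ∃ z : ℂ, z ≠ 0 ∧ (z + z⁻¹) / 2 = x := by
  obtain ⟨w, hw⟩ := IsAlgClosed.exists_pow_nat_eq (x ^ 2 - 1) two_pos
  have h : (x + w) * (x - w) = 1 := by linear_combination -hw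
  have hz : x + w ≠ 0 := left_ne_zero_of_mul_eq_one h
  refine ⟨x + w, hz, ?_⟩
  rw [inv_eq_of_mul_eq_one_right h]
  ring

theorem IsWeightPoly.unique {F W W' : Matrix (Fin l) (Fin l) ℝ[X]} (h : IsWeightPoly F W)
    (h' : IsWeightPoly F W') : W = W' := by
  ext1 i j
  refine Polynomial.funext fun x => ?_
  obtain ⟨z, hz, hx⟩ := exists_joukowski x
  have h1 := (h z hz).trans (h' z hz).symm
  rw [hx] at h1
  have h2 : aeval (x : ℂ) (W i j) = aeval (x : ℂ) (W' i j) := congrFun (congrFun h1 i) j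
  rw [aeval_ofReal, aeval_ofReal] at h2
  exact_mod_cast h2

/-- Exchanging `z` and `1/z` fixes `x` and transposes the product. -/
theorem IsWeightPoly.transpose_eq {F W : Matrix (Fin l) (Fin l) ℝ[X]} (h : IsWeightPoly F W) :
    W.transpose = W := by
  refine IsWeightPoly.unique (F := F) (fun z hz => ?_) h
  have h1 := congrArg Matrix.transpose (h z⁻¹ (inv_ne_zero hz))
  rw [Matrix.transpose_mul, Matrix.transpose_transpose, inv_inv, add_comm] at h1
  exact h1

theorem IsWeightPoly.ev_eq {F W : Matrix (Fin l) (Fin l) ℝ[X]} (h : IsWeightPoly F W) {z : ℂ}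
    (hz : z ≠ 0) : ev ((z + z⁻¹) / 2) W = (ev z⁻¹ F).transpose * ev z F := h z hz

theorem IsWeightPoly.ev_eq' {F W : Matrix (Fin l) (Fin l) ℝ[X]} (h : IsWeightPoly F W) {z : ℂ}
    (hz : z ≠ 0) : ev ((z + z⁻¹) / 2) W = (ev z F).transpose * ev z⁻¹ F := by
  have h1 := h.ev_eq (inv_ne_zero hz)
  rwa [inv_inv, add_comm] at h1

theorem IsWeightPoly.ev_real {F W : Matrix (Fin l) (Fin l) ℝ[X]} (h : IsWeightPoly F W) {z : ℝ}
    (hz : z ≠ 0) : ev ((z + z⁻¹) / 2) W = (ev z F).transpose * ev z⁻¹ F := by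
  have h1 := h.ev_eq' (Complex.ofReal_ne_zero.mpr hz)
  rw [show ((z : ℂ) + (z : ℂ)⁻¹) / 2 = (((z + z⁻¹) / 2 : ℝ) : ℂ) by push_cast; ring,
    ← Complex.ofReal_inv, ev_ofReal, ev_ofReal, ev_ofReal] at h1
  ext i j
  have h2 := congrFun (congrFun h1 i) j
  simp only [Matrix.mul_apply, Matrix.map_apply, Matrix.transpose_apply] at h2 ⊢
  exact_mod_cast h2

theorem exists_joukowski_circle {x : ℝ} (h1 : -1 < x) (h2 : x < 1) :
    ∃ z : ℂ, ‖z‖ = 1 ∧ z.im ≠ 0 ∧ (z + z⁻¹) / 2 = x := by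
  have hpos : 0 < 1 - x ^ 2 := by nlinarith
  have hns : Complex.normSq ⟨x, √(1 - x ^ 2)⟩ = 1 := by
    rw [Complex.normSq_mk, Real.mul_self_sqrt hpos.le]; ring
  refine ⟨⟨x, √(1 - x ^ 2)⟩, ?_, (Real.sqrt_pos.mpr hpos).ne', ?_⟩
  · have h := Complex.normSq_eq_norm_sq (⟨x, √(1 - x ^ 2)⟩ : ℂ)
    rw [hns] at h
    exact (pow_eq_one_iff_of_nonneg (norm_nonneg _) two_ne_zero).mp h.symm
  · rw [Complex.inv_def, hns, inv_one, Complex.ofReal_one, mul_one, Complex.add_conj]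
    simp

/-- A point of `(-1, 1)` comes from a nonreal `z` on the unit circle, where both `z` and `1/z` lie
in the closed disk. -/
theorem IsWeightPoly.det_ne_zero {F W : Matrix (Fin l) (Fin l) ℝ[X]} (h : IsWeightPoly F W)
    (hF : ∀ z : ℂ, ‖z‖ ≤ 1 → z.im ≠ 0 → (ev z F).det ≠ 0) {x : ℝ} (h1 : -1 < x) (h2 : x < 1) :
    (ev x W).det ≠ 0 := by
  obtain ⟨z, hz, him, hx⟩ := exists_joukowski_circle h1 h2
  have hz0 : z ≠ 0 := by rintro rfl; simp at him
  have hd := congrArg Matrix.det (h.ev_eq hz0)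
  rw [hx, det_ev_ofReal, Matrix.det_mul, Matrix.det_transpose] at hd
  have : ((ev x W).det : ℂ) ≠ 0 := by
    rw [hd]
    refine mul_ne_zero (hF _ (by rw [norm_inv, hz, inv_one]) ?_) (hF _ hz.le him)
    rw [Complex.inv_im]
    exact div_ne_zero (neg_ne_zero.mpr him) (Complex.normSq_pos.mpr hz0).ne'
  exact_mod_cast this

section

variable {L : ℝ[X] →ₗ[ℝ] Matrix (Fin l) (Fin l) ℝ} {P : ℕ → Matrix (Fin l) (Fin l) ℝ[X]}

/-- The product expands to terms in `z` and `1/z` separately; Christoffel–Darboux with equal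
arguments gives `bᵗ p = pᵗ b`, so they combine into `z + 1/z = 2x`. -/
theorem IsOrthonormalSeq.exists_isWeightPoly (hP : IsOrthonormalSeq L P)
    (hL : IsPositiveFunctional L) (N : ℕ) : ∃ W, IsWeightPoly (psiHat L P N) W := by
  set a := (recA L P N).transpose.map C * prevPoly P N with ha
  refine ⟨(P N).transpose * P N - (4 * X : ℝ[X]) • ((P N).transpose * a) +
    (4 : ℝ[X]) • (a.transpose * a), fun z hz => ?_⟩
  set x := (z + z⁻¹) / 2 with hx
  set p := ev x (P N) with hp
  set b := ((recA L P N).map (algebraMap ℝ ℂ)).transpose * ev x (prevPoly P N) with hb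
  have hab : ev x a = b := by rw [ha, map_mul, ev_map_C, Matrix.transpose_map]
  have hsymm : b.transpose * p = p.transpose * b := by
    have h := hP.christoffel_darboux hL N x x
    rw [sub_self, zero_smul, eq_comm, sub_eq_zero] at h
    rw [hb, Matrix.transpose_mul, Matrix.transpose_transpose, h, mul_assoc]
  have h1 : ev z (psiHat L P N) = z ^ N • (p - (2 * z) • b) := hP.ev_psiHat N hz
  have h2 : ev z⁻¹ (psiHat L P N) = z⁻¹ ^ N • (p - (2 * z⁻¹) • b) := by
    rw [hP.ev_psiHat N (inv_ne_zero hz), inv_inv, add_comm z⁻¹]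
  rw [evalC_eq_ev, evalC_eq_ev, evalC_eq_ev, h1, h2, map_add, map_sub, ev_smul, ev_smul]
  simp only [map_mul]
  rw [ev_transpose, ev_transpose, hab, Matrix.transpose_smul,
    smul_mul_smul_comm, ← mul_pow, inv_mul_cancel₀ hz, one_pow, one_smul, Matrix.transpose_sub,
    Matrix.transpose_smul, sub_mul, mul_sub, mul_sub, smul_mul_smul_comm, mul_smul_comm,
    smul_mul_assoc, hsymm, ← hp, aeval_X, map_ofNat,
    show (2 * z⁻¹ * (2 * z)) = 4 by field_simp; norm_num,
    show 4 * x = 2 * z + 2 * z⁻¹ by rw [hx]; ring, add_smul]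
  abel

end

/-! ### The weights at the zeros -/

/-- A factorization of `F` on its kernel at `s`. -/
theorem exists_mul_kerProj_eq (F : Matrix (Fin l) (Fin l) ℝ[X]) (s : ℝ) :
    ∃ B, F * (kerProj (ev s F)).map C = (X - C s : ℝ[X]) • B := by
  refine exists_eq_smul_of_ev_eq_zero fun i j => ?_
  have h : ev s (F * (kerProj (ev s F)).map C) = 0 := by
    rw [map_mul, ev_map_C]
    exact mul_kerProj _
  have := congrFun (congrFun h i) j
  rwa [ev_apply, coe_aeval_eq_eval] at this

theorem continuousAt_ev (Q : Matrix (Fin l) (Fin l) ℝ[X]) {f : ℝ → ℝ} {s : ℝ}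
    (hf : ContinuousAt f s) : ContinuousAt (fun z => ev (f z) Q) s := by
  have h : Continuous fun x : ℝ => ev x Q := continuous_matrix fun i j => (Q i j).continuous_aeval
  exact h.continuousAt.comp hf

section

variable {F W B : Matrix (Fin l) (Fin l) ℝ[X]} {s : ℝ}

theorem kerProj_mul_ev_transpose (hB : F * (kerProj (ev s F)).map C = (X - C s : ℝ[X]) • B)
    (z : ℝ) : kerProj (ev s F) * (ev z F).transpose = (z - s) • (ev z B).transpose := by
  have h := congrArg (fun Q => (ev z Q).transpose) hB
  simp only [map_mul, ev_map_C, ev_smul, Matrix.transpose_mul, Matrix.transpose_smul] at h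
  rw [← kerProj_transpose (ev s F)]
  refine Eq.trans h ?_
  simp

theorem continuousAt_transpose_ev_mul_ev_inv (hs : s ≠ 0) :
    ContinuousAt (fun z : ℝ => (ev z B).transpose * ev z⁻¹ F) s :=
  ((continuous_id.matrix_transpose).continuousAt.comp (continuousAt_ev B continuousAt_id)).mul
    (continuousAt_ev F (continuousAt_inv₀ hs))

/-- The derivative of the weight polynomial on the kernel of `F`. -/
theorem IsWeightPoly.kerProj_mul_derivative (hW : IsWeightPoly F W) (hs : s ≠ 0)
    (hB : F * (kerProj (ev s F)).map C = (X - C s : ℝ[X]) • B) :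
    ((1 - s⁻¹ * s⁻¹) / 2) • (kerProj (ev s F) *
      ev ((s + s⁻¹) / 2) (W.map fun p => derivative p)) = (ev s B).transpose * ev s⁻¹ F := by
  set E := kerProj (ev s F) with hE
  set xs := (s + s⁻¹) / 2 with hxs
  have hEW : ∀ z : ℝ, z ≠ 0 → E * ev ((z + z⁻¹) / 2) W =
      (z - s) • ((ev z B).transpose * ev z⁻¹ F) := by
    intro z hz
    rw [hW.ev_real hz, ← mul_assoc, hE, kerProj_mul_ev_transpose hB, smul_mul_assoc]
  have hmul : ∀ x : ℝ, ev x (E.map C * W) = E * ev x W := fun x => by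
    rw [map_mul, ev_map_C]; rfl
  -- `E W` vanishes at `xs`, so its derivative there is the value of the quotient `W1`.
  obtain ⟨W1, hW1⟩ : ∃ W1, E.map C * W = (X - C xs : ℝ[X]) • W1 := by
    refine exists_eq_smul_of_ev_eq_zero fun i j => ?_
    have h : ev xs (E.map C * W) = 0 := by
      rw [hmul, hxs, hEW s hs, sub_self, zero_smul]
    have := congrFun (congrFun h i) j
    rwa [ev_apply, coe_aeval_eq_eval] at this
  have hder : E * ev xs (W.map fun p => derivative p) = ev xs W1 := by
    ext i j
    have h := congrArg (fun p => (derivative p).eval xs) (congrFun (congrFun hW1 i) j)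
    simpa [Matrix.mul_apply, eval_finsetSum, ev_apply, coe_aeval_eq_eval] using h
  rw [hder]
  refine eq_of_eq_punctured (s := s)
    (f := fun z : ℝ => ((1 - z⁻¹ * s⁻¹) / 2) • ev ((z + z⁻¹) / 2) W1)
    (g := fun z : ℝ => (ev z B).transpose * ev z⁻¹ F) ?_
    (continuousAt_transpose_ev_mul_ev_inv hs) hs fun z hz hzs => ?_
  · exact ((continuousAt_const.sub ((continuousAt_inv₀ hs).mul continuousAt_const)).div_const 2).smul
      (continuousAt_ev W1 ((continuousAt_id.add (continuousAt_inv₀ hs)).div_const 2))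
  · have h := hEW z hz
    rw [← hmul, hW1, ev_smul, map_sub, aeval_X, aeval_C, Algebra.algebraMap_self_apply, hxs,
      joukowski_sub hz hs, mul_smul] at h
    exact smul_right_injective _ (sub_ne_zero.mpr hzs) h

/-- Multiply `F(z)ᵗ F(1/z) = F(1/z)ᵗ F(z)` (symmetry of `W`) by `E` on the left and `K` on the
right; both sides are divisible by `z - s`. -/
theorem IsWeightPoly.transpose_mul_mul (hW : IsWeightPoly F W) (hs : s ≠ 0)
    (hB : F * (kerProj (ev s F)).map C = (X - C s : ℝ[X]) • B)
    {K : Matrix (Fin l) (Fin l) ℝ[X]} {h : ℝ[X]} (hK : F * K = ((X - C s) * h) • 1) :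
    (ev s B).transpose * ev s⁻¹ F * ev s K =
      h.eval s • (kerProj (ev s F) * (ev s⁻¹ F).transpose) := by
  set E := kerProj (ev s F) with hE
  refine eq_of_eq_punctured (s := s)
    (f := fun z : ℝ => (ev z B).transpose * ev z⁻¹ F * ev z K)
    (g := fun z : ℝ => h.eval z • (E * (ev z⁻¹ F).transpose))
    ((continuousAt_transpose_ev_mul_ev_inv hs).mul (continuousAt_ev K continuousAt_id))
    (h.continuous.continuousAt.smul (continuousAt_const.mul
      ((continuous_id.matrix_transpose).continuousAt.comp
        (continuousAt_ev F (continuousAt_inv₀ hs))))) hs fun z hz hzs => ?_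
  refine smul_right_injective _ (sub_ne_zero.mpr hzs) ?_
  have hFK : ev z F * ev z K = ((z - s) * h.eval z) • 1 := by
    rw [← map_mul, hK, ev_smul, map_one]
    simp [coe_aeval_eq_eval]
  have h1 : (ev z F).transpose * ev z⁻¹ F = (ev z⁻¹ F).transpose * ev z F := by
    have h2 := congrArg Matrix.transpose (hW.ev_real hz)
    rw [← ev_transpose, hW.transpose_eq, hW.ev_real hz, Matrix.transpose_mul,
      Matrix.transpose_transpose] at h2
    exact h2
  have h3 := congrArg (fun M => E * M * ev z K) h1
  simp only [← mul_assoc] at h3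
  rw [hE, kerProj_mul_ev_transpose hB, ← hE, smul_mul_assoc, smul_mul_assoc, mul_assoc _ (ev z F),
    hFK, mul_smul_comm, mul_one, mul_smul] at h3
  exact h3

theorem canonicalMat_eq (F W : Matrix (Fin l) (Fin l) ℝ[X]) (s : ℝ) :
    canonicalMat F W s = (1 / (2 * (s - s⁻¹))) • (kerProj (ev s F) *
      ev ((s + s⁻¹) / 2) (W.map fun p => derivative p) * kerProj (ev s F)) +
      (1 - kerProj (ev s F)) := by
  rw [canonicalMat, evalR_eq_ev, evalR_eq_ev]

theorem kerProj_mul_canonicalMat (F W : Matrix (Fin l) (Fin l) ℝ[X]) (s : ℝ) :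
    kerProj (ev s F) * canonicalMat F W s = (1 / (2 * (s - s⁻¹))) • (kerProj (ev s F) *
      ev ((s + s⁻¹) / 2) (W.map fun p => derivative p) * kerProj (ev s F)) := by
  rw [canonicalMat_eq, mul_add, mul_sub (kerProj (ev s F)), kerProj_mul_self, mul_one, sub_self, add_zero,
    mul_smul_comm, ← mul_assoc, ← mul_assoc, kerProj_mul_self]

theorem canonicalMat_mul_kerProj (F W : Matrix (Fin l) (Fin l) ℝ[X]) (s : ℝ) :
    canonicalMat F W s * kerProj (ev s F) = kerProj (ev s F) * canonicalMat F W s := by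
  rw [kerProj_mul_canonicalMat, canonicalMat_eq, add_mul, sub_mul _ _ (kerProj (ev s F)), kerProj_mul_self, one_mul,
    sub_self, add_zero, smul_mul_assoc, mul_assoc _ (kerProj _), kerProj_mul_self]

/-- Together with commutation with the projection, this makes the canonical weight symmetric. -/
theorem IsWeightPoly.canonicalMat_transpose (hW : IsWeightPoly F W) (s : ℝ) :
    (canonicalMat F W s).transpose = canonicalMat F W s := by
  have h : (ev ((s + s⁻¹) / 2) (W.map fun p => derivative p)).transpose =
      ev ((s + s⁻¹) / 2) (W.map fun p => derivative p) := by
    rw [← ev_transpose, ← Matrix.transpose_map, hW.transpose_eq]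
  rw [canonicalMat_eq, Matrix.transpose_add, Matrix.transpose_smul, Matrix.transpose_mul,
    Matrix.transpose_mul, Matrix.transpose_sub, Matrix.transpose_one, kerProj_transpose, h,
    mul_assoc]

theorem canonicalWeight_eq (F W : Matrix (Fin l) (Fin l) ℝ[X]) (s : ℝ) :
    canonicalWeight F W s = kerProj (ev s F) * (canonicalMat F W s)⁻¹ := by
  rw [canonicalWeight, evalR_eq_ev]

theorem ev_mul_canonicalWeight (F W : Matrix (Fin l) (Fin l) ℝ[X]) (s : ℝ) :
    ev s F * canonicalWeight F W s = 0 := by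
  rw [canonicalWeight_eq, ← mul_assoc, mul_kerProj, zero_mul]

theorem canonicalWeight_eq' (hdet : (canonicalMat F W s).det ≠ 0) :
    canonicalWeight F W s = (canonicalMat F W s)⁻¹ * kerProj (ev s F) := by
  have hu := isUnit_iff_ne_zero.mpr hdet
  have h := congrArg (fun M => (canonicalMat F W s)⁻¹ * M * (canonicalMat F W s)⁻¹)
    (canonicalMat_mul_kerProj F W s)
  simp only [← mul_assoc] at h
  rw [Matrix.nonsing_inv_mul _ hu, one_mul, mul_assoc _ (canonicalMat F W s),
    Matrix.mul_nonsing_inv _ hu, mul_one] at h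
  rw [canonicalWeight_eq, h]

theorem IsWeightPoly.canonicalWeight_transpose (hW : IsWeightPoly F W)
    (hdet : (canonicalMat F W s).det ≠ 0) :
    (canonicalWeight F W s).transpose = canonicalWeight F W s := by
  rw [canonicalWeight_eq, Matrix.transpose_mul, Matrix.transpose_nonsing_inv,
    hW.canonicalMat_transpose, kerProj_transpose, ← canonicalWeight_eq, canonicalWeight_eq' hdet]

/-- The canonical weight in terms of the residue of `F⁻¹` at `s`. -/
theorem IsWeightPoly.ev_inv_mul_canonicalWeight (hW : IsWeightPoly F W) (hs : s ≠ 0)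
    (hs1 : s ^ 2 ≠ 1) (hdet : (canonicalMat F W s).det ≠ 0)
    {K : Matrix (Fin l) (Fin l) ℝ[X]} {h : ℝ[X]} (hK : F * K = ((X - C s) * h) • 1) :
    h.eval s • (ev s⁻¹ F * canonicalWeight F W s) =
      ((s - s⁻¹) * (1 - s⁻¹ * s⁻¹)) • (ev s K).transpose := by
  obtain ⟨B, hB⟩ := exists_mul_kerProj_eq F s
  have hK0 : ev s F * ev s K = 0 := by
    rw [← map_mul, hK, ev_smul]
    simp
  have hEK : kerProj (ev s F) * ev s K = ev s K := kerProj_mul_eq_self hK0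
  have h1 := hW.transpose_mul_mul hs hB hK
  rw [← hW.kerProj_mul_derivative hs hB, smul_mul_assoc] at h1
  have hs2 : s - s⁻¹ ≠ 0 := by
    intro h0
    apply hs1
    field_simp at h0
    linarith
  have h2 : canonicalMat F W s * ev s K = (1 / (2 * (s - s⁻¹))) • (kerProj (ev s F) *
      ev ((s + s⁻¹) / 2) (W.map fun p => derivative p) * ev s K) := by
    conv_lhs => rw [← hEK, ← mul_assoc, canonicalMat_mul_kerProj, kerProj_mul_canonicalMat]
    rw [smul_mul_assoc, mul_assoc _ (kerProj _), hEK]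
  have h3 : ((s - s⁻¹) * (1 - s⁻¹ * s⁻¹)) • (canonicalMat F W s * ev s K) =
      h.eval s • (kerProj (ev s F) * (ev s⁻¹ F).transpose) := by
    rw [← h1, h2, smul_smul]
    congr 1
    field_simp
  have h4 := congrArg (fun M => (canonicalMat F W s)⁻¹ * M) h3
  simp only [mul_smul_comm, ← mul_assoc] at h4
  rw [Matrix.nonsing_inv_mul _ (isUnit_iff_ne_zero.mpr hdet), one_mul,
    ← canonicalWeight_eq' hdet] at h4
  -- Transposing puts the symmetric canonical weight on the right, where the residue computation
  -- needs it.
  have h5 := congrArg Matrix.transpose h4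
  rw [Matrix.transpose_smul, Matrix.transpose_smul, Matrix.transpose_mul,
    Matrix.transpose_transpose, hW.canonicalWeight_transpose hdet] at h5
  exact h5.symm

end

variable {L : ℝ[X] →ₗ[ℝ] Matrix (Fin l) (Fin l) ℝ} {P : ℕ → Matrix (Fin l) (Fin l) ℝ[X]}

/-- A null vector `v` lies in `ker F(s)` and satisfies `B(s) v ⬝ᵥ F(1/s) v = 0`. Since `F(1/s) v` is
a nonzero multiple of `w`, this is the hypothesis of `eq_zero_of_confluent` for the constant vector
`v`. -/
theorem IsOrthonormalSeq.det_canonicalMat_ne_zero (hP : IsOrthonormalSeq L P)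
    (hL : IsPositiveFunctional L) (N : ℕ) {W : Matrix (Fin l) (Fin l) ℝ[X]}
    (hW : IsWeightPoly (psiHat L P N) W) {s : ℝ} (hs : s ≠ 0) (hs1 : -1 < s) (hs2 : s < 1) :
    (canonicalMat (psiHat L P N) W s).det ≠ 0 := by
  set F := psiHat L P N with hF
  set E := kerProj (ev s F) with hE
  intro hdet
  obtain ⟨v, hv0, hv⟩ := Matrix.exists_mulVec_eq_zero_iff.mpr hdet
  have hsq : s ^ 2 < 1 := by nlinarith
  have hss : s - s⁻¹ ≠ 0 := by
    intro h0
    field_simp at h0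
    linarith
  obtain ⟨B, hB⟩ := exists_mul_kerProj_eq F s
  have h1 : (E * ev ((s + s⁻¹) / 2) (W.map fun p => derivative p)).mulVec (E.mulVec v) = 0 := by
    have h := congrArg (E.mulVec ·) hv
    simp only [Matrix.mulVec_mulVec, Matrix.mulVec_zero, hE, kerProj_mul_canonicalMat,
      Matrix.smul_mulVec] at h
    rw [smul_eq_zero_iff_right (by positivity)] at h
    rw [Matrix.mulVec_mulVec]
    exact h
  have hEv : E.mulVec v = v := by
    have h := hv
    rw [canonicalMat_eq, Matrix.add_mulVec, Matrix.smul_mulVec, ← hE, ← Matrix.mulVec_mulVec, h1,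
      smul_zero, zero_add, Matrix.sub_mulVec, Matrix.one_mulVec, sub_eq_zero] at h
    exact h.symm
  rw [hEv] at h1
  have h2 : ((ev s B).transpose * ev s⁻¹ F).mulVec v = 0 := by
    rw [← hW.kerProj_mul_derivative hs hB, Matrix.smul_mulVec, h1, smul_zero]
  have h3 : (ev s B).mulVec v ⬝ᵥ (ev s⁻¹ F).mulVec v = 0 := by
    rw [← Matrix.vecMul_transpose, ← Matrix.dotProduct_mulVec, Matrix.mulVec_mulVec, h2,
      dotProduct_zero]
  have hFv : (ev s F).mulVec v = 0 := by
    rw [← hEv, Matrix.mulVec_mulVec, hE, mul_kerProj, Matrix.zero_mulVec]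
  have hA : ∀ A : Matrix (Fin l) (Fin l) ℝ, A.map (algebraMap ℝ ℝ) = A := fun A => by ext; rfl
  set w := ((recA L P N).transpose * ev ((s + s⁻¹) / 2) (prevPoly P N)).mulVec v with hw
  have hF1 : (ev s⁻¹ F).mulVec v = (s⁻¹ ^ N * (2 * (s - s⁻¹))) • w := by
    rw [hP.mulVec_psiHat N hs, smul_eq_zero_iff_right (pow_ne_zero _ hs), sub_eq_zero, hA, ← hw]
      at hFv
    rw [hP.mulVec_psiHat N (inv_ne_zero hs), inv_inv, add_comm s⁻¹, hFv, hA, ← hw, ← sub_smul,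
      smul_smul]
    congr 1
    ring
  rw [hF1, dotProduct_smul, smul_eq_zero_iff_right (mul_ne_zero (by positivity)
    (mul_ne_zero two_ne_zero hss)), dotProduct_comm] at h3
  refine hv0 (hP.eq_zero_of_confluent hL N hs hs1.le hs2.le (fun i => C (v i))
    (B.mulVec fun i => C (v i)) ?_ v (by simp) ?_)
  · have h4 : (fun i => C (v i)) = (E.map C).mulVec fun i => C (v i) := by
      conv_lhs => rw [← hEv]
      funext i
      simp [Matrix.mulVec, dotProduct]
    rw [h4, Matrix.mulVec_mulVec, ← hF, hB, Matrix.smul_mulVec, ← h4]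
  · have h5 : (fun i => (B.mulVec (fun i => C (v i)) i).eval s) = (ev s B).mulVec v := by
      have := ev_mulVec_eval B (fun i => C (v i)) s
      simp only [coe_aeval_eq_eval, eval_C] at this
      exact this.symm
    rw [h5]
    exact h3

end

noncomputable section

/-! ### Residues of functions with simple poles in the unit disk -/

/-- Lagrange interpolation of the constant `1` at the nodes `S` is the partial fraction expansion;
Cauchy's formula then handles each simple pole. -/
theorem circleIntegral_mul_inv_prod (S : Finset ℂ) (hne : S.Nonempty) (hS : ∀ s ∈ S, ‖s‖ < 1)
    {h : ℂ → ℂ} (hh : DiffContOnCl ℂ h (Metric.ball 0 1)) :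
    (∮ z in C(0, 1), h z * (∏ s ∈ S, (z - s))⁻¹) =
      2 * Real.pi * Complex.I * ∑ s ∈ S, h s * (∏ t ∈ S.erase s, (s - t))⁻¹ := by
  have hoff : ∀ z ∈ Metric.sphere (0 : ℂ) 1, ∀ s ∈ S, z ≠ s := by
    rintro z hz s hs rfl
    rw [mem_sphere_zero_iff_norm] at hz
    exact absurd (hS z hs) (by rw [hz]; exact lt_irrefl _)
  have h1 : Set.EqOn (fun z => h z * (∏ s ∈ S, (z - s))⁻¹)
      (fun z => ∑ s ∈ S, (∏ t ∈ S.erase s, (s - t))⁻¹ * ((z - s)⁻¹ • h z)) (Metric.sphere 0 1) := by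
    intro z hz
    have hprod : ∏ s ∈ S, (z - s) ≠ 0 :=
      Finset.prod_ne_zero_iff.mpr fun s hs => sub_ne_zero.mpr (hoff z hz s hs)
    have h2 := Lagrange.eval_interpolate_not_at_node (s := S) (v := id) (x := z) 1
      (fun i hi => hoff z hz i hi)
    rw [Lagrange.interpolate_one Function.injective_id.injOn hne, eval_one,
      Lagrange.eval_nodal] at h2
    simp only [Lagrange.nodalWeight, id, Pi.one_apply, mul_one, Finset.prod_inv_distrib] at h2
    have h3 := inv_eq_of_mul_eq_one_right h2.symm
    simp only [h3, Finset.mul_sum]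
    refine Finset.sum_congr rfl fun s _ => ?_
    rw [smul_eq_mul]; ring
  rw [circleIntegral.integral_congr zero_le_one h1, circleIntegral.integral_fun_sum, Finset.mul_sum]
  · refine Finset.sum_congr rfl fun s hs => ?_
    rw [circleIntegral.integral_const_mul, hh.circleIntegral_sub_inv_smul (by simpa using hS s hs),
      smul_eq_mul]
    ring
  · intro s hs
    simp only [smul_eq_mul]
    refine ContinuousOn.circleIntegrable zero_le_one (continuousOn_const.mul (ContinuousOn.mul ?_ ?_))
    · exact (continuousOn_id.sub continuousOn_const).inv₀
        fun z hz => sub_ne_zero.mpr (hoff z hz s hs)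
    · exact hh.continuousOn_ball.mono Metric.sphere_subset_closedBall

theorem circleIntegral_mul_inv_prod_real (S : Finset ℝ) (h0 : (0 : ℝ) ∉ S)
    (hS : ∀ s ∈ S, -1 < s ∧ s < 1) {h : ℂ → ℂ} (hh : DiffContOnCl ℂ h (Metric.ball 0 1)) :
    (∮ z in C(0, 1), h z * (z * ∏ s ∈ S, (z - (s : ℂ)))⁻¹) =
      2 * Real.pi * Complex.I * (h 0 * (∏ s ∈ S, (0 - (s : ℂ)))⁻¹ +
        ∑ s ∈ S, h s * ((s : ℂ) * ∏ t ∈ S.erase s, ((s : ℂ) - t))⁻¹) := by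
  classical
  have hinj : Function.Injective (fun s : ℝ => (s : ℂ)) := Complex.ofReal_injective
  set e : ℝ ↪ ℂ := ⟨fun s => (s : ℂ), hinj⟩ with he
  have h0' : (0 : ℂ) ∉ S.map e := by
    simp only [Finset.mem_map, not_exists, not_and]
    intro s hs hs0
    have : s = 0 := by exact_mod_cast (show (s : ℂ) = 0 from hs0)
    exact h0 (this ▸ hs)
  have h1 := circleIntegral_mul_inv_prod (insert 0 (S.map e)) (Finset.insert_nonempty _ _) (by
    intro s hs
    rcases Finset.mem_insert.mp hs with rfl | hs
    · simp
    · obtain ⟨t, ht, rfl⟩ := Finset.mem_map.mp hs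
      change ‖(t : ℂ)‖ < 1
      rw [Complex.norm_real]
      exact abs_lt.mpr (hS t ht)) hh
  simp only [Finset.prod_insert h0', Finset.sum_insert h0', Finset.prod_map, Finset.sum_map,
    Finset.erase_insert h0', sub_zero] at h1
  refine h1.trans ?_
  congr 2
  refine Finset.sum_congr rfl fun s hs => ?_
  have hse : e s ≠ 0 := by
    intro hs0
    exact h0' (hs0 ▸ Finset.mem_map_of_mem e hs)
  rw [Finset.erase_insert_of_ne hse.symm, Finset.prod_insert (fun h => h0' (Finset.mem_of_mem_erase h)),
    ← Finset.map_erase, Finset.prod_map, sub_zero]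
  rfl

/-! ### The substitution `x = cos θ` -/

open MeasureTheory intervalIntegral Set

theorem image_cos_Ioo : Real.cos '' Ioo 0 Real.pi = Ioo (-1) 1 := by
  ext x
  constructor
  · rintro ⟨θ, ⟨h1, h2⟩, rfl⟩
    refine ⟨?_, ?_⟩
    · rw [← Real.cos_pi]
      exact Real.strictAntiOn_cos ⟨h1.le, h2.le⟩ ⟨Real.pi_pos.le, le_rfl⟩ h2
    · rw [← Real.cos_zero]
      exact Real.strictAntiOn_cos ⟨le_rfl, Real.pi_pos.le⟩ ⟨h1.le, h2.le⟩ h1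
  · rintro ⟨h1, h2⟩
    exact ⟨Real.arccos x, ⟨Real.arccos_pos.mpr h2, Real.arccos_lt_pi.mpr h1⟩,
      Real.cos_arccos h1.le h2.le⟩

theorem injOn_cos_Ioo : InjOn Real.cos (Ioo 0 Real.pi) :=
  Real.injOn_cos.mono Ioo_subset_Icc_self

/-- The Jacobian `sin θ` absorbs possible endpoint singularities of `f`. -/
theorem intervalIntegrable_of_cos {f c : ℝ → ℝ} (hc : Continuous c)
    (hf : ∀ θ ∈ Ioo 0 Real.pi, Real.sin θ * f (Real.cos θ) = c θ) :
    IntervalIntegrable f volume (-1) 1 := by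
  rw [intervalIntegrable_iff_integrableOn_Ioo_of_le (by norm_num), ← image_cos_Ioo,
    integrableOn_image_iff_integrableOn_abs_deriv_smul measurableSet_Ioo
      (fun θ _ => (Real.hasDerivAt_cos θ).hasDerivWithinAt) injOn_cos_Ioo]
  refine (hc.integrableOn_Icc.mono_set Ioo_subset_Icc_self).congr_fun (fun θ hθ => ?_)
    measurableSet_Ioo
  rw [← hf θ hθ, abs_neg, abs_of_pos (Real.sin_pos_of_mem_Ioo hθ), smul_eq_mul]

theorem integral_eq_of_cos {f c : ℝ → ℝ}
    (hf : ∀ θ ∈ Ioo 0 Real.pi, Real.sin θ * f (Real.cos θ) = c θ) :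
    ∫ x in (-1 : ℝ)..1, f x = ∫ θ in (0 : ℝ)..Real.pi, c θ := by
  rw [integral_of_le (by norm_num), integral_Ioc_eq_integral_Ioo, ← image_cos_Ioo,
    integral_image_eq_integral_abs_deriv_smul measurableSet_Ioo
      (fun θ _ => (Real.hasDerivAt_cos θ).hasDerivWithinAt) injOn_cos_Ioo,
    integral_of_le Real.pi_pos.le, integral_Ioc_eq_integral_Ioo]
  refine setIntegral_congr_fun measurableSet_Ioo fun θ hθ => ?_
  rw [← hf θ hθ, abs_neg, abs_of_pos (Real.sin_pos_of_mem_Ioo hθ), smul_eq_mul]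

/-- An integral over `[-1, 1]` as a contour integral over the unit circle. -/
theorem integral_eq_circleIntegral {f : ℝ → ℝ} {G : ℂ → ℂ}
    (hG : ContinuousOn G (Metric.sphere 0 1))
    (hf : ∀ θ ∈ Ioo 0 Real.pi, ((Real.sin θ * f (Real.cos θ) : ℝ) : ℂ) =
      (Complex.exp (θ * Complex.I) * G (Complex.exp (θ * Complex.I)) +
        (Complex.exp (θ * Complex.I))⁻¹ * G (Complex.exp (θ * Complex.I))⁻¹) / 4) :
    IntervalIntegrable f volume (-1) 1 ∧
    ((2 / Real.pi * ∫ x in (-1 : ℝ)..1, f x : ℝ) : ℂ) =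
      (2 * Real.pi * Complex.I)⁻¹ * ∮ z in C(0, 1), G z := by
  set u : ℝ → ℂ := fun θ => Complex.exp (θ * Complex.I) * G (Complex.exp (θ * Complex.I)) with hu
  have hexp : Continuous fun θ : ℝ => Complex.exp (θ * Complex.I) := by fun_prop
  have hucont : Continuous u := by
    refine hexp.mul (hG.comp_continuous hexp fun θ => ?_)
    rw [mem_sphere_zero_iff_norm, Complex.norm_exp_ofReal_mul_I]
  have hper : Function.Periodic u (2 * Real.pi) := by
    intro θ
    have : Complex.exp (((θ + 2 * Real.pi : ℝ) : ℂ) * Complex.I) = Complex.exp (θ * Complex.I) := by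
      rw [← Complex.exp_periodic (θ * Complex.I)]
      congr 1
      push_cast; ring
    simp only [hu, this]
  have hneg : ∀ θ : ℝ, (Complex.exp (θ * Complex.I))⁻¹ = Complex.exp (((-θ : ℝ) : ℂ) * Complex.I) := by
    intro θ
    rw [← Complex.exp_neg]
    congr 1
    push_cast; ring
  have hf' : ∀ θ ∈ Ioo 0 Real.pi, ((Real.sin θ * f (Real.cos θ) : ℝ) : ℂ) = (u θ + u (-θ)) / 4 := by
    intro θ hθ
    rw [hf θ hθ, hneg]
  set c : ℝ → ℝ := fun θ => ((u θ + u (-θ)) / 4).re with hc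
  have hccont : Continuous c :=
    Complex.continuous_re.comp ((hucont.add (hucont.comp continuous_neg)).div_const 4)
  have hfc : ∀ θ ∈ Ioo 0 Real.pi, Real.sin θ * f (Real.cos θ) = c θ := by
    intro θ hθ
    rw [hc]
    simp only
    rw [← hf' θ hθ, Complex.ofReal_re]
  refine ⟨intervalIntegrable_of_cos hccont hfc, ?_⟩
  have h1 : ((∫ x in (-1 : ℝ)..1, f x : ℝ) : ℂ) = ∫ θ in (0 : ℝ)..Real.pi, (u θ + u (-θ)) / 4 := by
    rw [integral_eq_of_cos (c := fun θ => Real.sin θ * f (Real.cos θ)) fun θ _ => rfl,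
      ← intervalIntegral.integral_ofReal, integral_of_le Real.pi_pos.le,
      integral_of_le Real.pi_pos.le, integral_Ioc_eq_integral_Ioo, integral_Ioc_eq_integral_Ioo]
    exact setIntegral_congr_fun measurableSet_Ioo hf'
  -- The reflected half fills `[-π, 0]`, and periodicity moves `[-π, π]` to `[0, 2π]`.
  have h2 : ∫ θ in (0 : ℝ)..Real.pi, (u θ + u (-θ)) / 4 = (∫ θ in (0 : ℝ)..(2 * Real.pi), u θ) / 4 := by
    have hu' : Continuous fun θ => u (-θ) := hucont.comp continuous_neg
    rw [intervalIntegral.integral_div, intervalIntegral.integral_add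
      (hucont.intervalIntegrable _ _) (hu'.intervalIntegrable _ _),
      intervalIntegral.integral_comp_neg, neg_zero, add_comm,
      intervalIntegral.integral_add_adjacent_intervals (hucont.intervalIntegrable _ _)
        (hucont.intervalIntegrable _ _)]
    have := hper.intervalIntegral_add_eq (-Real.pi) 0
    rw [show -Real.pi + 2 * Real.pi = Real.pi by ring, zero_add] at this
    rw [this]
  have h3 : (∮ z in C(0, 1), G z) = Complex.I * ∫ θ in (0 : ℝ)..(2 * Real.pi), u θ := by
    rw [circleIntegral, ← intervalIntegral.integral_const_mul]
    refine intervalIntegral.integral_congr fun θ _ => ?_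
    simp only [deriv_circleMap, circleMap_zero, Complex.ofReal_one, one_mul, smul_eq_mul, hu]
    ring
  rw [Complex.ofReal_mul, h1, h2, h3]
  have hpi : (Real.pi : ℂ) ≠ 0 := Complex.ofReal_ne_zero.mpr Real.pi_ne_zero
  have hI := Complex.I_ne_zero
  push_cast
  field_simp
  ring

end

noncomputable section

open MeasureTheory Set

variable {l : ℕ}

theorem map_ofReal_inv {M : Matrix (Fin l) (Fin l) ℝ} (hM : M.det ≠ 0) :
    M⁻¹.map Complex.ofReal = (M.map Complex.ofReal)⁻¹ := by
  refine (Matrix.inv_eq_right_inv ?_).symm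
  have h := congrArg (Complex.ofRealHom.mapMatrix) (Matrix.mul_nonsing_inv M (isUnit_iff_ne_zero.mpr hM))
  rw [map_mul, map_one] at h
  exact h

/-! ### The inverse of the weight polynomial in terms of a scalar denominator. -/

section Weight

variable {F W K : Matrix (Fin l) (Fin l) ℝ[X]} {c : ℝ[X]}

theorem ev_transpose_mul_denominator (hK : F * K = c • 1) {z : ℂ} (hz : aeval z c ≠ 0) :
    (ev z F).transpose * ((aeval z c)⁻¹ • (ev z K).transpose) = 1 := by
  have h : ev z F * ((aeval z c)⁻¹ • ev z K) = 1 := by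
    rw [mul_smul_comm, ← map_mul, hK, ev_smul, map_one, smul_smul, inv_mul_cancel₀ hz, one_smul]
  have h2 := congrArg Matrix.transpose (mul_eq_one_comm.mp h)
  rwa [Matrix.transpose_mul, Matrix.transpose_one, Matrix.transpose_smul] at h2

theorem ev_mul_denominator (hK : F * K = c • 1) {z : ℂ} (hz : aeval z c ≠ 0) :
    ev z F * ((aeval z c)⁻¹ • ev z K) = 1 := by
  rw [mul_smul_comm, ← map_mul, hK, ev_smul, map_one, smul_smul, inv_mul_cancel₀ hz, one_smul]

theorem IsWeightPoly.inv_eq (hW : IsWeightPoly F W) (hK : F * K = c • 1) {z : ℂ} (hz0 : z ≠ 0)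
    (hz : aeval z c ≠ 0) (hz' : aeval z⁻¹ c ≠ 0) :
    (ev ((z + z⁻¹) / 2) W)⁻¹ =
      ((aeval z c)⁻¹ • ev z K) * ((aeval z⁻¹ c)⁻¹ • (ev z⁻¹ K).transpose) := by
  refine Matrix.inv_eq_right_inv ?_
  rw [hW.ev_eq hz0, mul_assoc, ← mul_assoc (ev z F), ev_mul_denominator hK hz, one_mul,
    ev_transpose_mul_denominator hK hz']

/-- One factor of `W` cancels, so only the denominator at `1/z` remains; this is what makes the
contour integrand meromorphic with poles on one side. -/
theorem IsWeightPoly.ev_mul_inv (hW : IsWeightPoly F W) (hK : F * K = c • 1) {z : ℂ} (hz0 : z ≠ 0)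
    (hz : aeval z c ≠ 0) (hz' : aeval z⁻¹ c ≠ 0) :
    ev z F * (ev ((z + z⁻¹) / 2) W)⁻¹ = (aeval z⁻¹ c)⁻¹ • (ev z⁻¹ K).transpose := by
  rw [hW.inv_eq hK hz0 hz hz', ← mul_assoc, ev_mul_denominator hK hz, one_mul]

theorem IsWeightPoly.ev_inv_mul_inv (hW : IsWeightPoly F W) (hK : F * K = c • 1) {z : ℂ}
    (hz0 : z ≠ 0) (hz : aeval z c ≠ 0) (hz' : aeval z⁻¹ c ≠ 0) :
    ev z⁻¹ F * (ev ((z + z⁻¹) / 2) W)⁻¹ = (aeval z c)⁻¹ • (ev z K).transpose := by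
  have h := hW.ev_mul_inv hK (inv_ne_zero hz0) hz' (by rwa [inv_inv])
  rwa [inv_inv, add_comm] at h

theorem IsWeightPoly.map_inv (hW : IsWeightPoly F W) (hK : F * K = c • 1) {z : ℂ} (hz0 : z ≠ 0)
    (hz : aeval z c ≠ 0) (hz' : aeval z⁻¹ c ≠ 0) {x : ℝ} (hx : (z + z⁻¹) / 2 = x) :
    (ev x W)⁻¹.map Complex.ofReal = (ev ((z + z⁻¹) / 2) W)⁻¹ := by
  have hdet : (ev x W).det ≠ 0 := by
    intro h
    have h1 : (ev ((z + z⁻¹) / 2) W).det = 0 := by rw [hx, det_ev_ofReal, h, Complex.ofReal_zero]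
    rw [hW.ev_eq hz0, Matrix.det_mul, Matrix.det_transpose] at h1
    have h2 := congrArg Matrix.det (ev_mul_denominator hK hz)
    have h3 := congrArg Matrix.det (ev_mul_denominator hK hz')
    rw [Matrix.det_mul, Matrix.det_one] at h2 h3
    rcases mul_eq_zero.mp h1 with h4 | h4
    · rw [h4, zero_mul] at h3; exact zero_ne_one h3
    · rw [h4, zero_mul] at h2; exact zero_ne_one h2
  rw [map_ofReal_inv hdet, hx, ev_ofReal]

end Weight

/-! ### Points of the unit circle -/

section Circle

variable {θ : ℝ}

theorem exp_mul_I_add_inv (θ : ℝ) :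
    (Complex.exp (θ * Complex.I) + (Complex.exp (θ * Complex.I))⁻¹) / 2 = (Real.cos θ : ℂ) := by
  rw [← Complex.exp_neg, Complex.ofReal_cos, Complex.cos, neg_mul]

/-- These are the factors that `1 - X ^ 2` in `diskPoly` contributes to the denominators at `z` and
`1/z`. -/
theorem sin_sq_eq_exp (θ : ℝ) : ((Real.sin θ : ℂ)) ^ 2 =
    (1 - Complex.exp (θ * Complex.I) ^ 2) * (1 - (Complex.exp (θ * Complex.I))⁻¹ ^ 2) / 4 := by
  have h1 := exp_mul_I_add_inv θ
  have h2 : ((Real.sin θ : ℂ)) ^ 2 = 1 - ((Real.cos θ : ℂ)) ^ 2 := by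
    have := Real.sin_sq θ
    exact_mod_cast this
  have h3 : Complex.exp (θ * Complex.I) * (Complex.exp (θ * Complex.I))⁻¹ = 1 :=
    mul_inv_cancel₀ (Complex.exp_ne_zero _)
  rw [h2, ← h1]
  linear_combination ((Complex.exp (θ * Complex.I) * (Complex.exp (θ * Complex.I))⁻¹) / (-4) - 3 / 4) * h3

theorem one_sub_exp_sq_ne_zero (hθ : θ ∈ Ioo 0 Real.pi) :
    1 - Complex.exp (θ * Complex.I) ^ 2 ≠ 0 ∧ 1 - (Complex.exp (θ * Complex.I))⁻¹ ^ 2 ≠ 0 := by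
  have h : ((Real.sin θ : ℂ)) ^ 2 ≠ 0 :=
    pow_ne_zero _ (Complex.ofReal_ne_zero.mpr (Real.sin_pos_of_mem_Ioo hθ).ne')
  rw [sin_sq_eq_exp] at h
  have h' := (div_ne_zero_iff.mp h).1
  exact ⟨left_ne_zero_of_mul h', right_ne_zero_of_mul h'⟩

theorem sqrt_one_sub_cos_sq (hθ : θ ∈ Ioo 0 Real.pi) : √(1 - Real.cos θ ^ 2) = Real.sin θ := by
  rw [← Real.sin_sq, Real.sqrt_sq (Real.sin_pos_of_mem_Ioo hθ).le]

end Circle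

/-! ### Integrals against the weight, by residues. -/

section Integral

variable {F W K : Matrix (Fin l) (Fin l) ℝ[X]} {q : ℝ[X]} {S : Finset ℝ}

theorem aeval_diskPoly_mul (S : Finset ℝ) (q : ℝ[X]) (z : ℂ) :
    aeval z (diskPoly S * q) = (1 - z ^ 2) * ((∏ s ∈ S, (z - (s : ℂ))) * aeval z q) := by
  simp [diskPoly, map_prod, mul_assoc]

theorem prod_sub_mul_ne_zero (hS : ∀ s ∈ S, -1 < s ∧ s < 1)
    (hq : ∀ z : ℂ, ‖z‖ ≤ 1 → aeval z q ≠ 0) {z : ℂ} (hz : ‖z‖ = 1) :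
    (∏ s ∈ S, (z - (s : ℂ))) * aeval z q ≠ 0 := by
  refine mul_ne_zero (Finset.prod_ne_zero_iff.mpr fun s hs => ?_) (hq z hz.le)
  rw [sub_ne_zero]
  rintro rfl
  rw [Complex.norm_real] at hz
  exact absurd (abs_lt.mpr (hS s hs)) (not_lt.mpr hz.ge)

/-- After `x = cos θ` the square root and the Jacobian give `sin² θ`, which cancels the possible
singularities of `W⁻¹` at `±1`; the remaining denominators do not vanish on the circle. -/
theorem IsWeightPoly.intervalIntegrable (hW : IsWeightPoly F W)
    (hK : F * K = (diskPoly S * q) • 1) (hS : ∀ s ∈ S, -1 < s ∧ s < 1)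
    (hq : ∀ z : ℂ, ‖z‖ ≤ 1 → aeval z q ≠ 0) (f : ℝ[X]) (i j : Fin l) :
    IntervalIntegrable (fun x : ℝ => f.eval x * √(1 - x ^ 2) * (ev x W)⁻¹ i j) volume (-1) 1 := by
  set e : ℝ → ℂ := fun θ => Complex.exp (θ * Complex.I) with he
  set r : ℂ → ℂ := fun z => (∏ s ∈ S, (z - (s : ℂ))) * aeval z q with hr
  have hecont : Continuous e := by fun_prop
  have hnorm : ∀ θ, ‖e θ‖ = 1 := fun θ => Complex.norm_exp_ofReal_mul_I θ
  have hnorm' : ∀ θ, ‖(e θ)⁻¹‖ = 1 := fun θ => by rw [norm_inv, hnorm, inv_one]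
  have hrcont : Continuous r :=
    (continuous_finsetProd _ fun s _ => continuous_id.sub continuous_const).mul q.continuous_aeval
  have he0 : ∀ θ, e θ ≠ 0 := fun θ => Complex.exp_ne_zero _
  have heinv : Continuous fun θ => (e θ)⁻¹ := hecont.inv₀ he0
  have hr1 : ∀ θ, r (e θ) ≠ 0 := fun θ => prod_sub_mul_ne_zero hS hq (hnorm θ)
  have hr2 : ∀ θ, r (e θ)⁻¹ ≠ 0 := fun θ => prod_sub_mul_ne_zero hS hq (hnorm' θ)
  refine intervalIntegrable_of_cos (c := fun θ => f.eval (Real.cos θ) *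
    ((∑ k, aeval (e θ) (K i k) * aeval (e θ)⁻¹ (K j k)) / (4 * r (e θ) * r (e θ)⁻¹)).re) ?_ ?_
  · refine (f.continuous.comp Real.continuous_cos).mul (Complex.continuous_re.comp ?_)
    refine Continuous.div (continuous_finsetSum _ fun k _ => ?_) ?_ fun θ =>
      mul_ne_zero (mul_ne_zero (by norm_num : (4 : ℂ) ≠ 0) (hr1 θ)) (hr2 θ)
    · exact ((K i k).continuous_aeval.comp hecont).mul ((K j k).continuous_aeval.comp heinv)
    · exact (continuous_const.mul (hrcont.comp hecont)).mul (hrcont.comp heinv)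
  · intro θ hθ
    obtain ⟨h1, h2⟩ := one_sub_exp_sq_ne_zero hθ
    have hc1 : aeval (e θ) (diskPoly S * q) ≠ 0 := by
      rw [aeval_diskPoly_mul]; exact mul_ne_zero h1 (hr1 θ)
    have hc2 : aeval (e θ)⁻¹ (diskPoly S * q) ≠ 0 := by
      rw [aeval_diskPoly_mul]; exact mul_ne_zero h2 (hr2 θ)
    have hinv := hW.map_inv hK (he0 θ) hc1 hc2 (exp_mul_I_add_inv θ)
    rw [hW.inv_eq hK (he0 θ) hc1 hc2] at hinv
    have hij : (((ev (Real.cos θ) W)⁻¹ i j : ℝ) : ℂ) = (aeval (e θ) (diskPoly S * q))⁻¹ *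
        (aeval (e θ)⁻¹ (diskPoly S * q))⁻¹ * ∑ k, aeval (e θ) (K i k) * aeval (e θ)⁻¹ (K j k) := by
      have := congrFun (congrFun hinv i) j
      rw [smul_mul_smul_comm] at this
      simpa [Matrix.mul_apply, ev_apply] using this
    have hmain : ((Real.sin θ ^ 2 * (ev (Real.cos θ) W)⁻¹ i j : ℝ) : ℂ) =
        (∑ k, aeval (e θ) (K i k) * aeval (e θ)⁻¹ (K j k)) / (4 * r (e θ) * r (e θ)⁻¹) := by
      rw [Complex.ofReal_mul, Complex.ofReal_pow, sin_sq_eq_exp, hij, aeval_diskPoly_mul,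
        aeval_diskPoly_mul]
      change (1 - e θ ^ 2) * (1 - (e θ)⁻¹ ^ 2) / 4 * (((1 - e θ ^ 2) * r (e θ))⁻¹ *
        ((1 - (e θ)⁻¹ ^ 2) * r (e θ)⁻¹)⁻¹ * _) = _
      change 1 - e θ ^ 2 ≠ 0 at h1
      change 1 - (e θ)⁻¹ ^ 2 ≠ 0 at h2
      have h3 := hr1 θ
      have h4 := hr2 θ
      generalize 1 - e θ ^ 2 = y1 at *
      generalize 1 - (e θ)⁻¹ ^ 2 = y2 at *
      generalize r (e θ) = y3 at *
      generalize r (e θ)⁻¹ = y4 at *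
      field_simp
    rw [← hmain, Complex.ofReal_re, sqrt_one_sub_cos_sq hθ]
    ring

/-- The integral of `g W⁻¹ Qᵗ` with respect to `√(1 - x²)` by residues, for `g` of the form
`(z⁻¹ - z) g(x) = z ^ (-n - 1) F(z) - z ^ (n + 1) F(1 / z)` and `Q` of degree at most `n`. -/
theorem IsWeightPoly.integral_eq_residues (hW : IsWeightPoly F W)
    (hK : F * K = (diskPoly S * q) • 1) (h0 : (0 : ℝ) ∉ S) (hS : ∀ s ∈ S, -1 < s ∧ s < 1)
    (hq : ∀ z : ℂ, ‖z‖ ≤ 1 → aeval z q ≠ 0) {g Q : Matrix (Fin l) (Fin l) ℝ[X]} {n : ℕ}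
    (hg : ∀ z : ℂ, z ≠ 0 → (z⁻¹ - z) • ev ((z + z⁻¹) / 2) g =
      z⁻¹ ^ (n + 1) • ev z F - z ^ (n + 1) • ev z⁻¹ F)
    (hQ : DegLT Q (n + 1)) (a b : Fin l) :
    IntervalIntegrable (fun x : ℝ => √(1 - x ^ 2) *
      (ev x g * (ev x W)⁻¹ * (ev x Q).transpose) a b) volume (-1) 1 ∧
    2 / Real.pi * (∫ x in (-1 : ℝ)..1, √(1 - x ^ 2) *
      (ev x g * (ev x W)⁻¹ * (ev x Q).transpose) a b) =
    ((Q.map (pull n) * K) b a).eval 0 / q.eval 0 * (∏ s ∈ S, (0 - s))⁻¹ +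
    ∑ s ∈ S, ((Q.map (pull n) * K) b a).eval s / q.eval s *
      (s * ∏ t ∈ S.erase s, (s - t))⁻¹ := by
  set p := (Q.map (pull n) * K) b a with hp
  set h : ℂ → ℂ := fun z => aeval z p / aeval z q with hh
  -- The factor `1 - z²` has already been cancelled, so `G` has no pole on the circle, and inside
  -- only possible simple poles at `0` and `S`.
  set G : ℂ → ℂ := fun z => h z * (z * ∏ s ∈ S, (z - (s : ℂ)))⁻¹ with hG
  have hdiff : DiffContOnCl ℂ h (Metric.ball 0 1) := by
    refine DifferentiableOn.diffContOnCl_ball (U := Metric.closedBall 0 1) (fun z hz => ?_) le_rfl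
    refine DifferentiableWithinAt.div (p.differentiable_aeval.differentiableAt.differentiableWithinAt)
      (q.differentiable_aeval.differentiableAt.differentiableWithinAt) (hq z ?_)
    simpa using hz
  have hGcont : ContinuousOn G (Metric.sphere 0 1) := by
    refine (hdiff.continuousOn_ball.mono Metric.sphere_subset_closedBall).mul (ContinuousOn.inv₀ ?_ ?_)
    · exact (continuous_id.mul
        (continuous_finsetProd _ fun s _ => continuous_id.sub continuous_const)).continuousOn
    · intro z hz
      rw [mem_sphere_zero_iff_norm] at hz
      refine mul_ne_zero ?_ (left_ne_zero_of_mul (prod_sub_mul_ne_zero hS hq hz))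
      rintro rfl
      simp at hz
  have hzG : ∀ z : ℂ, z ≠ 0 → aeval z (diskPoly S * q) ≠ 0 → z * G z = (1 - z ^ 2) * z ^ n *
      (((aeval z (diskPoly S * q))⁻¹ • (ev z K).transpose) *
        (ev ((z + z⁻¹) / 2) Q).transpose) a b := by
    intro z hz0 hz
    have h1 : aeval z p = z ^ n * ((ev z K).transpose * (ev ((z + z⁻¹) / 2) Q).transpose) a b := by
      rw [← Matrix.transpose_mul, Matrix.transpose_apply, hp, ← ev_apply, map_mul,
        ev_map_pull hQ hz0, smul_mul_assoc, Matrix.smul_apply, smul_eq_mul]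
    rw [smul_mul_assoc, Matrix.smul_apply, smul_eq_mul]
    generalize ((ev z K).transpose * (ev ((z + z⁻¹) / 2) Q).transpose) a b = y at *
    rw [aeval_diskPoly_mul] at hz ⊢
    simp only [hG, hh, h1]
    have h2 := left_ne_zero_of_mul hz
    have h3 := left_ne_zero_of_mul (right_ne_zero_of_mul hz)
    have h4 := right_ne_zero_of_mul (right_ne_zero_of_mul hz)
    generalize 1 - z ^ 2 = y1 at *
    generalize (∏ s ∈ S, (z - (s : ℂ))) = y2 at *
    field_simp
  obtain ⟨hint, hval⟩ := integral_eq_circleIntegral (f := fun x : ℝ => √(1 - x ^ 2) *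
      (ev x g * (ev x W)⁻¹ * (ev x Q).transpose) a b) hGcont (by
    intro θ hθ
    obtain ⟨h1, h2⟩ := one_sub_exp_sq_ne_zero hθ
    have hsin := sin_sq_eq_exp θ
    have hx := exp_mul_I_add_inv θ
    have hnorm : ‖Complex.exp (θ * Complex.I)‖ = 1 := Complex.norm_exp_ofReal_mul_I θ
    have hz0 : Complex.exp (θ * Complex.I) ≠ 0 := Complex.exp_ne_zero _
    generalize Complex.exp (θ * Complex.I) = z at *
    have hc1 : aeval z (diskPoly S * q) ≠ 0 := by
      rw [aeval_diskPoly_mul]; exact mul_ne_zero h1 (prod_sub_mul_ne_zero hS hq hnorm)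
    have hc2 : aeval z⁻¹ (diskPoly S * q) ≠ 0 := by
      rw [aeval_diskPoly_mul]
      exact mul_ne_zero h2 (prod_sub_mul_ne_zero hS hq (by rw [norm_inv, hnorm, inv_one]))
    have hcast : (((ev (Real.cos θ) g * (ev (Real.cos θ) W)⁻¹ *
        (ev (Real.cos θ) Q).transpose) a b : ℝ) : ℂ) =
        (ev ((z + z⁻¹) / 2) g * (ev ((z + z⁻¹) / 2) W)⁻¹ *
          (ev ((z + z⁻¹) / 2) Q).transpose) a b := by
      rw [← hW.map_inv hK hz0 hc1 hc2 hx, hx, ev_ofReal, ev_ofReal]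
      simp [Matrix.mul_apply]
    rw [sqrt_one_sub_cos_sq hθ, ← mul_assoc, ← sq, Complex.ofReal_mul, hcast, Complex.ofReal_pow,
      hsin, hzG z hz0 hc1, hzG z⁻¹ (inv_ne_zero hz0) hc2, inv_inv, add_comm z⁻¹]
    -- The two terms of `hg` become the contributions of `1/z` and `z`, interchanged by reflection
    -- of the circle.
    have hy := congrArg (fun M => (M * (ev ((z + z⁻¹) / 2) W)⁻¹ *
      (ev ((z + z⁻¹) / 2) Q).transpose) a b) (hg z hz0)
    simp only [sub_mul, smul_mul_assoc, hW.ev_mul_inv hK hz0 hc1 hc2,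
      hW.ev_inv_mul_inv hK hz0 hc1 hc2, Matrix.sub_apply, Matrix.smul_apply, smul_eq_mul] at hy
    simp only [smul_mul_assoc, Matrix.smul_apply, smul_eq_mul]
    have hzw : z * z⁻¹ = 1 := mul_inv_cancel₀ hz0
    generalize (ev ((z + z⁻¹) / 2) g * (ev ((z + z⁻¹) / 2) W)⁻¹ *
          (ev ((z + z⁻¹) / 2) Q).transpose) a b = y at *
    generalize (aeval z (diskPoly S * q))⁻¹ * ((ev z K).transpose * (ev ((z + z⁻¹) / 2) Q).transpose) a b
      = y2 at *
    generalize (aeval z⁻¹ (diskPoly S * q))⁻¹ *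
      ((ev z⁻¹ K).transpose * (ev ((z + z⁻¹) / 2) Q).transpose) a b = y1 at *
    rw [← sub_mul] at hy
    have e1 : z * z⁻¹ ^ (n + 1) = z⁻¹ ^ n := by rw [pow_succ', ← mul_assoc, hzw, one_mul]
    have e2 : (1 - z ^ 2) = z * (z⁻¹ - z) := by rw [mul_sub, hzw]; ring
    have e3 : z * (1 - z⁻¹ ^ 2) * z ^ (n + 1) = (z ^ 2 - 1) * z ^ n := by
      field_simp
      ring
    calc (1 - z ^ 2) * (1 - z⁻¹ ^ 2) / 4 * y
        = z * (1 - z⁻¹ ^ 2) / 4 * ((z⁻¹ - z) * y) := by rw [e2]; ring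
      _ = ((1 - z⁻¹ ^ 2) * (z * z⁻¹ ^ (n + 1)) * y1 -
          (z * (1 - z⁻¹ ^ 2) * z ^ (n + 1)) * y2) / 4 := by rw [hy]; ring
      _ = _ := by rw [e1, e3]; ring)
  refine ⟨hint, ?_⟩
  have hpi : (2 * Real.pi * Complex.I : ℂ) ≠ 0 :=
    mul_ne_zero (mul_ne_zero two_ne_zero (Complex.ofReal_ne_zero.mpr Real.pi_ne_zero))
      Complex.I_ne_zero
  rw [circleIntegral_mul_inv_prod_real S h0 hS hdiff, ← mul_assoc, inv_mul_cancel₀ hpi, one_mul]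
    at hval
  have hreal : ∀ s : ℝ, h s = ((p.eval s / q.eval s : ℝ) : ℂ) := by
    intro s
    simp only [hh, aeval_ofReal, Complex.ofReal_div]
  have hreal0 : h 0 = ((p.eval 0 / q.eval 0 : ℝ) : ℂ) := by
    rw [← Complex.ofReal_zero, hreal]
  simp only [hreal, hreal0] at hval
  exact_mod_cast hval

end Integral

end

noncomputable section

variable {l : ℕ} {L : ℝ[X] →ₗ[ℝ] Matrix (Fin l) (Fin l) ℝ} {P : ℕ → Matrix (Fin l) (Fin l) ℝ[X]}

/-! ### Continuation by the free recurrence -/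

/-- The polynomials with index `N, N + 1, …` obtained from `P_{N-1}` and `P_N` by the recurrence
with constant coefficients `A_{n+1} = 1 / 2`, `B_n = 0` for `n ≥ N`. -/
def freePoly (L : ℝ[X] →ₗ[ℝ] Matrix (Fin l) (Fin l) ℝ) (P : ℕ → Matrix (Fin l) (Fin l) ℝ[X])
    (N : ℕ) : ℕ → Matrix (Fin l) (Fin l) ℝ[X]
  | 0 => P N
  | 1 => ((X : ℝ[X]) • P N + (X : ℝ[X]) • P N) -
      ((recA L P N).transpose.map C * prevPoly P N + (recA L P N).transpose.map C * prevPoly P N)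
  | k + 2 => ((X : ℝ[X]) • freePoly L P N (k + 1) + (X : ℝ[X]) • freePoly L P N (k + 1)) -
      freePoly L P N k

theorem freePoly_zero (N : ℕ) : freePoly L P N 0 = P N := by rw [freePoly]

/-- As sequences in `k`, both sides solve `y_{k+2} = (z + 1/z) y_{k+1} - y_k`, whose basic solutions
are powers of `z` and `1/z`; the cases `k = 0, 1` fix the combination. -/
theorem IsOrthonormalSeq.ev_freePoly {𝕜 : Type*} [Field 𝕜] [Algebra ℝ 𝕜]
    (hP : IsOrthonormalSeq L P) (N k : ℕ) {z : 𝕜} (hz : z ≠ 0) :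
    (z⁻¹ - z) • ev ((z + z⁻¹) / 2) (freePoly L P N k) =
      z⁻¹ ^ (N + k + 1) • ev z (psiHat L P N) - z ^ (N + k + 1) • ev z⁻¹ (psiHat L P N) := by
  have : CharZero 𝕜 := charZero_of_injective_algebraMap (algebraMap ℝ 𝕜).injective
  set x := (z + z⁻¹) / 2 with hx
  have hzw : z * z⁻¹ = 1 := mul_inv_cancel₀ hz
  have h2x : x + x = z + z⁻¹ := by rw [hx]; ring
  set p := ev x (P N) with hp
  set b := ((recA L P N).map (algebraMap ℝ 𝕜)).transpose * ev x (prevPoly P N) with hb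
  have h1 : ev z (psiHat L P N) = z ^ N • (p - (2 * z) • b) := hP.ev_psiHat N hz
  have h2 : ev z⁻¹ (psiHat L P N) = z⁻¹ ^ N • (p - (2 * z⁻¹) • b) := by
    rw [hP.ev_psiHat N (inv_ne_zero hz), inv_inv, add_comm z⁻¹]
  have hpow : z⁻¹ ^ N * z ^ N = 1 := by rw [← mul_pow, inv_mul_cancel₀ hz, one_pow]
  have h3 : ∀ m, z⁻¹ ^ (N + m) • ev z (psiHat L P N) = z⁻¹ ^ m • (p - (2 * z) • b) := by
    intro m
    rw [h1, smul_smul, pow_add, mul_right_comm, hpow, one_mul]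
  have h4 : ∀ m, z ^ (N + m) • ev z⁻¹ (psiHat L P N) = z ^ m • (p - (2 * z⁻¹) • b) := by
    intro m
    rw [h2, smul_smul, pow_add, mul_right_comm, mul_comm (z ^ N), hpow, one_mul]
  simp only [add_assoc N, h3, h4]
  have hsm : ∀ Q : Matrix (Fin l) (Fin l) ℝ[X], ev x ((X : ℝ[X]) • Q + (X : ℝ[X]) • Q) =
      (z + z⁻¹) • ev x Q := by
    intro Q
    rw [map_add, ev_smul, aeval_X, ← add_smul, h2x]
  have hz2 : z⁻¹ * z = 1 := inv_mul_cancel₀ hz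
  induction k using Nat.twoStepInduction with
  | zero =>
    rw [freePoly_zero, ← hp]
    ext i j
    simp only [Matrix.smul_apply, Matrix.sub_apply, smul_eq_mul]
    ring
  | one =>
    rw [freePoly, map_sub, hsm, map_add, map_mul, ev_map_C, Matrix.transpose_map, ← hb, ← hp]
    ext i j
    simp only [Matrix.smul_apply, Matrix.sub_apply, Matrix.add_apply, smul_eq_mul]
    linear_combination (2 * b i j * z⁻¹ - 2 * b i j * z) * hzw
  | more k ih1 ih2 =>
    rw [freePoly, map_sub, hsm, smul_sub, smul_comm, ih1, ih2]
    ext i j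
    simp only [Matrix.smul_apply, Matrix.sub_apply, smul_eq_mul]
    have e1 : z⁻¹ ^ (k + 2 + 1) = (z + z⁻¹) * z⁻¹ ^ (k + 1 + 1) - z⁻¹ ^ (k + 1) := by
      linear_combination (-z⁻¹ ^ (k + 1)) * hzw
    have e2 : z ^ (k + 2 + 1) = (z + z⁻¹) * z ^ (k + 1 + 1) - z ^ (k + 1) := by
      linear_combination (-z ^ (k + 1)) * hzw
    rw [e1, e2]
    ring

/-- The lower-degree term `T` lets the exceptional first step, which involves `A_N`, and the later
steps be treated alike. -/
theorem IsOrthonormalSeq.freePoly_degree (hP : IsOrthonormalSeq L P) (N k : ℕ) :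
    DegLT (freePoly L P N k) (N + k + 1) ∧ ∃ T, DegLT T (N + k) ∧ freePoly L P N (k + 1) =
      ((X : ℝ[X]) • freePoly L P N k + (X : ℝ[X]) • freePoly L P N k) - T := by
  induction k with
  | zero =>
    refine ⟨hP.degLT N, _, ((hP.prevPoly_degLT N).map_C_mul (recA L P N).transpose).add
      ((hP.prevPoly_degLT N).map_C_mul (recA L P N).transpose), ?_⟩
    rw [freePoly_zero, zero_add, freePoly]
  | succ k ih =>
    obtain ⟨h1, T, hT, h2⟩ := ih
    refine ⟨?_, freePoly L P N k, h1, by rw [freePoly]⟩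
    rw [h2]
    exact (h1.X_smul.add h1.X_smul).sub (hT.mono (by omega))

theorem IsOrthonormalSeq.coeffMat_freePoly (hP : IsOrthonormalSeq L P) (N k : ℕ) :
    coeffMat (freePoly L P N k) (N + k) = (2 : ℝ) ^ k • coeffMat (P N) N := by
  induction k with
  | zero => rw [freePoly_zero, pow_zero, one_smul, add_zero]
  | succ k ih =>
    obtain ⟨-, T, hT, h⟩ := hP.freePoly_degree N k
    rw [h, ← add_assoc, coeffMat_sub, coeffMat_add, coeffMat_X_smul_succ, ih, hT _ (by omega),
      sub_zero, pow_succ, mul_two, add_smul]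

theorem IsOrthonormalSeq.freePoly_lead (hP : IsOrthonormalSeq L P) (N k : ℕ) :
    IsLowerPos (coeffMat (freePoly L P N k) (N + k)) := by
  rw [hP.coeffMat_freePoly]
  exact (hP.lead N).smul (by positivity)

/-! ### The functional given by the weight and the masses -/

/-- The functional with density `2 / π √(1 - x²) W(x)⁻¹` on `(-1, 1)` and canonical weights. -/
def weightFunctional (F W : Matrix (Fin l) (Fin l) ℝ[X])
    (hint : ∀ (f : ℝ[X]) (i j : Fin l), IntervalIntegrable
      (fun x : ℝ => f.eval x * √(1 - x ^ 2) * (evalR W x)⁻¹ i j) MeasureTheory.volume (-1) 1) :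
    ℝ[X] →ₗ[ℝ] Matrix (Fin l) (Fin l) ℝ where
  toFun f := Matrix.of fun i j => 2 / Real.pi *
      (∫ x in (-1 : ℝ)..1, f.eval x * √(1 - x ^ 2) * (evalR W x)⁻¹ i j) +
      ∑ z ∈ zerosIn F, f.eval ((z + z⁻¹) / 2) * canonicalWeight F W z i j
  map_add' f g := by
    ext i j
    simp only [eval_add, add_mul, Matrix.of_apply, Matrix.add_apply, Finset.sum_add_distrib]
    rw [intervalIntegral.integral_add (hint f i j) (hint g i j)]
    ring
  map_smul' c f := by
    ext i j
    simp only [eval_smul, smul_eq_mul, mul_assoc, Matrix.of_apply, Matrix.smul_apply,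
      intervalIntegral.integral_const_mul, ← Finset.mul_sum, RingHom.id_apply]
    ring

theorem weightFunctional_apply (F W : Matrix (Fin l) (Fin l) ℝ[X])
    (hint : ∀ (f : ℝ[X]) (i j : Fin l), IntervalIntegrable
      (fun x : ℝ => f.eval x * √(1 - x ^ 2) * (evalR W x)⁻¹ i j) MeasureTheory.volume (-1) 1)
    (f : ℝ[X]) (i j : Fin l) :
    weightFunctional F W hint f i j = 2 / Real.pi *
      (∫ x in (-1 : ℝ)..1, f.eval x * √(1 - x ^ 2) * (evalR W x)⁻¹ i j) +
      ∑ z ∈ zerosIn F, f.eval ((z + z⁻¹) / 2) * canonicalWeight F W z i j := rfl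

theorem mul_mul_transpose_apply (A B D : Matrix (Fin l) (Fin l) ℝ) (a b : Fin l) :
    (A * B * D.transpose) a b = ∑ c, ∑ d, A a c * D b d * B c d := by
  simp only [Matrix.mul_apply, Matrix.transpose_apply, Finset.sum_mul]
  rw [Finset.sum_comm]
  exact Finset.sum_congr rfl fun c _ => Finset.sum_congr rfl fun d _ => by ring

theorem ip_weightFunctional (F W : Matrix (Fin l) (Fin l) ℝ[X])
    (hint : ∀ (f : ℝ[X]) (i j : Fin l), IntervalIntegrable
      (fun x : ℝ => f.eval x * √(1 - x ^ 2) * (evalR W x)⁻¹ i j) MeasureTheory.volume (-1) 1)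
    (g Q : Matrix (Fin l) (Fin l) ℝ[X]) (a b : Fin l) :
    ip (weightFunctional F W hint) g Q a b = 2 / Real.pi * (∫ x in (-1 : ℝ)..1, √(1 - x ^ 2) *
      (ev x g * (ev x W)⁻¹ * (ev x Q).transpose) a b) +
      ∑ s ∈ zerosIn F, (ev ((s + s⁻¹) / 2) g * canonicalWeight F W s *
        (ev ((s + s⁻¹) / 2) Q).transpose) a b := by
  simp only [ip_apply, weightFunctional_apply, Finset.sum_add_distrib, ← Finset.mul_sum]
  congr 1
  · congr 1
    simp_rw [← intervalIntegral.integral_finsetSum fun d (_ : d ∈ Finset.univ) => hint _ _ d]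
    rw [← intervalIntegral.integral_finsetSum]
    · refine intervalIntegral.integral_congr fun x _ => ?_
      simp only [mul_mul_transpose_apply, Finset.mul_sum, eval_mul, evalR_eq_ev, ev_apply,
        coe_aeval_eq_eval]
      exact Finset.sum_congr rfl fun c _ => Finset.sum_congr rfl fun d _ => by ring
    · intro c _
      have := IntervalIntegrable.sum Finset.univ fun d (_ : d ∈ Finset.univ) =>
        hint (g a c * Q b d) c d
      simpa only [Finset.sum_fn] using this
  · simp only [mul_mul_transpose_apply, ev_apply, coe_aeval_eq_eval, eval_mul]
    simp_rw [Finset.sum_comm (t := zerosIn F)]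

/-- The free continuation is orthogonal with respect to the weight functional. -/
theorem IsOrthonormalSeq.ip_weightFunctional_freePoly (hP : IsOrthonormalSeq L P)
    (hL : IsPositiveFunctional L) (N : ℕ) {W : Matrix (Fin l) (Fin l) ℝ[X]}
    (hW : IsWeightPoly (psiHat L P N) W)
    (hint : ∀ (f : ℝ[X]) (i j : Fin l), IntervalIntegrable
      (fun x : ℝ => f.eval x * √(1 - x ^ 2) * (evalR W x)⁻¹ i j) MeasureTheory.volume (-1) 1)
    {K : Matrix (Fin l) (Fin l) ℝ[X]} {q : ℝ[X]}
    (hK : psiHat L P N * K = (diskPoly (zerosIn (psiHat L P N)) * q) • 1)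
    (h0 : (0 : ℝ) ∉ zerosIn (psiHat L P N))
    (hS : ∀ s ∈ zerosIn (psiHat L P N), -1 < s ∧ s < 1)
    (hq : ∀ z : ℂ, ‖z‖ ≤ 1 → aeval z q ≠ 0) (k : ℕ) {Q : Matrix (Fin l) (Fin l) ℝ[X]}
    (hQ : DegLT Q (N + k + 1)) :
    ip (weightFunctional (psiHat L P N) W hint) (freePoly L P N k) Q =
      (coeffMat Q (N + k) * (coeffMat (freePoly L P N k) (N + k))⁻¹).transpose := by
  set F := psiHat L P N with hF
  set S := zerosIn F with hSdef
  set g := freePoly L P N k with hg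
  have hqr : ∀ s : ℝ, |s| ≤ 1 → q.eval s ≠ 0 := by
    intro s hs h
    refine hq s (by rwa [Complex.norm_real]) ?_
    rw [aeval_ofReal, h, Complex.ofReal_zero]
  ext a b
  rw [ip_weightFunctional, (hW.integral_eq_residues hK h0 hS hq
    (fun z hz => hP.ev_freePoly N k hz) hQ a b).2, add_assoc, ← Finset.sum_add_distrib]
  -- At each zero the residue cancels the mass: `ρ` is annihilated by `F(s)`, so only the `F(1/s) ρ`
  -- term of `g ρ` survives, and it equals a multiple of `K(s)ᵗ`.
  have hzero : ∑ s ∈ S, (((Q.map (pull (N + k)) * K) b a).eval s / q.eval s *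
      (s * ∏ t ∈ S.erase s, (s - t))⁻¹ + (ev ((s + s⁻¹) / 2) g * canonicalWeight F W s *
        (ev ((s + s⁻¹) / 2) Q).transpose) a b) = 0 := by
    refine Finset.sum_eq_zero fun s hs => ?_
    have hs0 : s ≠ 0 := fun h => h0 (h ▸ hs)
    obtain ⟨hs1, hs2⟩ := hS s hs
    have hsq : 1 - s ^ 2 ≠ 0 := by nlinarith
    set ϖ := ∏ t ∈ S.erase s, (s - t) with hϖ
    have hϖ0 : ϖ ≠ 0 := Finset.prod_ne_zero_iff.mpr fun t ht =>
      sub_ne_zero.mpr (Finset.ne_of_mem_erase ht).symm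
    have hqs := hqr s (abs_le.mpr ⟨hs1.le, hs2.le⟩)
    have hKs : F * K = ((X - C s) * ((1 - X ^ 2) * (∏ t ∈ S.erase s, (X - C t)) * q)) • 1 := by
      rw [hK, diskPoly, ← Finset.mul_prod_erase S _ hs]
      congr 1
      ring
    have hρ := hW.ev_inv_mul_canonicalWeight hs0 (fun h => hsq (by rw [h, sub_self]))
      (hP.det_canonicalMat_ne_zero hL N hW hs0 hs1 hs2) hKs
    have hh : ((1 - X ^ 2) * (∏ t ∈ S.erase s, (X - C t)) * q).eval s =
        (1 - s ^ 2) * ϖ * q.eval s := by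
      simp [eval_prod, hϖ]
    rw [hh] at hρ
    have hgs' := congrArg (fun M => (M * canonicalWeight F W s *
      (ev ((s + s⁻¹) / 2) Q).transpose) a b) (hP.ev_freePoly N k hs0)
    simp only [sub_mul _ _ (canonicalWeight F W s), smul_mul_assoc, ← hF, ev_mul_canonicalWeight,
      smul_zero, zero_sub, ← hg, neg_mul, Matrix.smul_apply, Matrix.neg_apply, smul_eq_mul] at hgs'
    have hρ' := congrArg (fun M => (M * (ev ((s + s⁻¹) / 2) Q).transpose) a b) hρ
    simp only [smul_mul_assoc, Matrix.smul_apply, smul_eq_mul] at hρ'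
    have hp : ((Q.map (pull (N + k)) * K) b a).eval s =
        s ^ (N + k) * ((ev s K).transpose * (ev ((s + s⁻¹) / 2) Q).transpose) a b := by
      rw [← Matrix.transpose_mul, Matrix.transpose_apply, ← coe_aeval_eq_eval, ← ev_apply, map_mul,
        ev_map_pull hQ hs0, smul_mul_assoc, Matrix.smul_apply, smul_eq_mul]
    rw [hp]
    generalize (ev ((s + s⁻¹) / 2) g * canonicalWeight F W s *
        (ev ((s + s⁻¹) / 2) Q).transpose) a b = y at *
    generalize ((ev s K).transpose * (ev ((s + s⁻¹) / 2) Q).transpose) a b = κ at *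
    generalize (ev s⁻¹ F * canonicalWeight F W s *
      (ev ((s + s⁻¹) / 2) Q).transpose) a b = u at *
    generalize q.eval s = r at *
    have hy : s * (ϖ * r * y) = -(s ^ (N + k) * κ) := by
      have e1 : (1 - s ^ 2) * y = -(s ^ (N + k + 1 + 1) * u) := by
        have : s * ((s⁻¹ - s) * y) = s * -(s ^ (N + k + 1) * u) := by rw [hgs']
        rw [← mul_assoc, mul_sub, mul_inv_cancel₀ hs0] at this
        linear_combination this
      have e2 : s ^ 3 * ((1 - s ^ 2) * ϖ * r * u) = (1 - s ^ 2) ^ 2 * κ := by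
        rw [hρ']
        field_simp
        ring
      refine mul_left_cancel₀ (pow_ne_zero 2 hsq) ?_
      linear_combination (s * ϖ * r * (1 - s ^ 2)) * e1 - s ^ (N + k) * e2
    field_simp
    linear_combination hy
  rw [hzero, add_zero]
  set κ := coeffMat g (N + k) with hκ
  have hlead : IsLowerPos κ := hP.freePoly_lead N k
  have hF0 : ev (0 : ℝ) F = (1 / 2 : ℝ) ^ (N + k) • κ := by
    rw [hF, ev_zero_psiHat, hκ, hg, hP.coeffMat_freePoly, smul_smul, pow_add, mul_assoc, ← mul_pow]
    norm_num
  set c := (∏ s ∈ S, (0 - s)) * q.eval 0 with hc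
  have hc0 : c ≠ 0 := by
    refine mul_ne_zero (Finset.prod_ne_zero_iff.mpr fun s hs => ?_) (hqr 0 (by simp))
    rw [sub_ne_zero]
    rintro rfl
    exact h0 hs
  -- Only the residue at `0` is left. Since `F(0)` is the leading coefficient of `g` up to a power
  -- of two, `K(0)` is a multiple of its inverse.
  have hK0 : (1 / 2 : ℝ) ^ (N + k) • ev (0 : ℝ) K = c • κ⁻¹ := by
    have h := congrArg (fun M => κ⁻¹ * ev (0 : ℝ) M) hK
    simp only [map_mul (ev (0 : ℝ)), ev_smul, map_one, hF0, smul_mul_assoc, mul_smul_comm, mul_one,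
      ← mul_assoc, hlead.inv_mul, one_mul] at h
    rw [h]
    congr 1
    simp [diskPoly, hc, eval_prod, coe_aeval_eq_eval]
  have hp0 : ((Q.map (pull (N + k)) * K) b a).eval 0 = c * (coeffMat Q (N + k) * κ⁻¹) b a := by
    rw [← coe_aeval_eq_eval, ← ev_apply, map_mul, ev_zero_map_pull, smul_mul_assoc, ← mul_smul_comm,
      hK0, mul_smul_comm, Matrix.smul_apply, smul_eq_mul]
  rw [hp0, Matrix.transpose_apply, hc]
  have hc1 := left_ne_zero_of_mul hc0
  have hc2 := right_ne_zero_of_mul hc0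
  field_simp

/-! ### Characterization of eventually constant recurrence coefficients -/

section Characterization

variable {M : ℝ[X] →ₗ[ℝ] Matrix (Fin l) (Fin l) ℝ}

theorem IsOrthonormalSeq.freePoly_eq (hP : IsOrthonormalSeq L P) (hL : IsPositiveFunctional L)
    {N : ℕ} (h : ∀ n, N ≤ n → recA L P (n + 1) = (1 / 2 : ℝ) • (1 : Matrix (Fin l) (Fin l) ℝ) ∧
      recB L P n = 0) (k : ℕ) : freePoly L P N k = P (N + k) := by
  have hhalf : ((1 / 2 : ℝ) • (1 : Matrix (Fin l) (Fin l) ℝ)).map C +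
      ((1 / 2 : ℝ) • (1 : Matrix (Fin l) (Fin l) ℝ)).map C = (1 : Matrix (Fin l) (Fin l) ℝ[X]) := by
    rw [← Matrix.map_add _ (fun a b => C_add), ← add_smul]
    norm_num
  have hrec : ∀ n, N ≤ n → (X : ℝ[X]) • P n + (X : ℝ[X]) • P n - ((recA L P n).transpose.map C *
      prevPoly P n + (recA L P n).transpose.map C * prevPoly P n) = P (n + 1) := by
    intro n hn
    have h1 := hP.recurrence hL n
    rw [(h n hn).1, (h n hn).2, Matrix.map_zero _ C_0, zero_mul, add_zero] at h1
    have h2 : ((1 / 2 : ℝ) • (1 : Matrix (Fin l) (Fin l) ℝ)).map C * P (n + 1) +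
        ((1 / 2 : ℝ) • (1 : Matrix (Fin l) (Fin l) ℝ)).map C * P (n + 1) = P (n + 1) := by
      rw [← add_mul, hhalf, one_mul]
    rw [h1]
    conv_rhs => rw [← h2]
    abel
  induction k using Nat.twoStepInduction with
  | zero => rw [freePoly_zero, add_zero]
  | one => rw [freePoly, hrec N le_rfl]
  | more k ih1 ih2 =>
    rw [freePoly, ih1, ih2, ← add_assoc N, ← add_assoc N, ← hrec (N + k + 1) (by omega), prevPoly,
      (h (N + k) (by omega)).1, Matrix.transpose_smul, Matrix.transpose_one, ← add_mul, hhalf,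
      one_mul]

/-- Orthogonality propagates downwards along the recurrence. -/
theorem IsOrthonormalSeq.ip_of_degLT_pred (hP : IsOrthonormalSeq L P)
    (hL : IsPositiveFunctional L) {n : ℕ}
    (h1 : ∀ Q : Matrix (Fin l) (Fin l) ℝ[X], DegLT Q (n + 2) → ip M (P (n + 1)) Q =
      (coeffMat Q (n + 1) * (coeffMat (P (n + 1)) (n + 1))⁻¹).transpose)
    (h2 : ∀ Q : Matrix (Fin l) (Fin l) ℝ[X], DegLT Q (n + 3) → ip M (P (n + 2)) Q =
      (coeffMat Q (n + 2) * (coeffMat (P (n + 2)) (n + 2))⁻¹).transpose)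
    (Q : Matrix (Fin l) (Fin l) ℝ[X]) (hQ : DegLT Q (n + 1)) : ip M (P n) Q =
      (coeffMat Q n * (coeffMat (P n) n)⁻¹).transpose := by
  have hA := hP.recA_lowerPos hL n
  -- Pair the recurrence with `Q` and move `X` onto `Q`. As `Q` has degree at most `n`, the terms
  -- with `P (n + 2)` and `B` vanish, which leaves `A_{n+1}ᵗ ⟨P_n, Q⟩`.
  have h := congrArg (fun R => ip M R Q) (hP.recurrence hL (n + 1))
  simp only [ip_add_left, ip_map_C_mul_left, ip_X_smul, h1 _ hQ.X_smul,
    h1 _ (hQ.mono (by omega)), h2 _ (hQ.mono (by omega)), coeffMat_X_smul_succ,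
    hQ (n + 1) (by omega), hQ (n + 2) (by omega), zero_mul, Matrix.transpose_zero, mul_zero,
    zero_add, prevPoly] at h
  have hinv : (coeffMat (P (n + 1)) (n + 1))⁻¹ = (coeffMat (P n) n)⁻¹ * recA L P (n + 1) := by
    have e : recA L P (n + 1) = coeffMat (P n) n * (coeffMat (P (n + 1)) (n + 1))⁻¹ := by
      rw [hP.lead_eq hL n, mul_assoc, (hP.lead (n + 1)).mul_inv, mul_one]
    rw [e, ← mul_assoc, (hP.lead n).inv_mul, one_mul]
  rw [hinv, ← mul_assoc, Matrix.transpose_mul _ (recA L P (n + 1))] at h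
  have hcancel : (recA L P (n + 1))⁻¹.transpose * (recA L P (n + 1)).transpose = 1 := by
    rw [← Matrix.transpose_mul, hA.mul_inv, Matrix.transpose_one]
  have h3 := congrArg (fun R => (recA L P (n + 1))⁻¹.transpose * R) h
  simp only [← mul_assoc, hcancel, one_mul] at h3
  exact h3.symm

/-- The hypothesis is the pairing that `L` itself satisfies. Once it reaches every `n`, the two
functionals agree against `1` on all left combinations of the `P n`, hence on all polynomials. -/
theorem IsOrthonormalSeq.functional_eq (hP : IsOrthonormalSeq L P) (hL : IsPositiveFunctional L)
    {N : ℕ} (h : ∀ n, N ≤ n → ∀ Q : Matrix (Fin l) (Fin l) ℝ[X], DegLT Q (n + 1) →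
      ip M (P n) Q = (coeffMat Q n * (coeffMat (P n) n)⁻¹).transpose) : L = M := by
  have hall : ∀ n, ∀ Q : Matrix (Fin l) (Fin l) ℝ[X], DegLT Q (n + 1) →
      ip M (P n) Q = (coeffMat Q n * (coeffMat (P n) n)⁻¹).transpose := by
    -- Downward induction on `n`, with `j` bounding the distance below `N`.
    have : ∀ j n, N ≤ n + j → ∀ Q : Matrix (Fin l) (Fin l) ℝ[X], DegLT Q (n + 1) →
        ip M (P n) Q = (coeffMat Q n * (coeffMat (P n) n)⁻¹).transpose := by
      intro j
      induction j with
      | zero => exact h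
      | succ j ih =>
        intro n hn
        exact hP.ip_of_degLT_pred hL (ih (n + 1) (by omega)) (ih (n + 2) (by omega))
    exact fun n => this N n (by omega)
  have hone : DegLT (1 : Matrix (Fin l) (Fin l) ℝ[X]) 1 := by
    intro k hk
    ext i j
    rcases eq_or_ne i j with rfl | hij
    · simp [coeffMat, coeff_one, Nat.ne_of_gt hk]
    · simp [coeffMat, hij]
  have hip : ∀ m, ∀ Q : Matrix (Fin l) (Fin l) ℝ[X], DegLT Q m → ip L Q 1 = ip M Q 1 := by
    intro m
    induction m with
    | zero => intro Q hQ; rw [hQ.eq_zero, ip_zero_left, ip_zero_left]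
    | succ m ih =>
      intro Q hQ
      have h1 := ih _ (DegLT.reduce (hP.degLT m) (hP.lead m) hQ)
      have h2 : ip L (P m) 1 = ip M (P m) 1 := by
        rw [hP.ip_of_degLT (hone.mono (by omega)), hall m _ (hone.mono (by omega))]
      rw [ip_sub_left, ip_sub_left, ip_map_C_mul_left, ip_map_C_mul_left, h2] at h1
      exact sub_left_injective h1
  refine LinearMap.ext fun f => ?_
  rw [← ip_one_left_smul L, ← ip_one_left_smul M]
  exact hip (matDegree (f • (1 : Matrix (Fin l) (Fin l) ℝ[X])) + 1) _ (matDegree_le_iff.mp le_rfl)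

/-- Orthogonality to lower degrees gives `P = A g` with `A` a quotient of leading coefficients;
normalization makes `A` orthogonal, and a lower triangular orthogonal matrix with positive diagonal
is `1`. -/
theorem IsOrthonormalSeq.eq_freePoly (hP : IsOrthonormalSeq L P) (hL : IsPositiveFunctional L)
    {N : ℕ} (k : ℕ) (h : ∀ Q : Matrix (Fin l) (Fin l) ℝ[X], DegLT Q (N + k + 1) →
      ip L (freePoly L P N k) Q =
        (coeffMat Q (N + k) * (coeffMat (freePoly L P N k) (N + k))⁻¹).transpose) :
    P (N + k) = freePoly L P N k := by
  set g := freePoly L P N k with hg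
  set A := coeffMat (P (N + k)) (N + k) * (coeffMat g (N + k))⁻¹ with hA
  have hlow : IsLowerPos A := (hP.lead (N + k)).mul (hP.freePoly_lead N k).inv
  have h0 : P (N + k) - A.map C * g = 0 := by
    refine hP.eq_zero_of_ip (DegLT.reduce (hP.freePoly_degree N k).1 (hP.freePoly_lead N k)
      (hP.degLT (N + k))) fun j hj => ?_
    rw [← ip_transpose hL.symm, ip_sub_left, ip_map_C_mul_left,
      h _ ((hP.degLT j).mono (by omega)), hP.degLT j (N + k) (by omega), hP.ip_eq, if_neg (by omega)]
    simp
  rw [sub_eq_zero] at h0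
  have h1 : A * A.transpose = 1 := by
    rw [← h _ (hP.degLT (N + k)), ← ip_map_C_mul_left, ← h0, hP.ip_eq, if_pos rfl]
  rw [h0, hlow.eq_one (mul_eq_one_comm.mp h1)]
  simp

/-- Pair the free recurrence with `P n` and `P (n + 1)`; the lower-degree term drops out. -/
theorem IsOrthonormalSeq.rec_of_eq_freePoly (hP : IsOrthonormalSeq L P)
    (hL : IsPositiveFunctional L) {N : ℕ} (h : ∀ k, P (N + k) = freePoly L P N k) (n : ℕ)
    (hn : N ≤ n) : recA L P (n + 1) = (1 / 2 : ℝ) • (1 : Matrix (Fin l) (Fin l) ℝ) ∧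
      recB L P n = 0 := by
  obtain ⟨k, rfl⟩ := Nat.exists_eq_add_of_le hn
  obtain ⟨-, T, hT, hrec⟩ := hP.freePoly_degree N k
  rw [← h, ← h, ← add_assoc] at hrec
  have hTn : ∀ m, N + k ≤ m → ip L T (P m) = 0 := by
    intro m hm
    rw [← ip_transpose hL.symm, hP.ip_eq_zero hm hT, Matrix.transpose_zero]
  have hB : ip L ((X : ℝ[X]) • P (N + k)) (P (N + k)) +
      ip L ((X : ℝ[X]) • P (N + k)) (P (N + k)) = 0 := by
    have h1 := congrArg (fun R => ip L R (P (N + k))) hrec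
    simp only [ip_sub_left, ip_add_left, hTn _ le_rfl, hP.ip_eq, sub_zero] at h1
    rw [← h1, if_neg (by omega)]
  have hA : ip L ((X : ℝ[X]) • P (N + k)) (P (N + k + 1)) +
      ip L ((X : ℝ[X]) • P (N + k)) (P (N + k + 1)) = 1 := by
    have h1 := congrArg (fun R => ip L R (P (N + k + 1))) hrec
    simp only [ip_sub_left, ip_add_left, hTn _ (Nat.le_succ _), hP.ip_eq, sub_zero] at h1
    rw [← h1, if_pos trivial]
  rw [recA_succ_eq, recB_eq]
  constructor
  · rw [← hA, ← two_smul ℝ, smul_smul]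
    norm_num
  · rw [← two_smul ℝ, smul_eq_zero_iff_right two_ne_zero] at hB
    exact hB

end Characterization

end

theorem IsOrthonormalSeq.det_psiHat_eval_zero {l : ℕ} {L : ℝ[X] →ₗ[ℝ] Matrix (Fin l) (Fin l) ℝ}
    {P : ℕ → Matrix (Fin l) (Fin l) ℝ[X]} (hP : IsOrthonormalSeq L P) (N : ℕ) :
    (psiHat L P N).det.eval 0 ≠ 0 := by
  rw [← coe_aeval_eq_eval, ← det_ev, ev_zero_psiHat, Matrix.det_smul]
  exact mul_ne_zero (by positivity) (hP.lead N).det_ne_zero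

end MatrixOP

/-! ### The main theorem. -/

open MatrixOP in
theorem theorem3p4 (l : ℕ) (L : ℝ[X] →ₗ[ℝ] Matrix (Fin l) (Fin l) ℝ)
    (hL : MatrixOP.IsPositiveFunctional L)
    (P : ℕ → Matrix (Fin l) (Fin l) ℝ[X]) (hP : MatrixOP.IsOrthonormalSeq L P) (N : ℕ) :
    -- nonsingular on the closed disk off `[-1, 0) ∪ (0, 1]`
    (∀ z : ℂ, ‖z‖ ≤ 1 → (¬ ∃ t : ℝ, t ≠ 0 ∧ -1 ≤ t ∧ t ≤ 1 ∧ (t : ℂ) = z) →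
      (MatrixOP.evalC (MatrixOP.psiHat L P N) z).det ≠ 0) ∧
    -- only simple zeros on `[-1, 0) ∪ (0, 1]`
    (∀ t : ℝ, t ≠ 0 → -1 ≤ t → t ≤ 1 →
      (MatrixOP.evalC (MatrixOP.psiHat L P N) (t : ℂ)).det = 0 →
      MatrixOP.HasSimpleZero (MatrixOP.evalC (MatrixOP.psiHat L P N)) (t : ℂ)) ∧
    -- `W_N` is well defined
    (∃! W : Matrix (Fin l) (Fin l) ℝ[X],
      MatrixOP.IsWeightPoly (MatrixOP.psiHat L P N) W) ∧
    (∀ W : Matrix (Fin l) (Fin l) ℝ[X], MatrixOP.IsWeightPoly (MatrixOP.psiHat L P N) W →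
      -- the integrand and the canonical weights are well defined, and the integrals converge
      (∀ x : ℝ, -1 < x → x < 1 → (MatrixOP.evalR W x).det ≠ 0) ∧
      (∀ (f : ℝ[X]) (i j : Fin l),
        IntervalIntegrable
          (fun x : ℝ => f.eval x * √(1 - x ^ 2) * (MatrixOP.evalR W x)⁻¹ i j)
          MeasureTheory.volume (-1) 1) ∧
      (∀ z ∈ MatrixOP.zerosIn (MatrixOP.psiHat L P N),
        (MatrixOP.canonicalMat (MatrixOP.psiHat L P N) W z).det ≠ 0) ∧
      -- the characterization
      ((∀ n, N ≤ n →
          MatrixOP.recA L P (n + 1) = (1 / 2 : ℝ) • (1 : Matrix (Fin l) (Fin l) ℝ) ∧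
          MatrixOP.recB L P n = 0) ↔
        ∀ (f : ℝ[X]) (i j : Fin l),
          L f i j =
            2 / Real.pi *
              (∫ x in (-1 : ℝ)..1, f.eval x * √(1 - x ^ 2) * (MatrixOP.evalR W x)⁻¹ i j) +
            ∑ z ∈ MatrixOP.zerosIn (MatrixOP.psiHat L P N),
              f.eval ((z + z⁻¹) / 2) *
                MatrixOP.canonicalWeight (MatrixOP.psiHat L P N) W z i j)) ∧
    -- the degree
    (MatrixOP.recA L P N ≠ (1 / 2 : ℝ) • (1 : Matrix (Fin l) (Fin l) ℝ) →
      MatrixOP.matDegree (MatrixOP.psiHat L P N) = 2 * N) ∧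
    (1 ≤ N → MatrixOP.recA L P N = (1 / 2 : ℝ) • (1 : Matrix (Fin l) (Fin l) ℝ) →
      MatrixOP.recB L P (N - 1) ≠ 0 →
      MatrixOP.matDegree (MatrixOP.psiHat L P N) = 2 * N - 1) := by
  set F := psiHat L P N with hF
  have h0 : F.det.eval 0 ≠ 0 := hP.det_psiHat_eval_zero N
  have hdet : F.det ≠ 0 := fun h => h0 (by rw [h, eval_zero])
  have hmem : ∀ s ∈ zerosIn F, F.det.eval s = 0 ∧ -1 < s ∧ s < 1 :=
    fun s hs => (mem_zerosIn hdet).mp hs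
  -- This single factorization serves the simple poles, the integrability and the residues.
  obtain ⟨K, q, hK, hq⟩ := exists_disk_denominator (hP.det_psiHat_ne_zero hL N)
    fun s hs hs1 hs2 => hP.no_double_zero hL N hs hs1 hs2
  refine ⟨hP.det_psiHat_ne_zero hL N,
    fun t _ h1 h2 h => hasSimpleZero_of_disk_denominator hdet hK hq h1 h2 h, ?_, fun W hW => ?_,
    hP.matDegree_psiHat hL N, fun hN hA hB => ?_⟩
  · obtain ⟨W, hW⟩ := hP.exists_isWeightPoly hL N
    exact ⟨W, hW, fun W' hW' => hW'.unique hW⟩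
  · have hint : ∀ (f : ℝ[X]) (i j : Fin l), IntervalIntegrable
        (fun x : ℝ => f.eval x * √(1 - x ^ 2) * (evalR W x)⁻¹ i j) MeasureTheory.volume (-1) 1 := by
      simpa only [evalR_eq_ev] using hW.intervalIntegrable hK (fun s hs => (hmem s hs).2) hq
    have hip := fun k Q => hP.ip_weightFunctional_freePoly hL N hW hint hK
      (fun h => h0 (hmem 0 h).1) (fun s hs => (hmem s hs).2) hq k (Q := Q)
    refine ⟨fun x h1 h2 => ?_, hint, fun s hs => ?_, fun h => ?_, fun h => ?_⟩
    · rw [evalR_eq_ev]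
      exact hW.det_ne_zero (fun z => hP.det_psiHat_ne_zero_of_im hL N) h1 h2
    · obtain ⟨hs0, hs1, hs2⟩ := hmem s hs
      exact hP.det_canonicalMat_ne_zero hL N hW (by rintro rfl; exact h0 hs0) hs1 hs2
    · have hLM : L = weightFunctional F W hint := hP.functional_eq hL (N := N) fun n hn Q hQ => by
        obtain ⟨k, rfl⟩ := Nat.exists_eq_add_of_le hn
        have := hip k Q hQ
        rwa [hP.freePoly_eq hL h k] at this
      intro f i j
      rw [hLM, weightFunctional_apply]
    · have hLM : L = weightFunctional F W hint :=
        LinearMap.ext fun f => Matrix.ext fun i j => h f i j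
      refine hP.rec_of_eq_freePoly hL fun k => hP.eq_freePoly hL k fun Q hQ => ?_
      have := hip k Q hQ
      rwa [← hLM] at this
  · obtain ⟨n, rfl⟩ := Nat.exists_eq_add_of_le' hN
    exact hP.matDegree_psiHat_of_half hL n hA hB
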